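/- Let $\mathcal H$ be a finite-dimensional complex Hilbert space, $\mathcal S(\mathcal H)$ the set of density operators on $\mathcal H$ (positive semidefinite, unit trace), $\mathcal X$ a nonempty finite alphabet, $\mathscr P(\mathcal X)$ the set of probability distributions on $\mathcal X$, and $\mathscr W:\mathcal X\to\mathcal S(\mathcal H)$, $x\mapsto W_x$, a classical-quantum channel. Logarithms are natural, $0\cdot\infty=0$, and powers $A^p$ of a positive semidefinite operator act on its nonzero eigenvalues only. Definitions. For positive semidefinite $\rho,\sigma$ let $D(\rho\|\sigma)=\operatorname{Tr}[\rho(\log\rho-\log\sigma)]$ if $\operatorname{supp}\rho\subseteq\operatorname{supp}\sigma$ and $+\infty$ otherwise. For $\alpha\in(0,1)$ and positive definite $\rho,\sigma$ let $$Q_\alpha(\rho\|\sigma)=\operatorname{Tr}[\rho^\alpha\sigma^{1-\alpha}],\qquad Q^\flat_\alpha(\rho\|\sigma)=\operatorname{Tr}\big[e^{\alpha\log\rho+(1-\alpha)\log\sigma}\big],$$ extended to positive semidefinite $\rho,\sigma$ as the limits for $\delta\downarrow0$ of the values at $(\rho+\delta\mathbb 1,\sigma+\delta\mathbb 1)$.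 Let $D_\alpha=\frac1{\alpha-1}\log Q_\alpha$ (Petz) and $D^\flat_\alpha=\frac1{\alpha-1}\log Q^\flat_\alpha$ (log-Euclidean), with $\log 0=-\infty$, and define the orders $\alpha=0,1$ by one-sided limits in $\alpha$. Put $$D(\mathscr V\|\mathscr W|P)=\sum_x P(x)D(V_x\|W_x),\quad D_\alpha(\mathscr W\|\sigma|P)=\sum_xP(x)D_\alpha(W_x\|\sigma),\quad D^\flat_\alpha(\mathscr W\|\sigma|P)=\sum_xP(x)D^\flat_\alpha(W_x\|\sigma),$$ $I(P,\mathscr V)=\inf_{\sigma\in\mathcal S(\mathcal H)}\sum_xP(x)D(V_x\|\sigma)$, and $$R_\infty=\sup_{P\in\mathscr P(\mathcal X)}\inf_{\sigma\in\mathcal S(\mathcal H)}D_0(P\circ\mathscr W\|P\otimes\sigma),\qquad P\circ\mathscr W=\sum_xP(x)|x\rangle\langle x|\otimes W_x,\quad P=\sum_x P(x)|x\rangle\langle x|.$$ The weak and strong sphere-packing exponents are $$\widetilde E_{\rm sp}(R,P)=\min_{\mathscr V:\mathcal X\to\mathcal S(\mathcal H)}\{D(\mathscr V\|\mathscr W|P):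 I(P,\mathscr V)\le R\},$$ $$E_{\rm sp}(R,P)=\sup_{s\ge0}\{E_0(s,P)-sR\},\quad E_0(s,P)=-\log\operatorname{Tr}\Big[\Big(\sum_xP(x)W_x^{1/(1+s)}\Big)^{1+s}\Big],\quad E_{\rm sp}(R)=\max_{P\in\mathscr P(\mathcal X)}E_{\rm sp}(R,P).$$ Theorem. Let $R$ be a real number with $R>R_\infty$. Then for every $P\in\mathscr P(\mathcal X)$ $$\widetilde E_{\rm sp}(R,P)=\sup_{0<\alpha\le1}\min_{\sigma\in\mathcal S(\mathcal H)}\frac{1-\alpha}{\alpha}\big(D^\flat_\alpha(\mathscr W\|\sigma|P)-R\big),$$ $$E_{\rm sp}(R,P)\le\sup_{0<\alpha\le1}\min_{\sigma\in\mathcal S(\mathcal H)}\frac{1-\alpha}{\alpha}\big(D_\alpha(\mathscr W\|\sigma|P)-R\big),$$ and $$E_{\rm sp}(R)=\max_{P\in\mathscr P(\mathcal X)}E_{\rm sp}(R,P)=\max_{P\in\mathscr P(\mathcal X)}\sup_{0<\alpha\le1}\min_{\sigma\in\mathcal S(\mathcal H)}\frac{1-\alpha}{\alpha}\big(D_\alpha(\mathscr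 W\|\sigma|P)-R\big).$$ All minima (over $\mathscr V$ and over $\sigma$) and both maxima over $P$ are attained. -/

import Mathlib

noncomputable section

namespace CQ

open Matrix Filter Topology
open scoped Kronecker ComplexOrder

/-- Density operators on the finite-dimensional Hilbert space with orthonormal basis indexed by
`n`: positive semidefinite complex matrices of unit trace. -/
abbrev State (n : Type*) [Fintype n] : Type _ :=
  {ρ : Matrix n n ℂ // ρ.PosSemidef ∧ ρ.trace = 1}

/-- Probability distributions on a finite alphabet. -/
abbrev Dist (X : Type*) [Fintype X] : Type _ := stdSimplex ℝ X

/-- A classical-quantum channel: each input letter is mapped to a density operator. -/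
abbrev Channel (X n : Type*) [Fintype n] : Type _ := X → State n

section Matrices

variable {m : Type*} [Fintype m] [DecidableEq m]

/-- Real powers `A ^ p = ∑_{a ≠ 0} a ^ p P_a` of a positive semidefinite matrix with eigenvalues
`a` and eigenprojections `P_a`; only the nonzero eigenvalues contribute, for every `p`. -/
def mpow (A : Matrix m m ℂ) (p : ℝ) : Matrix m m ℂ :=
  cfc (fun t : ℝ => if t = 0 then 0 else t ^ p) A

/-- Natural logarithm of a Hermitian matrix by spectral calculus. Kernel vectors are sent to `0`,
which is immaterial where it is used. -/
def mlog (A : Matrix m m ℂ) : Matrix m m ℂ := cfc Real.log A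

/-- Exponential of a Hermitian matrix by spectral calculus. -/
def mexp (A : Matrix m m ℂ) : Matrix m m ℂ := cfc Real.exp A

/-- The support of `A` is contained in the support of `B` (for Hermitian matrices, the support is
the range). -/
def SuppLE (A B : Matrix m m ℂ) : Prop :=
  LinearMap.range A.mulVecLin ≤ LinearMap.range B.mulVecLin

open Classical in
/-- Quantum relative entropy `D(A‖B) = Tr[A (log A - log B)]` if `A ≪ B`, and `+∞` otherwise. -/
def relEntropy (A B : Matrix m m ℂ) : EReal :=
  if SuppLE A B then (((A * (mlog A - mlog B)).trace.re : ℝ) : EReal) else ⊤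

/-- `Tr[A ^ α B ^ (1 - α)]`. -/
def petzQPos (α : ℝ) (A B : Matrix m m ℂ) : ℝ :=
  (mpow A α * mpow B (1 - α)).trace.re

/-- `Tr[exp(α log A + (1 - α) log B)]`, for positive definite `A`, `B`. -/
def logEuclideanQPos (α : ℝ) (A B : Matrix m m ℂ) : ℝ :=
  (mexp (α • mlog A + (1 - α) • mlog B)).trace.re

/-- `Q_α(A‖B)` for positive semidefinite `A`, `B`: the limit as `δ ↓ 0` of the value at
`A + δ 1`, `B + δ 1`. -/
def petzQ (α : ℝ) (A B : Matrix m m ℂ) : ℝ :=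
  limUnder (𝓝[>] (0 : ℝ)) fun δ =>
    petzQPos α (A + δ • (1 : Matrix m m ℂ)) (B + δ • (1 : Matrix m m ℂ))

/-- `Q^♭_α(A‖B)` for positive semidefinite `A`, `B`: the limit as `δ ↓ 0` of the value at
`A + δ 1`, `B + δ 1`. -/
def logEuclideanQ (α : ℝ) (A B : Matrix m m ℂ) : ℝ :=
  limUnder (𝓝[>] (0 : ℝ)) fun δ =>
    logEuclideanQPos α (A + δ • (1 : Matrix m m ℂ)) (B + δ • (1 : Matrix m m ℂ))

/-- `(α - 1)⁻¹ log q` as an extended real, with `log 0 = -∞`. -/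
def renyiOfQ (α q : ℝ) : EReal :=
  (((α - 1)⁻¹ : ℝ) : EReal) * ENNReal.log (ENNReal.ofReal q)

/-- The Rényi divergence of order `α ∈ [0, 1]` obtained from `α ↦ q α`: the value
`(α - 1)⁻¹ log (q α)` for `0 < α < 1`, and its one-sided limits at `α = 0` and `α = 1`. -/
def renyiDiv (q : ℝ → ℝ) (α : ℝ) : EReal :=
  if α = 0 then limUnder (𝓝[>] (0 : ℝ)) fun a => renyiOfQ a (q a)
  else if α = 1 then limUnder (𝓝[<] (1 : ℝ)) fun a => renyiOfQ a (q a)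
  else renyiOfQ α (q α)

/-- The Petz `α`-Rényi divergence `D_α(A‖B)`, `α ∈ [0, 1]`. -/
def petzDiv (α : ℝ) (A B : Matrix m m ℂ) : EReal := renyiDiv (fun a => petzQ a A B) α

/-- The log-Euclidean `α`-Rényi divergence `D^♭_α(A‖B)`, `α ∈ [0, 1]`. -/
def logEuclideanDiv (α : ℝ) (A B : Matrix m m ℂ) : EReal :=
  renyiDiv (fun a => logEuclideanQ a A B) α

end Matrices

section Channels

variable {X n : Type*} [Fintype X] [Fintype n] [DecidableEq n]

/-- Conditional relative entropy `D(V‖W|P) = ∑ₓ P(x) D(V_x‖W_x)` (with `0 · ∞ = 0`). -/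
def condRelEntropy (V W : Channel X n) (P : Dist X) : EReal :=
  ∑ x, ((P.1 x : ℝ) : EReal) * relEntropy (V x).1 (W x).1

/-- `D_α(W‖σ|P) = ∑ₓ P(x) D_α(W_x‖σ)`. -/
def condPetzDiv (α : ℝ) (W : Channel X n) (σ : State n) (P : Dist X) : EReal :=
  ∑ x, ((P.1 x : ℝ) : EReal) * petzDiv α (W x).1 σ.1

/-- `D^♭_α(W‖σ|P) = ∑ₓ P(x) D^♭_α(W_x‖σ)`. -/
def condLogEuclideanDiv (α : ℝ) (W : Channel X n) (σ : State n) (P : Dist X) : EReal :=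
  ∑ x, ((P.1 x : ℝ) : EReal) * logEuclideanDiv α (W x).1 σ.1

/-- Mutual information `I(P, W) = inf_σ D(W‖σ|P)`. -/
def mutualInfo (P : Dist X) (W : Channel X n) : EReal :=
  ⨅ σ : State n, condRelEntropy W (fun _ => σ) P

/-- The classical-quantum state `P ∘ W = ∑ₓ P(x) |x⟩⟨x| ⊗ W_x`. -/
def cqState [DecidableEq X] (P : Dist X) (W : Channel X n) : Matrix (X × n) (X × n) ℂ :=
  ∑ x, ((P.1 x : ℝ) : ℂ) • (Matrix.single x x (1 : ℂ) ⊗ₖ (W x).1)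

/-- The product state `P ⊗ σ`, where `P = ∑ₓ P(x) |x⟩⟨x|`. -/
def prodState [DecidableEq X] (P : Dist X) (σ : State n) : Matrix (X × n) (X × n) ℂ :=
  Matrix.diagonal (fun x => ((P.1 x : ℝ) : ℂ)) ⊗ₖ σ.1

/-- The `α`-Rényi mutual information `inf_σ D_α(P ∘ W‖P ⊗ σ)`. -/
def renyiInfo [DecidableEq X] (α : ℝ) (P : Dist X) (W : Channel X n) : EReal :=
  ⨅ σ : State n, petzDiv α (cqState P W) (prodState P σ)

/-- The Rényi capacity of order `α`. -/
def renyiCapacity [DecidableEq X] (α : ℝ) (W : Channel X n) : EReal :=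
  ⨆ P : Dist X, renyiInfo α P W

/-- `R_∞`, the Rényi capacity of order `0`. -/
def rateInfty [DecidableEq X] (W : Channel X n) : EReal := renyiCapacity 0 W

/-- The auxiliary function `E₀(s, P) = -log Tr[(∑ₓ P(x) W_x ^ (1/(1+s))) ^ (1+s)]`. -/
def auxE0 (W : Channel X n) (s : ℝ) (P : Dist X) : ℝ :=
  -Real.log (mpow (∑ x, P.1 x • mpow (W x).1 (1 / (1 + s))) (1 + s)).trace.re

/-- `E_sp(R, P) = sup_{s ≥ 0} (E₀(s, P) - s R)`. -/
def strongExponentAt (W : Channel X n) (R : ℝ) (P : Dist X) : EReal :=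
  ⨆ s ∈ Set.Ici (0 : ℝ), ((auxE0 W s P - s * R : ℝ) : EReal)

/-- The strong sphere-packing exponent `E_sp(R)`, the supremum of `E_sp(R, P)` over `P`. -/
def strongExponent (W : Channel X n) (R : ℝ) : EReal :=
  ⨆ P : Dist X, strongExponentAt W R P

/-- The weak sphere-packing exponent at a fixed input distribution: the infimum of `D(V‖W|P)` over
all channels `V` with `I(P, V) ≤ R`. -/
def weakExponentAt (W : Channel X n) (R : ℝ) (P : Dist X) : EReal :=
  ⨅ V ∈ {V : Channel X n | mutualInfo P V ≤ (R : EReal)}, condRelEntropy V W P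

/-- `((1 - α)/α) (D_α(W‖σ|P) - R)`. -/
def petzObjective (W : Channel X n) (R : ℝ) (P : Dist X) (α : ℝ) (σ : State n) : EReal :=
  (((1 - α) / α : ℝ) : EReal) * (condPetzDiv α W σ P - (R : EReal))

/-- `((1 - α)/α) (D^♭_α(W‖σ|P) - R)`. -/
def logEuclideanObjective (W : Channel X n) (R : ℝ) (P : Dist X) (α : ℝ) (σ : State n) : EReal :=
  (((1 - α) / α : ℝ) : EReal) * (condLogEuclideanDiv α W σ P - (R : EReal))

end Channels

end CQ

end

noncomputable section

namespace CQ

open Matrix Filter Topology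
open scoped Kronecker ComplexOrder

/-! ### Spectral calculus, overlaps of eigenbases, supports, compactness of the state space -/

section Spectral

variable {m : Type*} [Fintype m] [DecidableEq m]

/-! Both exponents are governed by a multiplier `s = (1 - α) / α`, that is, `α = 1 / (1 + s)`.

Weak exponent. The Gibbs variational principle for the Hermitian matrix `α log A + (1 - α) log B`
gives `-log Q^♭_α(A‖B) = min_τ (α D(τ‖A) + (1 - α) D(τ‖B))`; singular `A`, `B` are reached through
`A + δ 1`, `B + δ 1` and compactness (`exp_neg_le_logEuclideanQ`, `exists_state_le_neg_log`).
Averaged over the letters, `s D^♭_α(W‖σ|P)` becomes the minimum over `V` of `D(V‖W|P) + s D(V‖σ|P)`.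
Minimizing over `σ` turns the last term into `s I(P, V)`, so `min_σ s (D^♭_α(W‖σ|P) - R)` is the
Lagrange dual function of the weak exponent. There is no duality gap (`exists_le_of_lagrangian`),
because the channels supported under `W` form a compact convex set on which `D(V‖W|P)` and the
Holevo quantity `I(P, V)` are continuous and convex in `V`. Convexity of `I(P, V)` rests on joint
convexity of the relative entropy, which is proved by integrating the concavity of parallel sums.

Strong exponent. Hölder's inequality gives `E₀(s, P) ≤ -(1 + s) log ∑ₓ P(x) Q_α(W_x‖σ)` for every
`σ` (`auxE0_le`), and Jensen's inequality bounds the right side by `s D_α(W‖σ|P)`; this is the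
inequality at fixed `P`. Conversely, let `P` maximize `E₀(s, ·)` and let `σ` be the normalized power
`(∑ₓ P(x) W_x ^ α) ^ (1 / α)`. First-order optimality bounds `Q_α(W_x‖σ)` below by the same constant
for all letters (`exists_optimal_state`), hence `s D_α(W‖σ|P') ≤ E₀(s, P)` for every `P'`, and the
two maxima agree.

The hypothesis `R > R_∞` is used twice: it forces `R ≥ 0`, so that constant channels are feasible,
and it makes `E₀(s, P) - s R` nonpositive for all large `s` uniformly in `P`, so that the supremum
over `(s, P)` is attained on a compact set. -/

theorem isHermitian_cfc (f : ℝ → ℝ) (A : Matrix m m ℂ) : (cfc f A).IsHermitian :=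
  cfc_predicate f A

theorem continuousOn_spectrum (f : ℝ → ℝ) (A : Matrix m m ℂ) : ContinuousOn f (spectrum ℝ A) :=
  (Matrix.finite_real_spectrum (A := A)).continuousOn f

theorem cfc_eq_eigen {A : Matrix m m ℂ} (hA : A.IsHermitian) (f : ℝ → ℝ) :
    cfc f A = (hA.eigenvectorUnitary : Matrix m m ℂ) *
      diagonal (fun i => ((f (hA.eigenvalues i) : ℝ) : ℂ)) *
      star (hA.eigenvectorUnitary : Matrix m m ℂ) := by
  rw [hA.cfc_eq f, IsHermitian.cfc, Unitary.conjStarAlgAut_apply]; rfl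

theorem cfc_cfc {A : Matrix m m ℂ} (hA : A.IsHermitian) (f g : ℝ → ℝ) :
    cfc g (cfc f A) = cfc (fun t => g (f t)) A :=
  (cfc_comp g f A hA ((Matrix.finite_real_spectrum.image f).continuousOn g)
    (continuousOn_spectrum f A)).symm

theorem cfc_congr_eigen {A : Matrix m m ℂ} (hA : A.IsHermitian) {f g : ℝ → ℝ}
    (h : ∀ i, f (hA.eigenvalues i) = g (hA.eigenvalues i)) : cfc f A = cfc g A := by
  simp only [cfc_eq_eigen hA, h]

theorem cfc_add_smul_one {A : Matrix m m ℂ} (hA : A.IsHermitian) (f : ℝ → ℝ) (d : ℝ) :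
    cfc f (A + d • (1 : Matrix m m ℂ)) = cfc (fun t => f (t + d)) A := by
  have h : A + d • (1 : Matrix m m ℂ) = cfc (fun t => t + d) A := by
    have hA' : IsSelfAdjoint A := hA
    rw [cfc_add_const d (fun t => t) A (continuousOn_spectrum _ A), cfc_id' ℝ A,
      Algebra.algebraMap_eq_smul_one]
  rw [h, cfc_cfc hA]

theorem cfc_id_of_isHermitian {A : Matrix m m ℂ} (hA : A.IsHermitian) : cfc (id : ℝ → ℝ) A = A :=
  cfc_id ℝ A (show IsSelfAdjoint A from hA)

theorem cfc_one_of_isHermitian {A : Matrix m m ℂ} (hA : A.IsHermitian) :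
    cfc (fun _ : ℝ => (1 : ℝ)) A = 1 :=
  cfc_const_one ℝ A (show IsSelfAdjoint A from hA)

theorem exists_eq_conjTranspose_mul_self {A : Matrix m m ℂ} (hA : A.PosSemidef) :
    ∃ C : Matrix m m ℂ, A = Cᴴ * C := by
  open scoped MatrixOrder Matrix.Norms.L2Operator in
  exact CStarAlgebra.nonneg_iff_eq_star_mul_self.1 hA.nonneg

omit [Fintype m] in
theorem isHermitian_add_smul_one {A : Matrix m m ℂ} (hA : A.IsHermitian) (d : ℝ) :
    (A + d • (1 : Matrix m m ℂ)).IsHermitian := by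
  refine hA.add ?_
  rw [IsHermitian, conjTranspose_smul, conjTranspose_one, star_trivial]

/-- The diagonal entries of `A` in the eigenbasis of `B`. -/
def diagIn {B : Matrix m m ℂ} (hB : B.IsHermitian) (A : Matrix m m ℂ) (j : m) : ℝ :=
  ((star (hB.eigenvectorUnitary : Matrix m m ℂ) * A * hB.eigenvectorUnitary) j j).re

/-- The squared moduli of the overlaps of the eigenvectors of two Hermitian matrices. -/
def overlap {A B : Matrix m m ℂ} (hA : A.IsHermitian) (hB : B.IsHermitian) (i j : m) : ℝ :=
  Complex.normSq ((star (hA.eigenvectorUnitary : Matrix m m ℂ) * hB.eigenvectorUnitary) i j)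

theorem trace_mul_cfc {B : Matrix m m ℂ} (hB : B.IsHermitian) (A : Matrix m m ℂ) (g : ℝ → ℝ) :
    (A * cfc g B).trace.re = ∑ j, g (hB.eigenvalues j) * diagIn hB A j := by
  have h : (A * cfc g B).trace = ((star (hB.eigenvectorUnitary : Matrix m m ℂ) * A *
      hB.eigenvectorUnitary) * diagonal (fun i => ((g (hB.eigenvalues i) : ℝ) : ℂ))).trace := by
    rw [cfc_eq_eigen hB, ← mul_assoc, trace_mul_comm]
    simp only [mul_assoc]
  rw [h, trace, Complex.re_sum]
  refine Finset.sum_congr rfl fun j _ => ?_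
  rw [diag_apply, mul_diagonal, Complex.re_mul_ofReal, mul_comm, diagIn]

theorem diagIn_nonneg {B : Matrix m m ℂ} (hB : B.IsHermitian) {A : Matrix m m ℂ}
    (hA : A.PosSemidef) (j : m) : 0 ≤ diagIn hB A j := by
  have h := (hA.conjTranspose_mul_mul_same (hB.eigenvectorUnitary : Matrix m m ℂ)).diag_nonneg
    (i := j)
  exact (Complex.nonneg_iff.1 h).1

theorem diagIn_add {B : Matrix m m ℂ} (hB : B.IsHermitian) (A A' : Matrix m m ℂ) (j : m) :
    diagIn hB (A + A') j = diagIn hB A j + diagIn hB A' j := by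
  simp [diagIn, mul_add, add_mul]

theorem diagIn_smul {B : Matrix m m ℂ} (hB : B.IsHermitian) (c : ℝ) (A : Matrix m m ℂ) (j : m) :
    diagIn hB (c • A) j = c * diagIn hB A j := by
  simp [diagIn]

theorem diagIn_sum {B : Matrix m m ℂ} (hB : B.IsHermitian) {ι : Type*} (s : Finset ι)
    (A : ι → Matrix m m ℂ) (j : m) : diagIn hB (∑ x ∈ s, A x) j = ∑ x ∈ s, diagIn hB (A x) j := by
  simp [diagIn, Finset.mul_sum, Finset.sum_mul, Matrix.sum_apply]

theorem continuous_diagIn {B : Matrix m m ℂ} (hB : B.IsHermitian) (j : m) :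
    Continuous fun A => diagIn hB A j := by
  unfold diagIn; fun_prop

theorem diagIn_cfc {A B : Matrix m m ℂ} (hA : A.IsHermitian) (hB : B.IsHermitian) (f : ℝ → ℝ)
    (j : m) : diagIn hB (cfc f A) j = ∑ i, f (hA.eigenvalues i) * overlap hA hB i j := by
  have h : star (hB.eigenvectorUnitary : Matrix m m ℂ) * cfc f A * hB.eigenvectorUnitary =
      star (star (hA.eigenvectorUnitary : Matrix m m ℂ) * hB.eigenvectorUnitary) *
      (diagonal (fun i => ((f (hA.eigenvalues i) : ℝ) : ℂ)) *
      (star (hA.eigenvectorUnitary : Matrix m m ℂ) * hB.eigenvectorUnitary)) := by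
    rw [cfc_eq_eigen hA, star_mul, star_star]
    simp only [mul_assoc]
  rw [diagIn, h, mul_apply, Complex.re_sum]
  refine Finset.sum_congr rfl fun i _ => ?_
  rw [diagonal_mul, star_apply, overlap, Complex.normSq_apply]
  simp
  ring

/-- Each matrix is expanded in its own eigenbasis. The weights `overlap` form a doubly stochastic
matrix, so trace inequalities for two noncommuting matrices reduce to scalar inequalities between
pairs of eigenvalues. -/
theorem trace_cfc_mul_cfc {A B : Matrix m m ℂ} (hA : A.IsHermitian) (hB : B.IsHermitian)
    (f g : ℝ → ℝ) : (cfc f A * cfc g B).trace.re =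
      ∑ j, ∑ i, f (hA.eigenvalues i) * g (hB.eigenvalues j) * overlap hA hB i j := by
  rw [trace_mul_cfc hB]
  refine Finset.sum_congr rfl fun j _ => ?_
  rw [diagIn_cfc hA, Finset.mul_sum]
  exact Finset.sum_congr rfl fun i _ => by ring

theorem trace_cfc {A : Matrix m m ℂ} (hA : A.IsHermitian) (f : ℝ → ℝ) :
    (cfc f A).trace.re = ∑ i, f (hA.eigenvalues i) := by
  have hs : star (hA.eigenvectorUnitary : Matrix m m ℂ) * hA.eigenvectorUnitary = 1 :=
    Unitary.coe_star_mul_self _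
  rw [cfc_eq_eigen hA, mul_assoc, trace_mul_comm, mul_assoc, hs, mul_one]
  simp [trace, Complex.re_sum]

theorem overlap_nonneg {A B : Matrix m m ℂ} (hA : A.IsHermitian) (hB : B.IsHermitian) (i j : m) :
    0 ≤ overlap hA hB i j := Complex.normSq_nonneg _

theorem sum_overlap_left {A B : Matrix m m ℂ} (hA : A.IsHermitian) (hB : B.IsHermitian) (j : m) :
    ∑ i, overlap hA hB i j = 1 := by
  have hs : star (hB.eigenvectorUnitary : Matrix m m ℂ) * hB.eigenvectorUnitary = 1 :=
    Unitary.coe_star_mul_self _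
  have h := diagIn_cfc hA hB (fun _ => 1) j
  rw [cfc_one_of_isHermitian hA, diagIn, mul_one, hs] at h
  simpa using h.symm

theorem overlap_comm {A B : Matrix m m ℂ} (hA : A.IsHermitian) (hB : B.IsHermitian) (i j : m) :
    overlap hA hB i j = overlap hB hA j i := by
  have h : star (hB.eigenvectorUnitary : Matrix m m ℂ) * hA.eigenvectorUnitary =
      star (star (hA.eigenvectorUnitary : Matrix m m ℂ) * hB.eigenvectorUnitary) := by
    rw [star_mul, star_star]
  rw [overlap, overlap, h, star_apply]
  exact (Complex.normSq_conj _).symm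

theorem sum_overlap_right {A B : Matrix m m ℂ} (hA : A.IsHermitian) (hB : B.IsHermitian) (i : m) :
    ∑ j, overlap hA hB i j = 1 := by
  simp only [overlap_comm hA hB]
  exact sum_overlap_left hB hA i

/-- Klein-type trace inequality: a scalar inequality `f(a) g(b) ≤ h(a) + k(b)` on the spectra
passes to the trace. -/
theorem trace_cfc_mul_cfc_le {A B : Matrix m m ℂ} (hA : A.IsHermitian) (hB : B.IsHermitian)
    {f g h k : ℝ → ℝ} (H : ∀ i j, f (hA.eigenvalues i) * g (hB.eigenvalues j) ≤
      h (hA.eigenvalues i) + k (hB.eigenvalues j)) :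
    (cfc f A * cfc g B).trace.re ≤ (cfc h A).trace.re + (cfc k B).trace.re := by
  rw [trace_cfc_mul_cfc hA hB, trace_cfc hA, trace_cfc hB]
  have e1 : ∑ i, h (hA.eigenvalues i) =
      ∑ j, ∑ i, h (hA.eigenvalues i) * overlap hA hB i j := by
    rw [Finset.sum_comm]
    refine Finset.sum_congr rfl fun i _ => ?_
    rw [← Finset.mul_sum, sum_overlap_right, mul_one]
  have e2 : ∑ j, k (hB.eigenvalues j) =
      ∑ j, ∑ i, k (hB.eigenvalues j) * overlap hA hB i j := by
    refine Finset.sum_congr rfl fun i _ => ?_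
    rw [← Finset.mul_sum, sum_overlap_left, mul_one]
  rw [e1, e2, ← Finset.sum_add_distrib]
  refine Finset.sum_le_sum fun j _ => ?_
  rw [← Finset.sum_add_distrib]
  refine Finset.sum_le_sum fun i _ => ?_
  rw [← add_mul]
  exact mul_le_mul_of_nonneg_right (H i j) (overlap_nonneg hA hB i j)

theorem trace_cfc_mul_cfc_mono {A B : Matrix m m ℂ} (hA : A.IsHermitian) (hB : B.IsHermitian)
    {f g f' g' : ℝ → ℝ} (H : ∀ i j, f (hA.eigenvalues i) * g (hB.eigenvalues j) ≤
      f' (hA.eigenvalues i) * g' (hB.eigenvalues j)) :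
    (cfc f A * cfc g B).trace.re ≤ (cfc f' A * cfc g' B).trace.re := by
  rw [trace_cfc_mul_cfc hA hB, trace_cfc_mul_cfc hA hB]
  exact Finset.sum_le_sum fun j _ => Finset.sum_le_sum fun i _ =>
    mul_le_mul_of_nonneg_right (H i j) (overlap_nonneg hA hB i j)

theorem posSemidef_cfc {A : Matrix m m ℂ} (hA : A.IsHermitian) {f : ℝ → ℝ}
    (h : ∀ i, 0 ≤ f (hA.eigenvalues i)) : (cfc f A).PosSemidef := by
  rw [cfc_eq_eigen hA]
  refine PosSemidef.mul_mul_conjTranspose_same (PosSemidef.diagonal fun i => ?_) _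
  exact Complex.zero_le_real.2 (h i)

theorem sum_eigenvalues_eq_trace_re {A : Matrix m m ℂ} (hA : A.IsHermitian) :
    ∑ i, hA.eigenvalues i = A.trace.re := by
  have := trace_cfc hA id
  rw [cfc_id_of_isHermitian hA] at this
  exact this.symm

theorem sum_diagIn {B : Matrix m m ℂ} (hB : B.IsHermitian) (A : Matrix m m ℂ) :
    ∑ j, diagIn hB A j = A.trace.re := by
  have := trace_mul_cfc hB A (fun _ => 1)
  rw [cfc_one_of_isHermitian hB, mul_one] at this
  simpa using this.symm

theorem State.eigenvalues_le_one (σ : State m) (i : m) : σ.2.1.1.eigenvalues i ≤ 1 := by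
  have h := sum_eigenvalues_eq_trace_re σ.2.1.1
  have h1 : (σ.1.trace).re = 1 := by rw [σ.2.2, Complex.one_re]
  rw [← h1, ← h]
  exact Finset.single_le_sum (fun j _ => σ.2.1.eigenvalues_nonneg j) (Finset.mem_univ i)

/-- With `N` the projection onto the kernel of `B`, the support condition is `N * A = 0`, which for
positive semidefinite `A` is the vanishing of `Tr (A N)`. The resulting equations are linear in `A`,
which makes the condition closed and stable under mixtures. -/
theorem suppLE_iff_diagIn {A B : Matrix m m ℂ} (hA : A.PosSemidef) (hB : B.IsHermitian) :
    SuppLE A B ↔ ∀ j, hB.eigenvalues j = 0 → diagIn hB A j = 0 := by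
  set N : Matrix m m ℂ := cfc (fun t : ℝ => if t = 0 then (1 : ℝ) else 0) B with hN
  have hBs : IsSelfAdjoint B := hB
  have hNN : N * N = N := by
    rw [hN, ← cfc_mul _ _ B (continuousOn_spectrum _ B) (continuousOn_spectrum _ B)]
    congr 1; ext t; by_cases h : t = 0 <;> simp [h]
  have hNH : N.IsHermitian := isHermitian_cfc _ _
  have hNB : N * B = 0 := by
    conv_lhs => rw [hN]; enter [2]; rw [← cfc_id' ℝ B]
    rw [← cfc_mul _ _ B (continuousOn_spectrum _ B) (continuousOn_spectrum _ B)]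
    rw [show (fun x : ℝ => (if x = 0 then (1 : ℝ) else 0) * x) = fun _ => 0 from by
      ext t; by_cases h : t = 0 <;> simp [h]]
    exact cfc_const_zero ℝ B
  have hN1 : 1 - N = B * cfc (fun t : ℝ => t⁻¹) B := by
    conv_rhs => enter [1]; rw [← cfc_id' ℝ B]
    rw [← cfc_mul _ _ B (continuousOn_spectrum _ B) (continuousOn_spectrum _ B), hN,
      ← cfc_const_one ℝ B, ← cfc_sub _ _ B (continuousOn_spectrum _ B) (continuousOn_spectrum _ B)]
    congr 1; ext t; by_cases h : t = 0 <;> simp [h]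
  have key : SuppLE A B ↔ N * A = 0 := by
    constructor
    · intro h
      refine Matrix.ext_of_mulVec_single fun j => ?_
      obtain ⟨u, hu⟩ := h (LinearMap.mem_range_self A.mulVecLin (Pi.single j 1))
      simp only [mulVecLin_apply] at hu
      rw [← mulVec_mulVec, ← hu, mulVec_mulVec, hNB]
      simp only [zero_mulVec]
    · rintro h _ ⟨v, rfl⟩
      have : A = B * (cfc (fun t : ℝ => t⁻¹) B * A) := by
        rw [← mul_assoc, ← hN1, sub_mul, h, one_mul, sub_zero]
      refine ⟨(cfc (fun t : ℝ => t⁻¹) B * A) *ᵥ v, ?_⟩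
      rw [mulVecLin_apply, mulVecLin_apply, mulVec_mulVec, ← this]
  have hP : (N * A * N).PosSemidef := by
    have := hA.conjTranspose_mul_mul_same N
    rwa [hNH.eq] at this
  have h3 : N * A = 0 ↔ (A * N).trace.re = 0 := by
    constructor
    · intro h
      rw [trace_mul_comm, h]; simp
    · intro h
      have h0 : (N * A * N).trace = 0 := by
        apply Complex.ext
        · rw [mul_assoc, trace_mul_comm, mul_assoc, hNN, h]; simp
        · exact (Complex.nonneg_iff.1 hP.trace_nonneg).2.symm
      -- Writing `A = Cᴴ * C` turns `N A N = 0` into `(C N)ᴴ (C N) = 0`, hence `C N = 0` and `N A =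
      -- 0`.
      rw [hP.trace_eq_zero_iff] at h0
      obtain ⟨C, rfl⟩ := exists_eq_conjTranspose_mul_self hA
      have h4 : (C * N)ᴴ * (C * N) = 0 := by
        rw [conjTranspose_mul, hNH.eq, ← h0]
        simp only [mul_assoc]
      have h5 : C * N = 0 := conjTranspose_mul_self_eq_zero.1 h4
      have h6 : N * Cᴴ = 0 := by
        rw [← hNH.eq, ← conjTranspose_mul, h5, conjTranspose_zero]
      rw [← mul_assoc, h6, zero_mul]
  rw [key, h3, trace_mul_cfc hB, Finset.sum_eq_zero_iff_of_nonneg]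
  · constructor
    · intro h j hj
      simpa [hj] using h j (Finset.mem_univ j)
    · intro h j _
      by_cases hj : hB.eigenvalues j = 0 <;> simp [hj, h j]
  · intro j _
    refine mul_nonneg ?_ (diagIn_nonneg _ hA j)
    split_ifs <;> norm_num

/-- The function may vary together with the matrix, as needed for exponents that depend on a
parameter. Near a given point all spectra lie in one compact ball, on which the functions converge
uniformly. -/
theorem continuous_cfc {Y : Type*} [TopologicalSpace Y] {u : Y → Matrix m m ℂ}
    (hu : Continuous u) (hH : ∀ y, (u y).IsHermitian) {f : Y → ℝ → ℝ}
    (hf : Continuous (Function.uncurry f)) : Continuous fun y => cfc (f y) (u y) := by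
  open scoped Matrix.Norms.L2Operator in
  rw [continuous_iff_continuousAt]
  intro y0
  set s : Set ℝ := Metric.closedBall 0 ((‖u y0‖ + 1) * ‖(1 : Matrix m m ℂ)‖) with hs
  have hsc : IsCompact s := isCompact_closedBall _ _
  have hev : ∀ᶠ y in 𝓝 y0, spectrum ℝ (u y) ⊆ s := by
    have : ∀ᶠ y in 𝓝 y0, ‖u y‖ < ‖u y0‖ + 1 :=
      (hu.norm.continuousAt.eventually_lt continuousAt_const (by simp))
    filter_upwards [this] with y hy
    refine (spectrum.subset_closedBall_norm_mul (𝕜 := ℝ) (u y)).trans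
      (Metric.closedBall_subset_closedBall ?_)
    gcongr
  have hc := continuousOn_cfc_setProd (A := Matrix m m ℂ) (p := IsSelfAdjoint) hsc
  have h1 : Tendsto (fun y => UniformOnFun.ofFun {s} (f y)) (𝓝 y0)
      (𝓝 (UniformOnFun.ofFun {s} (f y0))) := by
    rw [UniformOnFun.tendsto_iff_tendstoUniformlyOn]
    rintro _ rfl
    intro v hv
    obtain ⟨w, hw, h⟩ := hsc.mem_uniformity_of_prod (s := Set.univ) hf.continuousOn
      (Set.mem_univ y0) (symm_le_uniformity hv)
    rw [nhdsWithin_univ] at hw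
    filter_upwards [hw] with y hy x hx using h y hy x hx
  have hfc : ∀ y, Continuous (f y) := fun y => hf.comp (Continuous.prodMk_right y)
  have h2 : Tendsto (fun y => (UniformOnFun.ofFun {s} (f y), u y)) (𝓝 y0)
      (𝓝[{f | ContinuousOn (UniformOnFun.toFun {s} f) s} ×ˢ
        {a | IsSelfAdjoint a ∧ spectrum ℝ a ⊆ s}] (UniformOnFun.ofFun {s} (f y0), u y0)) := by
    rw [tendsto_nhdsWithin_iff]
    refine ⟨h1.prodMk_nhds (hu.tendsto y0), ?_⟩
    filter_upwards [hev] with y hy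
    exact ⟨(hfc y).continuousOn, hH y, hy⟩
  exact (hc (UniformOnFun.ofFun {s} (f y0), u y0)
    ⟨(hfc y0).continuousOn, hH y0, hev.self_of_nhds⟩).tendsto.comp h2

omit [DecidableEq m] in
theorem continuous_trace_re : Continuous fun A : Matrix m m ℂ => A.trace.re := by
  fun_prop

/-- The states are the image of the Frobenius unit sphere under `C ↦ Cᴴ * C`, and on that sphere
every entry has modulus at most one. -/
instance : CompactSpace (State m) := by
  suffices h : IsCompact {ρ : Matrix m m ℂ | ρ.PosSemidef ∧ ρ.trace = 1} from
    isCompact_iff_compactSpace.1 h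
  have hK : IsCompact {C : Matrix m m ℂ | (Cᴴ * C).trace.re = 1} := by
    have hb : IsCompact (Set.univ.pi fun _ : m => Set.univ.pi fun _ : m =>
        Metric.closedBall (0 : ℂ) 1) :=
      isCompact_univ_pi fun _ => isCompact_univ_pi fun _ => isCompact_closedBall _ _
    refine hb.of_isClosed_subset ?_ ?_
    · exact isClosed_eq (continuous_trace_re.comp (by fun_prop)) continuous_const
    · intro (C : Matrix m m ℂ) (hC : (Cᴴ * C).trace.re = 1) i _ j _
      rw [mem_closedBall_zero_iff]
      have h : ∑ j, ∑ i, ‖C i j‖ ^ 2 = 1 := by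
        rw [← hC, trace, Complex.re_sum]
        refine Finset.sum_congr rfl fun j _ => ?_
        rw [diag_apply, mul_apply, Complex.re_sum]
        refine Finset.sum_congr rfl fun i _ => ?_
        rw [conjTranspose_apply, ← Complex.normSq_eq_norm_sq, Complex.normSq_apply]
        simp
      have h1 : ‖C i j‖ ^ 2 ≤ ∑ j, ∑ i, ‖C i j‖ ^ 2 :=
        (Finset.single_le_sum (f := fun i => ‖C i j‖ ^ 2) (fun _ _ => by positivity)
          (Finset.mem_univ i)).trans
        (Finset.single_le_sum (f := fun j => ∑ i, ‖C i j‖ ^ 2)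
          (fun _ _ => Finset.sum_nonneg fun _ _ => by positivity) (Finset.mem_univ j))
      rw [h] at h1
      exact (sq_le_one_iff₀ (norm_nonneg _)).1 h1
  convert! hK.image (f := fun C : Matrix m m ℂ => Cᴴ * C) (by fun_prop) using 1
  ext ρ
  constructor
  · rintro ⟨h1, h2⟩
    obtain ⟨C, hC⟩ := exists_eq_conjTranspose_mul_self h1
    refine ⟨C, ?_, hC.symm⟩
    change (Cᴴ * C).trace.re = 1
    rw [← hC, h2, Complex.one_re]
  · rintro ⟨C, hC, rfl⟩
    have hp := posSemidef_conjTranspose_mul_self C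
    exact ⟨hp, Complex.ext hC (Complex.nonneg_iff.1 hp.trace_nonneg).2.symm⟩

end Spectral

/-! ### Joint convexity of the relative entropy through parallel sums -/

section JointConvexity

variable {m : Type*} [Fintype m] [DecidableEq m]

theorem trace_conj_diagonal (Z : Matrix m m ℂ) (d : m → ℝ) :
    (Zᴴ * diagonal (fun i => (d i : ℂ)) * Z).trace.re = ∑ j, ∑ i, d i * Complex.normSq (Z i j) := by
  rw [trace, Complex.re_sum]
  refine Finset.sum_congr rfl fun j _ => ?_
  rw [diag_apply, mul_assoc, mul_apply, Complex.re_sum]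
  refine Finset.sum_congr rfl fun i _ => ?_
  rw [diagonal_mul, conjTranspose_apply, Complex.normSq_apply]
  simp
  ring

/-- The unitary `U` is free, so the columns of `Z` may be read in the eigenbasis of a second matrix.
-/
theorem trace_conjTranspose_mul_mul {A : Matrix m m ℂ} (hA : A.IsHermitian)
    {U : Matrix m m ℂ} (hU : U * star U = 1) (Z : Matrix m m ℂ) : (Zᴴ * A * Z).trace.re = ∑ j, ∑ i, hA.eigenvalues i *
      Complex.normSq ((star (hA.eigenvectorUnitary : Matrix m m ℂ) * Z * U) i j) := by
  rw [← trace_conj_diagonal]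
  have h := cfc_eq_eigen hA id
  rw [cfc_id_of_isHermitian hA] at h
  have e : (star (hA.eigenvectorUnitary : Matrix m m ℂ) * Z * U)ᴴ *
      diagonal (fun i => ((hA.eigenvalues i : ℝ) : ℂ)) *
      (star (hA.eigenvectorUnitary : Matrix m m ℂ) * Z * U) =
      star U * (Zᴴ * A * Z) * U := by
    conv_rhs => rw [h]
    simp only [conjTranspose_mul, star_eq_conjTranspose, conjTranspose_conjTranspose, mul_assoc, id]
  rw [e, trace_mul_comm (star U * _) U, ← mul_assoc, hU, one_mul]

/-- The Kosaki quadratic form, whose minimum over `Y` is a parallel sum of `A / t` and `B`. -/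
def kosakiForm (t : ℝ) (A B Y : Matrix m m ℂ) : ℝ :=
  t⁻¹ * (Yᴴ * A * Y).trace.re + ((1 - Y) * B * (1 - Y)ᴴ).trace.re

/-- The trace form of the parallel sum of `A / t` (acting from the left) and `B` (acting from the
right). -/
def parallelTrace (t : ℝ) {A B : Matrix m m ℂ} (hA : A.IsHermitian) (hB : B.IsHermitian) : ℝ :=
  ∑ j, ∑ i, hA.eigenvalues i * hB.eigenvalues j / (hA.eigenvalues i + t * hB.eigenvalues j) *
    overlap hA hB i j

/-- In the eigenbases of `A` (rows) and `B` (columns) the quadratic form decouples into one scalar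
problem for each matrix entry of `Y`. -/
theorem kosakiForm_eq (t : ℝ) {A B : Matrix m m ℂ} (hA : A.IsHermitian) (hB : B.IsHermitian)
    (Y : Matrix m m ℂ) : kosakiForm t A B Y = ∑ j, ∑ i,
      (t⁻¹ * (hA.eigenvalues i * Complex.normSq
        ((star (hA.eigenvectorUnitary : Matrix m m ℂ) * Y * hB.eigenvectorUnitary) i j)) +
      hB.eigenvalues j * Complex.normSq
        ((star (hA.eigenvectorUnitary : Matrix m m ℂ) * hB.eigenvectorUnitary) i j -
        (star (hA.eigenvectorUnitary : Matrix m m ℂ) * Y * hB.eigenvectorUnitary) i j)) := by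
  have h1 := trace_conjTranspose_mul_mul hA
    (Unitary.coe_mul_star_self hB.eigenvectorUnitary) Y
  have h2 := trace_conjTranspose_mul_mul hB
    (Unitary.coe_mul_star_self hA.eigenvectorUnitary) (1 - Y)ᴴ
  rw [conjTranspose_conjTranspose, Finset.sum_comm] at h2
  rw [kosakiForm, h1, h2, Finset.mul_sum, ← Finset.sum_add_distrib]
  refine Finset.sum_congr rfl fun j _ => ?_
  rw [Finset.mul_sum, ← Finset.sum_add_distrib]
  refine Finset.sum_congr rfl fun i _ => ?_
  congr 2
  have : star (hB.eigenvectorUnitary : Matrix m m ℂ) * (1 - Y)ᴴ *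
      (hA.eigenvectorUnitary : Matrix m m ℂ) =
      (star (hA.eigenvectorUnitary : Matrix m m ℂ) * (hB.eigenvectorUnitary : Matrix m m ℂ) -
        star (hA.eigenvectorUnitary : Matrix m m ℂ) * Y *
          (hB.eigenvectorUnitary : Matrix m m ℂ))ᴴ := by
    simp only [star_eq_conjTranspose, conjTranspose_sub, conjTranspose_mul,
      conjTranspose_conjTranspose, conjTranspose_one, mul_sub, sub_mul, mul_assoc, mul_one]
  rw [this, conjTranspose_apply, ← Matrix.sub_apply]
  exact Complex.normSq_conj _

/-- After clearing denominators, the two sides differ by the square of `a y - t b (x - y)`, taken on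
real and imaginary parts separately. The minimizer is therefore `y = t b / (a + t b) * x`, the value
used in `parallel_scalar_eq`. -/
theorem parallel_scalar {a b t : ℝ} (ha : 0 ≤ a) (hb : 0 < b) (ht : 0 < t) (x y : ℂ) :
    a * b / (a + t * b) * Complex.normSq x ≤
      t⁻¹ * (a * Complex.normSq y) + b * Complex.normSq (x - y) := by
  have key : ∀ x y : ℝ, t * (a * b) * (x * x) ≤ (a + t * b) * (a * (y * y) +
      t * b * ((x - y) * (x - y))) := fun x y => by
    nlinarith [sq_nonneg (a * y - t * b * (x - y))]
  have hd : 0 < a + t * b := by positivity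
  have e : t⁻¹ * (a * Complex.normSq y) + b * Complex.normSq (x - y) =
      ((a + t * b) * (a * Complex.normSq y + t * b * Complex.normSq (x - y))) / (t * (a + t * b)) := by
    field_simp
  have e2 : a * b / (a + t * b) * Complex.normSq x =
      (t * (a * b) * Complex.normSq x) / (t * (a + t * b)) := by
    field_simp
  rw [e, e2]
  refine div_le_div_of_nonneg_right ?_ (by positivity)
  simp only [Complex.normSq_apply, Complex.sub_re, Complex.sub_im]
  linarith [key x.re y.re, key x.im y.im]

theorem parallel_scalar_eq {a b t : ℝ} (ha : 0 ≤ a) (hb : 0 < b) (ht : 0 < t) (x : ℂ) :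
    t⁻¹ * (a * Complex.normSq (((t * b / (a + t * b) : ℝ) : ℂ) * x)) +
      b * Complex.normSq (x - ((t * b / (a + t * b) : ℝ) : ℂ) * x) =
    a * b / (a + t * b) * Complex.normSq x := by
  have hd : 0 < a + t * b := by positivity
  have : x - ((t * b / (a + t * b) : ℝ) : ℂ) * x = ((a / (a + t * b) : ℝ) : ℂ) * x := by
    have h : (a / (a + t * b) : ℝ) = 1 - t * b / (a + t * b) := by field_simp; ring
    rw [h]; push_cast; ring
  rw [this, Complex.normSq_mul, Complex.normSq_mul, Complex.normSq_ofReal, Complex.normSq_ofReal]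
  field_simp
  ring

theorem parallelTrace_le_kosakiForm {t : ℝ} (ht : 0 < t) {A B : Matrix m m ℂ} (hA : A.PosSemidef)
    (hB : B.PosDef) (Y : Matrix m m ℂ) : parallelTrace t hA.1 hB.1 ≤ kosakiForm t A B Y := by
  rw [kosakiForm_eq t hA.1 hB.1, parallelTrace]
  exact Finset.sum_le_sum fun j _ => Finset.sum_le_sum fun i _ =>
    parallel_scalar (hA.eigenvalues_nonneg i) (hB.eigenvalues_pos j) ht _ _

theorem exists_kosakiForm_eq {t : ℝ} (ht : 0 < t) {A B : Matrix m m ℂ} (hA : A.PosSemidef)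
    (hB : B.PosDef) : ∃ Y : Matrix m m ℂ, kosakiForm t A B Y = parallelTrace t hA.1 hB.1 := by
  set U : Matrix m m ℂ := (hA.1.eigenvectorUnitary : Matrix m m ℂ) with hU
  set V : Matrix m m ℂ := (hB.1.eigenvectorUnitary : Matrix m m ℂ) with hV
  set y : Matrix m m ℂ := of fun i j => (((t * hB.1.eigenvalues j /
    (hA.1.eigenvalues i + t * hB.1.eigenvalues j) : ℝ) : ℂ)) * (star U * V) i j with hy
  have hUU : star U * U = 1 := Unitary.coe_star_mul_self _
  have hVV : star V * V = 1 := Unitary.coe_star_mul_self _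
  refine ⟨U * y * star V, ?_⟩
  have e : star U * (U * y * star V) * V = y := by
    calc _ = (star U * U) * y * (star V * V) := by simp only [mul_assoc]
      _ = y := by rw [hUU, hVV, one_mul, mul_one]
  rw [kosakiForm_eq t hA.1 hB.1, parallelTrace, ← hU, ← hV, e]
  exact Finset.sum_congr rfl fun j _ => Finset.sum_congr rfl fun i _ =>
    parallel_scalar_eq (hA.eigenvalues_nonneg i) (hB.eigenvalues_pos j) ht _

theorem kosakiForm_combo (t p q : ℝ) (A₀ A₁ B₀ B₁ Y : Matrix m m ℂ) :
    kosakiForm t (p • A₀ + q • A₁) (p • B₀ + q • B₁) Y =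
      p * kosakiForm t A₀ B₀ Y + q * kosakiForm t A₁ B₁ Y := by
  simp only [kosakiForm, mul_add, add_mul, Matrix.mul_smul, Matrix.smul_mul, trace_add, trace_smul,
    Complex.add_re, Complex.smul_re, smul_eq_mul]
  ring

/-- A minimum over `Y` of functions linear in `(A, B)` is concave: the optimal `Y` of the mixture is
a trial point for both endpoints. -/
theorem parallelTrace_concave {t p q : ℝ} (ht : 0 < t) (hp : 0 ≤ p) (hq : 0 ≤ q)
    {A₀ A₁ B₀ B₁ : Matrix m m ℂ} (hA₀ : A₀.PosSemidef) (hA₁ : A₁.PosSemidef) (hB₀ : B₀.PosDef)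
    (hB₁ : B₁.PosDef) (hA : (p • A₀ + q • A₁).PosSemidef) (hB : (p • B₀ + q • B₁).PosDef) :
    p * parallelTrace t hA₀.1 hB₀.1 + q * parallelTrace t hA₁.1 hB₁.1 ≤
      parallelTrace t hA.1 hB.1 := by
  obtain ⟨Y, hY⟩ := exists_kosakiForm_eq ht hA hB
  rw [← hY, kosakiForm_combo]
  exact add_le_add
    (mul_le_mul_of_nonneg_left (parallelTrace_le_kosakiForm ht hA₀ hB₀ Y) hp)
    (mul_le_mul_of_nonneg_left (parallelTrace_le_kosakiForm ht hA₁ hB₁ Y) hq)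

/-- Truncation of the integral representation of the relative entropy. -/
def truncEntropy (T : ℝ) {A B : Matrix m m ℂ} (hA : A.IsHermitian) (hB : B.IsHermitian) : ℝ :=
  ∑ j, ∑ i, hA.eigenvalues i * (Real.log (1 + T) + Real.log (hA.eigenvalues i) -
    Real.log (hA.eigenvalues i + T * hB.eigenvalues j)) * overlap hA hB i j

theorem truncEntropy_zero {A B : Matrix m m ℂ} (hA : A.IsHermitian) (hB : B.IsHermitian) :
    truncEntropy 0 hA hB = 0 := by
  simp [truncEntropy]

/-- This links entropy to parallel sums: the first term of the derivative is linear in `A` and the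
second is jointly concave, so the convexity defect of the truncated entropy has a nonnegative
derivative. -/
theorem hasDerivAt_truncEntropy {T : ℝ} (hT : 0 ≤ T) {A B : Matrix m m ℂ} (hA : A.PosSemidef)
    (hB : B.PosDef) : HasDerivAt (fun T => truncEntropy T hA.1 hB.1)
      (A.trace.re / (1 + T) - parallelTrace T hA.1 hB.1) T := by
  have e : A.trace.re / (1 + T) - parallelTrace T hA.1 hB.1 =
      ∑ j, ∑ i, (hA.1.eigenvalues i * (1 / (1 + T) - hB.1.eigenvalues j /
        (hA.1.eigenvalues i + T * hB.1.eigenvalues j))) * overlap hA.1 hB.1 i j := by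
    have h1 : A.trace.re = ∑ j, ∑ i, hA.1.eigenvalues i * overlap hA.1 hB.1 i j := by
      rw [Finset.sum_comm, ← sum_eigenvalues_eq_trace_re hA.1]
      refine Finset.sum_congr rfl fun i _ => ?_
      rw [← Finset.mul_sum, sum_overlap_right, mul_one]
    rw [h1, parallelTrace, Finset.sum_div, ← Finset.sum_sub_distrib]
    refine Finset.sum_congr rfl fun j _ => ?_
    rw [Finset.sum_div, ← Finset.sum_sub_distrib]
    refine Finset.sum_congr rfl fun i _ => ?_
    ring
  rw [e]
  refine HasDerivAt.fun_sum fun j _ => HasDerivAt.fun_sum fun i _ => HasDerivAt.mul_const ?_ _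
  -- For `a = 0` the logarithm of `a + T * b` is singular at `T = 0`, but the prefactor `a` removes
  -- the whole term.
  rcases (hA.eigenvalues_nonneg i).eq_or_lt with h0 | h0
  · simp only [← h0, zero_mul]
    exact hasDerivAt_const _ _
  · have hb := hB.eigenvalues_pos j
    refine HasDerivAt.const_mul _ (HasDerivAt.sub (HasDerivAt.add_const _ ?_) ?_)
    · exact ((hasDerivAt_id T).const_add 1).log (by simp; positivity)
    · refine HasDerivAt.log ?_ (by positivity)
      simpa using ((hasDerivAt_id T).mul_const (hB.1.eigenvalues j)).const_add (hA.1.eigenvalues i)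

theorem tendsto_log_truncation {a b : ℝ} (ha : 0 < a) (hb : 0 < b) :
    Tendsto (fun T => Real.log (1 + T) + Real.log a - Real.log (a + T * b)) atTop
      (𝓝 (Real.log a - Real.log b)) := by
  have h1 : Tendsto (fun T : ℝ => (T⁻¹ + 1) / (a * T⁻¹ + b)) atTop (𝓝 ((0 + 1) / (a * 0 + b))) :=
    (tendsto_inv_atTop_zero.add_const 1).div ((tendsto_inv_atTop_zero.const_mul a).add_const b)
      (by simp [hb.ne'])
  have h2 := (h1.log (by simp [hb.ne'])).add_const (Real.log a)
  have h3 : Real.log ((0 + 1) / (a * 0 + b)) + Real.log a = Real.log a - Real.log b := by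
    rw [zero_add, mul_zero, zero_add, one_div, Real.log_inv]; ring
  rw [h3] at h2
  refine h2.congr' ?_
  filter_upwards [eventually_gt_atTop 0] with T hT
  have : (T⁻¹ + 1) / (a * T⁻¹ + b) = (1 + T) / (a + T * b) := by field_simp
  rw [this, Real.log_div (by positivity) (by positivity)]
  ring

/-- The von Neumann functional `Tr[A log A]`. -/
def ent (A : Matrix m m ℂ) : ℝ := (A * mlog A).trace.re

theorem mul_cfc_self {A : Matrix m m ℂ} (hA : A.IsHermitian) (g : ℝ → ℝ) :
    A * cfc g A = cfc (fun t => t * g t) A := by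
  have hA' : IsSelfAdjoint A := hA
  rw [cfc_mul _ _ A (continuousOn_spectrum _ A) (continuousOn_spectrum _ A), cfc_id' ℝ A]

theorem ent_eq {A : Matrix m m ℂ} (hA : A.IsHermitian) :
    ent A = (cfc (fun t : ℝ => t * Real.log t) A).trace.re := by
  rw [ent, mlog, mul_cfc_self hA]

theorem ent_eq_sum {A : Matrix m m ℂ} (hA : A.IsHermitian) :
    ent A = ∑ i, hA.eigenvalues i * Real.log (hA.eigenvalues i) := by
  rw [ent_eq hA, trace_cfc hA]

theorem continuous_ent {Y : Type*} [TopologicalSpace Y] {u : Y → Matrix m m ℂ} (hu : Continuous u)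
    (hH : ∀ y, (u y).IsHermitian) : Continuous fun y => ent (u y) := by
  simp only [fun y => ent_eq (hH y)]
  refine continuous_trace_re.comp (continuous_cfc hu hH (f := fun _ t => t * Real.log t) ?_)
  exact Real.continuous_mul_log.comp continuous_snd

theorem trace_mul_cfc' {A B : Matrix m m ℂ} (hA : A.IsHermitian) (hB : B.IsHermitian)
    (g : ℝ → ℝ) : (A * cfc g B).trace.re =
      ∑ j, ∑ i, hA.eigenvalues i * g (hB.eigenvalues j) * overlap hA hB i j := by
  have := trace_cfc_mul_cfc hA hB id g
  rwa [cfc_id_of_isHermitian hA] at this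

theorem tendsto_truncEntropy {A B : Matrix m m ℂ} (hA : A.PosSemidef) (hB : B.PosDef) :
    Tendsto (fun T => truncEntropy T hA.1 hB.1) atTop (𝓝 (ent A - (A * mlog B).trace.re)) := by
  have e : ent A - (A * mlog B).trace.re = ∑ j, ∑ i, hA.1.eigenvalues i *
      (Real.log (hA.1.eigenvalues i) - Real.log (hB.1.eigenvalues j)) *
        overlap hA.1 hB.1 i j := by
    have h1 : ent A = ∑ j, ∑ i, hA.1.eigenvalues i * Real.log (hA.1.eigenvalues i) *
        overlap hA.1 hB.1 i j := by
      rw [Finset.sum_comm, ent_eq_sum hA.1]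
      refine Finset.sum_congr rfl fun i _ => ?_
      rw [← Finset.mul_sum, sum_overlap_right, mul_one]
    rw [h1, mlog, trace_mul_cfc' hA.1 hB.1, ← Finset.sum_sub_distrib]
    refine Finset.sum_congr rfl fun j _ => ?_
    rw [← Finset.sum_sub_distrib]
    refine Finset.sum_congr rfl fun i _ => ?_
    ring
  rw [e]
  refine tendsto_finsetSum _ fun j _ => tendsto_finsetSum _ fun i _ => Tendsto.mul_const _ ?_
  rcases (hA.eigenvalues_nonneg i).eq_or_lt with h0 | h0
  · simp only [← h0, zero_mul]
    exact tendsto_const_nhds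
  · exact (tendsto_log_truncation h0 (hB.eigenvalues_pos j)).const_mul _

omit [Fintype m] [DecidableEq m] in
theorem posDef_combo {p q : ℝ} (hp : 0 ≤ p) (hq : 0 ≤ q) (hpq : p + q = 1)
    {B₀ B₁ : Matrix m m ℂ} (hB₀ : B₀.PosDef) (hB₁ : B₁.PosDef) : (p • B₀ + q • B₁).PosDef := by
  rcases hp.eq_or_lt with h | h
  · have : q = 1 := by linarith
    rw [← h, this, zero_smul, one_smul, zero_add]; exact hB₁
  · exact (hB₀.smul h).add_posSemidef (hB₁.posSemidef.smul hq)

omit [Fintype m] [DecidableEq m] in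
theorem posSemidef_combo {p q : ℝ} (hp : 0 ≤ p) (hq : 0 ≤ q)
    {B₀ B₁ : Matrix m m ℂ} (hB₀ : B₀.PosSemidef) (hB₁ : B₁.PosSemidef) :
    (p • B₀ + q • B₁).PosSemidef :=
  (hB₀.smul hp).add (hB₁.smul hq)

/-- Joint convexity of the quantum relative entropy. -/
theorem relEntropy_jointly_convex {p q : ℝ} (hp : 0 ≤ p) (hq : 0 ≤ q) (hpq : p + q = 1)
    {A₀ A₁ B₀ B₁ : Matrix m m ℂ} (hA₀ : A₀.PosSemidef) (hA₁ : A₁.PosSemidef) (hB₀ : B₀.PosDef)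
    (hB₁ : B₁.PosDef) :
    ent (p • A₀ + q • A₁) - ((p • A₀ + q • A₁) * mlog (p • B₀ + q • B₁)).trace.re ≤
      p * (ent A₀ - (A₀ * mlog B₀).trace.re) + q * (ent A₁ - (A₁ * mlog B₁).trace.re) := by
  have hA := posSemidef_combo hp hq hA₀ hA₁
  have hB := posDef_combo hp hq hpq hB₀ hB₁
  -- The convexity defect of the truncated entropy vanishes at `T = 0`, is monotone in `T`, and
  -- tends to the desired defect as `T → ∞`.
  set F : ℝ → ℝ := fun T => p * truncEntropy T hA₀.1 hB₀.1 + q * truncEntropy T hA₁.1 hB₁.1 -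
    truncEntropy T hA.1 hB.1 with hF
  have hd : ∀ T, 0 ≤ T → HasDerivAt F (p * (A₀.trace.re / (1 + T) - parallelTrace T hA₀.1 hB₀.1) +
      q * (A₁.trace.re / (1 + T) - parallelTrace T hA₁.1 hB₁.1) -
      ((p • A₀ + q • A₁).trace.re / (1 + T) - parallelTrace T hA.1 hB.1)) T := fun T hT =>
    (((hasDerivAt_truncEntropy hT hA₀ hB₀).const_mul p).add
      ((hasDerivAt_truncEntropy hT hA₁ hB₁).const_mul q)).sub (hasDerivAt_truncEntropy hT hA hB)
  have hmono : MonotoneOn F (Set.Ici 0) := by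
    refine monotoneOn_of_deriv_nonneg (convex_Ici 0)
      (fun T hT => (hd T hT).continuousAt.continuousWithinAt)
      (fun T hT => (hd T (interior_subset hT)).differentiableAt.differentiableWithinAt) ?_
    intro T hT
    rw [interior_Ici] at hT
    rw [(hd T (le_of_lt hT)).deriv]
    have h1 := parallelTrace_concave hT hp hq hA₀ hA₁ hB₀ hB₁ hA hB
    have h2 : (p • A₀ + q • A₁).trace.re = p * A₀.trace.re + q * A₁.trace.re := by
      simp [trace_add, trace_smul]
    rw [h2]
    have h3 : (p * A₀.trace.re + q * A₁.trace.re) / (1 + T) =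
      p * (A₀.trace.re / (1 + T)) + q * (A₁.trace.re / (1 + T)) := by ring
    rw [h3]; linarith
  have hpos : ∀ T, 0 ≤ T → 0 ≤ F T := fun T hT => by
    have := hmono (Set.mem_Ici.2 le_rfl) (Set.mem_Ici.2 hT) hT
    simpa [hF, truncEntropy_zero] using this
  have hlim : Tendsto F atTop (𝓝 (p * (ent A₀ - (A₀ * mlog B₀).trace.re) +
      q * (ent A₁ - (A₁ * mlog B₁).trace.re) - (ent (p • A₀ + q • A₁) -
        ((p • A₀ + q • A₁) * mlog (p • B₀ + q • B₁)).trace.re))) :=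
    (((tendsto_truncEntropy hA₀ hB₀).const_mul p).add
      ((tendsto_truncEntropy hA₁ hB₁).const_mul q)).sub (tendsto_truncEntropy hA hB)
  have := ge_of_tendsto hlim ((eventually_ge_atTop 0).mono hpos)
  linarith

/-- Joint convexity with both second arguments equal to the identity, whose logarithm is zero. -/
theorem ent_convex {p q : ℝ} (hp : 0 ≤ p) (hq : 0 ≤ q) (hpq : p + q = 1)
    {A₀ A₁ : Matrix m m ℂ} (hA₀ : A₀.PosSemidef) (hA₁ : A₁.PosSemidef) :
    ent (p • A₀ + q • A₁) ≤ p * ent A₀ + q * ent A₁ := by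
  have h := relEntropy_jointly_convex hp hq hpq hA₀ hA₁ (PosDef.one (n := m) (R := ℂ)) PosDef.one
  have h1 : mlog (1 : Matrix m m ℂ) = 0 := by
    rw [mlog, cfc_apply_one]; simp
  rwa [← add_smul, hpq, one_smul, h1, mul_zero, mul_zero, mul_zero, trace_zero, Complex.zero_re,
    sub_zero, sub_zero, sub_zero] at h

end JointConvexity

/-! ### Regularized relative entropy and the Gibbs variational principle -/

section Regularized

variable {m : Type*} [Fintype m] [DecidableEq m]

/-- The relative entropy of `A` with respect to the regularization `B + δ 1`. -/
def regEnt (δ : ℝ) (A B : Matrix m m ℂ) : ℝ :=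
  ent A - (A * mlog (B + δ • (1 : Matrix m m ℂ))).trace.re

/-- `Tr[A (log A - log B)]`. -/
def umegaki (A B : Matrix m m ℂ) : ℝ := (A * (mlog A - mlog B)).trace.re

theorem umegaki_eq (A B : Matrix m m ℂ) : umegaki A B = ent A - (A * mlog B).trace.re := by
  rw [umegaki, mul_sub, trace_sub, Complex.sub_re, ent]

theorem regEnt_eq {A B : Matrix m m ℂ} (hB : B.IsHermitian) (δ : ℝ) :
    regEnt δ A B = ent A - ∑ j, Real.log (hB.eigenvalues j + δ) * diagIn hB A j := by
  rw [regEnt, mlog, cfc_add_smul_one hB, trace_mul_cfc hB]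

theorem umegaki_eq_sum {A B : Matrix m m ℂ} (hB : B.IsHermitian) :
    umegaki A B = ent A - ∑ j, Real.log (hB.eigenvalues j) * diagIn hB A j := by
  rw [umegaki_eq, mlog, trace_mul_cfc hB]

theorem regEnt_anti {A B : Matrix m m ℂ} (hA : A.PosSemidef) (hB : B.PosSemidef) {δ δ' : ℝ}
    (hδ : 0 < δ) (h : δ ≤ δ') : regEnt δ' A B ≤ regEnt δ A B := by
  rw [regEnt_eq hB.1, regEnt_eq hB.1]
  refine sub_le_sub_left (Finset.sum_le_sum fun j _ =>
    mul_le_mul_of_nonneg_right (Real.log_le_log ?_ ?_) (diagIn_nonneg _ hA j)) _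
  · linarith [hB.eigenvalues_nonneg j]
  · linarith

/-- Klein's inequality from `log u ≤ u - 1` with `u = (b + δ) / a`. It yields nonnegativity as `δ ↓
0` and a lower bound that is uniform for `δ ≤ 1`. -/
theorem regEnt_ge {A B : Matrix m m ℂ} (hA : A.PosSemidef) (hB : B.PosSemidef) {δ : ℝ}
    (hδ : 0 < δ) : A.trace.re - B.trace.re - δ * Fintype.card m ≤ regEnt δ A B := by
  have h := trace_cfc_mul_cfc_le hA.1 hB.1 (f := id) (g := fun t => Real.log (t + δ))
    (h := fun t => t * Real.log t - t) (k := fun t => t + δ) (fun i j => by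
      have ha := hA.eigenvalues_nonneg i
      have hb := hB.eigenvalues_nonneg j
      set a := hA.1.eigenvalues i
      set b := hB.1.eigenvalues j
      simp only [id]
      rcases ha.eq_or_lt with h0 | h0
      · rw [← h0]; simp; linarith
      · have hbd : 0 < b + δ := by linarith
        have := Real.log_le_sub_one_of_pos (div_pos hbd h0)
        rw [Real.log_div hbd.ne' h0.ne'] at this
        have h2 := mul_le_mul_of_nonneg_left this h0.le
        have h3 : a * ((b + δ) / a - 1) = b + δ - a := by field_simp
        rw [h3] at h2
        linarith)
  rw [cfc_id_of_isHermitian hA.1] at h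
  have e1 : (cfc (fun t : ℝ => t * Real.log t - t) A).trace.re = ent A - A.trace.re := by
    rw [trace_cfc hA.1, ent_eq_sum hA.1, ← sum_eigenvalues_eq_trace_re hA.1,
      Finset.sum_sub_distrib]
  have e2 : (cfc (fun t : ℝ => t + δ) B).trace.re = B.trace.re + δ * Fintype.card m := by
    rw [trace_cfc hB.1, ← sum_eigenvalues_eq_trace_re hB.1, Finset.sum_add_distrib]
    simp [mul_comm]
  rw [e1, e2] at h
  rw [regEnt, mlog, cfc_add_smul_one hB.1]
  linarith

theorem mlog_add_eq {B : Matrix m m ℂ} (hB : B.PosSemidef) (δ : ℝ) :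
    mlog (B + δ • (1 : Matrix m m ℂ)) = cfc (fun t : ℝ => Real.log (|t| + δ)) B := by
  rw [mlog, cfc_add_smul_one hB.1]
  -- The absolute value changes nothing on the spectrum and makes the function continuous on the
  -- whole line.
  exact cfc_congr_eigen hB.1 fun i => by rw [abs_of_nonneg (hB.eigenvalues_nonneg i)]

theorem continuous_mlog_add {Y : Type*} [TopologicalSpace Y] {v : Y → Matrix m m ℂ}
    (hv : Continuous v) (hV : ∀ y, (v y).PosSemidef) {δ : ℝ} (hδ : 0 < δ) :
    Continuous fun y => mlog (v y + δ • (1 : Matrix m m ℂ)) := by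
  simp only [fun y => mlog_add_eq (hV y) δ]
  refine continuous_cfc hv (fun y => (hV y).1) (f := fun _ t => Real.log (|t| + δ)) ?_
  exact ((continuous_abs.comp continuous_snd).add_const δ).log fun p =>
    (add_pos_of_nonneg_of_pos (abs_nonneg _) hδ).ne'

theorem continuous_regEnt {Y : Type*} [TopologicalSpace Y] {u v : Y → Matrix m m ℂ}
    (hu : Continuous u) (hU : ∀ y, (u y).IsHermitian) (hv : Continuous v)
    (hV : ∀ y, (v y).PosSemidef) {δ : ℝ} (hδ : 0 < δ) :
    Continuous fun y => regEnt δ (u y) (v y) :=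
  (continuous_ent hu hU).sub
    (continuous_trace_re.comp (hu.mul (continuous_mlog_add hv hV hδ)))

omit [Fintype m] in
theorem posDef_add_smul_one {B : Matrix m m ℂ} (hB : B.PosSemidef) {δ : ℝ} (hδ : 0 < δ) :
    (B + δ • (1 : Matrix m m ℂ)).PosDef :=
  PosDef.posSemidef_add hB (PosDef.one.smul hδ)

theorem regEnt_convex {p q : ℝ} (hp : 0 ≤ p) (hq : 0 ≤ q) (hpq : p + q = 1)
    {A₀ A₁ B₀ B₁ : Matrix m m ℂ} (hA₀ : A₀.PosSemidef) (hA₁ : A₁.PosSemidef)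
    (hB₀ : B₀.PosSemidef) (hB₁ : B₁.PosSemidef) {δ : ℝ} (hδ : 0 < δ) :
    regEnt δ (p • A₀ + q • A₁) (p • B₀ + q • B₁) ≤ p * regEnt δ A₀ B₀ + q * regEnt δ A₁ B₁ := by
  have h := relEntropy_jointly_convex hp hq hpq hA₀ hA₁ (posDef_add_smul_one hB₀ hδ)
    (posDef_add_smul_one hB₁ hδ)
  have e : p • (B₀ + δ • (1 : Matrix m m ℂ)) + q • (B₁ + δ • (1 : Matrix m m ℂ)) =
      p • B₀ + q • B₁ + δ • (1 : Matrix m m ℂ) := by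
    have : δ • (1 : Matrix m m ℂ) = p • δ • (1 : Matrix m m ℂ) + q • δ • (1 : Matrix m m ℂ) := by
      rw [← add_smul, hpq, one_smul]
    rw [smul_add, smul_add]
    conv_rhs => rw [this]
    abel
  rw [e] at h
  exact h

/-- The only divergent logarithms belong to zero eigenvalues of `B`, where `A` has no weight. -/
theorem tendsto_regEnt {A B : Matrix m m ℂ} (hA : A.PosSemidef) (hB : B.PosSemidef)
    (h : SuppLE A B) : Tendsto (fun δ => regEnt δ A B) (𝓝[>] 0) (𝓝 (umegaki A B)) := by
  simp only [regEnt_eq hB.1, umegaki_eq_sum hB.1]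
  refine tendsto_const_nhds.sub (tendsto_finsetSum _ fun j _ => ?_)
  by_cases hj : hB.1.eigenvalues j = 0
  · rw [(suppLE_iff_diagIn hA hB.1).1 h j hj]
    simp
  · refine Tendsto.mul_const _ (tendsto_nhdsWithin_of_tendsto_nhds ?_)
    have : Tendsto (fun δ => hB.1.eigenvalues j + δ) (𝓝 0) (𝓝 (hB.1.eigenvalues j + 0)) :=
      tendsto_const_nhds.add tendsto_id
    rw [add_zero] at this
    exact this.log hj

theorem regEnt_le_umegaki {A B : Matrix m m ℂ} (hA : A.PosSemidef) (hB : B.PosSemidef)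
    (h : SuppLE A B) {δ : ℝ} (hδ : 0 < δ) : regEnt δ A B ≤ umegaki A B := by
  refine ge_of_tendsto (tendsto_regEnt hA hB h) ?_
  filter_upwards [Ioc_mem_nhdsGT hδ] with d hd using regEnt_anti hA hB hd.1 hd.2

theorem umegaki_nonneg {ρ σ : State m} (h : SuppLE ρ.1 σ.1) : 0 ≤ umegaki ρ.1 σ.1 := by
  have h1 : Tendsto (fun δ : ℝ => -(δ * Fintype.card m)) (𝓝[>] 0) (𝓝 (-(0 * Fintype.card m))) :=
    ((tendsto_nhdsWithin_of_tendsto_nhds tendsto_id).mul_const _).neg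
  rw [zero_mul, neg_zero] at h1
  refine le_of_tendsto_of_tendsto h1 (tendsto_regEnt ρ.2.1 σ.2.1 h) ?_
  filter_upwards [self_mem_nhdsWithin] with δ hδ
  have := regEnt_ge ρ.2.1 σ.2.1 (Set.mem_Ioi.1 hδ)
  rw [ρ.2.2, σ.2.2] at this
  linarith

/-- Any weight of `A` on the kernel of `B` contributes a multiple of `-log δ`, which is unbounded.
-/
theorem suppLE_of_regEnt_le {A B : Matrix m m ℂ} (hA : A.PosSemidef) (hB : B.PosSemidef) {C : ℝ}
    (h : ∀ δ, 0 < δ → δ ≤ 1 → regEnt δ A B ≤ C) : SuppLE A B := by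
  rw [suppLE_iff_diagIn hA hB.1]
  intro j hj
  by_contra hne
  have hpos : 0 < diagIn hB.1 A j := lt_of_le_of_ne (diagIn_nonneg _ hA j) (Ne.symm hne)
  set S := ∑ k, Real.log (hB.1.eigenvalues k + 1) * diagIn hB.1 A k with hS
  -- At `δ = exp (-x)` the kernel direction adds `x * diagIn hB.1 A j` to the entropy, and the other
  -- logarithms are at most those in `S`. The quotient pushes the total past `C`; the maximum with
  -- `0` keeps `δ ≤ 1`.
  set x := max 0 ((C - ent A + S + 1) / diagIn hB.1 A j) with hx
  have hδ : 0 < Real.exp (-x) := Real.exp_pos _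
  have hδ1 : Real.exp (-x) ≤ 1 := Real.exp_le_one_iff.2 (by simp [hx])
  have h1 := h _ hδ hδ1
  rw [regEnt_eq hB.1] at h1
  have h2 : ∑ k, Real.log (hB.1.eigenvalues k + Real.exp (-x)) * diagIn hB.1 A k ≤
      S - x * diagIn hB.1 A j := by
    have : S - x * diagIn hB.1 A j = ∑ k, (Real.log (hB.1.eigenvalues k + 1) * diagIn hB.1 A k -
        if k = j then x * diagIn hB.1 A j else 0) := by
      rw [Finset.sum_sub_distrib]; simp [hS]
    rw [this]
    refine Finset.sum_le_sum fun k _ => ?_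
    split_ifs with hk
    · subst hk
      rw [hj, zero_add, zero_add, Real.log_exp, Real.log_one]
      linarith
    · rw [sub_zero]
      have hk := hB.eigenvalues_nonneg k
      refine mul_le_mul_of_nonneg_right (Real.log_le_log (by linarith) (by linarith))
        (diagIn_nonneg _ hA k)
  have h3 : C - ent A + S + 1 ≤ x * diagIn hB.1 A j := by
    rw [← div_le_iff₀ hpos]; exact le_max_right _ _
  linarith

theorem trace_mexp_pos [Nonempty m] {H : Matrix m m ℂ} (hH : H.IsHermitian) :
    0 < (mexp H).trace.re := by
  rw [mexp, trace_cfc hH]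
  exact Finset.sum_pos (fun _ _ => Real.exp_pos _) Finset.univ_nonempty

omit [DecidableEq m] in
theorem State.nonempty (τ : State m) : Nonempty m := by
  by_contra h
  rw [not_nonempty_iff] at h
  have := τ.2.2
  simp [trace] at this

/-- Gibbs variational principle, inequality. -/
theorem neg_log_trace_mexp_le {H : Matrix m m ℂ} (hH : H.IsHermitian) (τ : State m) :
    -Real.log (mexp H).trace.re ≤ ent τ.1 - (τ.1 * H).trace.re := by
  have := τ.nonempty
  set Z := (mexp H).trace.re with hZ
  have hZ0 : 0 < Z := trace_mexp_pos hH
  -- Klein's inequality against the Gibbs state of `H`, whose eigenvalues are `exp b / Z` and whose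
  -- logarithm is `H - log Z`.
  have h := trace_cfc_mul_cfc_le τ.2.1.1 hH (f := id) (g := fun t => t - Real.log Z)
    (h := fun t => t * Real.log t - t) (k := fun t => Real.exp t / Z) (fun i j => by
      have ha := τ.2.1.eigenvalues_nonneg i
      set a := τ.2.1.1.eigenvalues i
      set b := hH.eigenvalues j
      simp only [id]
      have hb : 0 < Real.exp b / Z := div_pos (Real.exp_pos b) hZ0
      rcases ha.eq_or_lt with h0 | h0
      · rw [← h0]; simp; positivity
      · have := Real.log_le_sub_one_of_pos (div_pos hb h0)
        rw [Real.log_div hb.ne' h0.ne', Real.log_div (Real.exp_pos b).ne' hZ0.ne',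
          Real.log_exp] at this
        have h2 := mul_le_mul_of_nonneg_left this h0.le
        have h3 : a * (Real.exp b / Z / a - 1) = Real.exp b / Z - a := by field_simp
        rw [h3] at h2
        linarith)
  have h1 : (τ.1.trace).re = 1 := by rw [τ.2.2, Complex.one_re]
  rw [cfc_id_of_isHermitian τ.2.1.1] at h
  have e1 : (cfc (fun t : ℝ => t * Real.log t - t) τ.1).trace.re = ent τ.1 - 1 := by
    rw [trace_cfc τ.2.1.1, ent_eq_sum τ.2.1.1, ← h1, ← sum_eigenvalues_eq_trace_re τ.2.1.1,
      Finset.sum_sub_distrib]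
  have e2 : (cfc (fun t : ℝ => Real.exp t / Z) H).trace.re = 1 := by
    rw [trace_cfc hH, ← Finset.sum_div, ← trace_cfc hH, ← mexp, ← hZ, div_self hZ0.ne']
  have e3 : (τ.1 * cfc (fun t : ℝ => t - Real.log Z) H).trace.re =
      (τ.1 * H).trace.re - Real.log Z := by
    have : (τ.1 * H).trace.re = (τ.1 * cfc (id : ℝ → ℝ) H).trace.re := by
      rw [cfc_id_of_isHermitian hH]
    rw [this, trace_mul_cfc hH, trace_mul_cfc hH]
    simp only [sub_mul, Finset.sum_sub_distrib, id]
    rw [← Finset.mul_sum, sum_diagIn, h1, mul_one]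
  rw [e1, e2, e3] at h
  linarith

/-- Gibbs variational principle, attainment. -/
theorem exists_neg_log_trace_mexp_eq [Nonempty m] {H : Matrix m m ℂ} (hH : H.IsHermitian) :
    ∃ τ : State m, ent τ.1 - (τ.1 * H).trace.re = -Real.log (mexp H).trace.re := by
  set Z := (mexp H).trace.re with hZ
  have hZ0 : 0 < Z := trace_mexp_pos hH
  have hp : (cfc (fun t : ℝ => Real.exp t / Z) H).PosSemidef :=
    posSemidef_cfc hH fun i => by positivity
  have e2 : (cfc (fun t : ℝ => Real.exp t / Z) H).trace.re = 1 := by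
    rw [trace_cfc hH, ← Finset.sum_div, ← trace_cfc hH, ← mexp, ← hZ, div_self hZ0.ne']
  refine ⟨⟨cfc (fun t : ℝ => Real.exp t / Z) H, hp,
    Complex.ext e2 (Complex.nonneg_iff.1 hp.trace_nonneg).2.symm⟩, ?_⟩
  have e3 : (cfc (fun t : ℝ => Real.exp t / Z) H * H).trace.re =
      ∑ i, hH.eigenvalues i * (Real.exp (hH.eigenvalues i) / Z) := by
    rw [trace_mul_comm, mul_cfc_self hH, trace_cfc hH]
  rw [e3, ent_eq hp.1, cfc_cfc hH, trace_cfc hH, ← Finset.sum_sub_distrib]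
  rw [trace_cfc hH] at e2
  calc _ = ∑ i, (-Real.log Z) * (Real.exp (hH.eigenvalues i) / Z) := by
        refine Finset.sum_congr rfl fun i _ => ?_
        rw [Real.log_div (Real.exp_pos _).ne' hZ0.ne', Real.log_exp]
        ring
    _ = _ := by rw [← Finset.mul_sum, e2, mul_one]

end Regularized

/-! ### Variational formula for the log-Euclidean divergence -/

section LogEuclidean

variable {m : Type*} [Fintype m] [DecidableEq m]

/-- The convex combination of logarithms in the exponent of the log-Euclidean quantity. -/
def logEuclideanExponent (α δ : ℝ) (A B : Matrix m m ℂ) : Matrix m m ℂ :=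
  α • mlog (A + δ • (1 : Matrix m m ℂ)) + (1 - α) • mlog (B + δ • (1 : Matrix m m ℂ))

/-- `Q^♭_α` of the regularized pair. -/
def regQ (α : ℝ) (A B : Matrix m m ℂ) (δ : ℝ) : ℝ :=
  logEuclideanQPos α (A + δ • (1 : Matrix m m ℂ)) (B + δ • (1 : Matrix m m ℂ))

theorem isHermitian_logEuclideanExponent (α δ : ℝ) (A B : Matrix m m ℂ) :
    (logEuclideanExponent α δ A B).IsHermitian := by
  have h : ∀ (c : ℝ) (M : Matrix m m ℂ), M.IsHermitian → (c • M).IsHermitian := fun c M hM => by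
    rw [IsHermitian, conjTranspose_smul, hM.eq, star_trivial]
  exact (h _ _ (isHermitian_cfc _ _)).add (h _ _ (isHermitian_cfc _ _))

/-- The free energy of `τ` at this exponent is a weighted sum of two relative entropies, so the
Gibbs principle becomes the variational formula for `Q^♭`. -/
theorem regEnt_combo (α δ : ℝ) (τ A B : Matrix m m ℂ) :
    ent τ - (τ * logEuclideanExponent α δ A B).trace.re =
      α * regEnt δ τ A + (1 - α) * regEnt δ τ B := by
  simp only [logEuclideanExponent, regEnt, mul_add, Matrix.mul_smul, trace_add, trace_smul,
    Complex.add_re, Complex.smul_re, smul_eq_mul]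
  ring

theorem regQ_pos [Nonempty m] (α δ : ℝ) (A B : Matrix m m ℂ) : 0 < regQ α A B δ :=
  trace_mexp_pos (isHermitian_logEuclideanExponent α δ A B)

theorem neg_log_regQ_le (α δ : ℝ) (A B : Matrix m m ℂ) (τ : State m) :
    -Real.log (regQ α A B δ) ≤ α * regEnt δ τ.1 A + (1 - α) * regEnt δ τ.1 B := by
  rw [← regEnt_combo]
  exact neg_log_trace_mexp_le (isHermitian_logEuclideanExponent α δ A B) τ

theorem exists_neg_log_regQ_eq [Nonempty m] (α δ : ℝ) (A B : Matrix m m ℂ) :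
    ∃ τ : State m, α * regEnt δ τ.1 A + (1 - α) * regEnt δ τ.1 B = -Real.log (regQ α A B δ) := by
  obtain ⟨τ, hτ⟩ := exists_neg_log_trace_mexp_eq (isHermitian_logEuclideanExponent α δ A B)
  exact ⟨τ, by rw [← regEnt_combo]; exact hτ⟩

variable {α : ℝ} {A B : Matrix m m ℂ}

/-- The optimal `τ` at the smaller `δ` is a trial state at the larger one, where both relative
entropies have decreased. -/
theorem regQ_mono [Nonempty m] (h0 : 0 ≤ α) (h1 : α ≤ 1) (hA : A.PosSemidef) (hB : B.PosSemidef) :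
    MonotoneOn (regQ α A B) (Set.Ioi 0) := by
  intro δ hδ δ' _ hle
  obtain ⟨τ, hτ⟩ := exists_neg_log_regQ_eq α δ A B
  have h := neg_log_regQ_le α δ' A B τ
  have h2 := mul_le_mul_of_nonneg_left (regEnt_anti τ.2.1 hA hδ hle) h0
  have h3 := mul_le_mul_of_nonneg_left (regEnt_anti τ.2.1 hB hδ hle) (sub_nonneg.2 h1)
  exact (Real.log_le_log_iff (regQ_pos α δ A B) (regQ_pos α δ' A B)).1 (by linarith)

/-- Monotonicity and positivity give convergence to the infimum, so the limit in the definition of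
`logEuclideanQ` is a genuine one. -/
theorem tendsto_regQ [Nonempty m] (h0 : 0 ≤ α) (h1 : α ≤ 1) (hA : A.PosSemidef)
    (hB : B.PosSemidef) : Tendsto (regQ α A B) (𝓝[>] 0) (𝓝 (logEuclideanQ α A B)) := by
  have h := (regQ_mono h0 h1 hA hB).tendsto_nhdsGT (x := 0) ⟨0, by
    rintro _ ⟨δ, _, rfl⟩; exact (regQ_pos α δ A B).le⟩
  have : logEuclideanQ α A B = sInf (regQ α A B '' Set.Ioi 0) := h.limUnder_eq
  rwa [this]

theorem logEuclideanQ_le_regQ [Nonempty m] (h0 : 0 ≤ α) (h1 : α ≤ 1) (hA : A.PosSemidef)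
    (hB : B.PosSemidef) {δ : ℝ} (hδ : 0 < δ) : logEuclideanQ α A B ≤ regQ α A B δ := by
  refine le_of_tendsto (tendsto_regQ h0 h1 hA hB) ?_
  filter_upwards [Ioc_mem_nhdsGT hδ] with d hd using regQ_mono h0 h1 hA hB hd.1 hδ hd.2

theorem exp_neg_le_logEuclideanQ (h0 : 0 ≤ α) (h1 : α ≤ 1) (hA : A.PosSemidef)
    (hB : B.PosSemidef) (τ : State m) (hτA : SuppLE τ.1 A) (hτB : SuppLE τ.1 B) :
    Real.exp (-(α * umegaki τ.1 A + (1 - α) * umegaki τ.1 B)) ≤ logEuclideanQ α A B := by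
  have := τ.nonempty
  refine ge_of_tendsto (tendsto_regQ h0 h1 hA hB) ?_
  filter_upwards [self_mem_nhdsWithin] with δ hδ
  have h := neg_log_regQ_le α δ A B τ
  have h2 := mul_le_mul_of_nonneg_left (regEnt_le_umegaki τ.2.1 hA hτA hδ) h0
  have h3 := mul_le_mul_of_nonneg_left (regEnt_le_umegaki τ.2.1 hB hτB hδ) (sub_nonneg.2 h1)
  rw [← Real.le_log_iff_exp_le (regQ_pos α δ A B)]
  linarith

/-- The minimizers at positive `δ` are passed to `δ ↓ 0` by compactness: the sublevel sets `K δ` are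
closed, nonempty and decrease with `δ`, so they share a state. -/
theorem exists_state_le_neg_log [Nonempty m] (h0 : 0 < α) (h1 : α < 1) (hA : A.PosSemidef)
    (hB : B.PosSemidef) (hq : 0 < logEuclideanQ α A B) :
    ∃ τ : State m, SuppLE τ.1 A ∧ SuppLE τ.1 B ∧
      α * umegaki τ.1 A + (1 - α) * umegaki τ.1 B ≤ -Real.log (logEuclideanQ α A B) := by
  set C := -Real.log (logEuclideanQ α A B) with hC
  have hα : 0 < 1 - α := by linarith
  let K : {δ : ℝ // 0 < δ} → Set (State m) := fun δ =>
    {τ | α * regEnt δ.1 τ.1 A + (1 - α) * regEnt δ.1 τ.1 B ≤ C}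
  have hanti : ∀ {δ δ' : {δ : ℝ // 0 < δ}}, δ ≤ δ' → K δ ⊆ K δ' := fun {δ δ'} hle τ hτ => by
    have h2 := mul_le_mul_of_nonneg_left (regEnt_anti τ.2.1 hA δ.2 hle) h0.le
    have h3 := mul_le_mul_of_nonneg_left (regEnt_anti τ.2.1 hB δ.2 hle) hα.le
    have : α * regEnt δ.1 τ.1 A + (1 - α) * regEnt δ.1 τ.1 B ≤ C := hτ
    show α * regEnt δ'.1 τ.1 A + (1 - α) * regEnt δ'.1 τ.1 B ≤ C
    linarith
  have hclosed : ∀ δ, IsClosed (K δ) := fun δ => by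
    have hc : ∀ M : Matrix m m ℂ, M.PosSemidef →
        Continuous fun τ : State m => regEnt δ.1 τ.1 M := fun M hM =>
      continuous_regEnt continuous_subtype_val (fun τ => τ.2.1.1) continuous_const
        (fun _ => hM) δ.2
    exact isClosed_le (((hc A hA).const_mul α).add ((hc B hB).const_mul (1 - α)))
      continuous_const
  have hne : ∀ δ, (K δ).Nonempty := fun δ => by
    obtain ⟨τ, hτ⟩ := exists_neg_log_regQ_eq α δ.1 A B
    refine ⟨τ, hτ.le.trans ?_⟩
    exact neg_le_neg (Real.log_le_log hq (logEuclideanQ_le_regQ h0.le h1.le hA hB δ.2))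
  have : Nonempty {δ : ℝ // 0 < δ} := ⟨⟨1, one_pos⟩⟩
  obtain ⟨τ, hτ⟩ := IsCompact.nonempty_iInter_of_directed_nonempty_isCompact_isClosed K
    (fun δ δ' => ⟨min δ δ', hanti (min_le_left _ _), hanti (min_le_right _ _)⟩)
    hne (fun δ => (hclosed δ).isCompact) hclosed
  have hτ' : ∀ δ, 0 < δ → α * regEnt δ τ.1 A + (1 - α) * regEnt δ τ.1 B ≤ C := fun δ hδ =>
    Set.mem_iInter.1 hτ ⟨δ, hδ⟩
  -- Since each relative entropy is bounded below for `δ ≤ 1`, a bound on their weighted sum bounds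
  -- each of them separately and forces both support conditions.
  have hlow : ∀ M : Matrix m m ℂ, M.PosSemidef → ∀ δ, 0 < δ → δ ≤ 1 →
      τ.1.trace.re - M.trace.re - Fintype.card m ≤ regEnt δ τ.1 M := fun M hM δ hδ hδ1 => by
    have h := regEnt_ge τ.2.1 hM hδ
    have h2 : δ * Fintype.card m ≤ 1 * Fintype.card m :=
      mul_le_mul_of_nonneg_right hδ1 (Nat.cast_nonneg _)
    linarith
  have hsA : SuppLE τ.1 A := suppLE_of_regEnt_le τ.2.1 hA
    (C := (C - (1 - α) * (τ.1.trace.re - B.trace.re - Fintype.card m)) / α) fun δ hδ hδ1 => by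
      rw [le_div_iff₀ h0]
      have := mul_le_mul_of_nonneg_left (hlow B hB δ hδ hδ1) hα.le
      linarith [hτ' δ hδ]
  have hsB : SuppLE τ.1 B := suppLE_of_regEnt_le τ.2.1 hB
    (C := (C - α * (τ.1.trace.re - A.trace.re - Fintype.card m)) / (1 - α)) fun δ hδ hδ1 => by
      rw [le_div_iff₀ hα]
      have := mul_le_mul_of_nonneg_left (hlow A hA δ hδ hδ1) h0.le
      linarith [hτ' δ hδ]
  refine ⟨τ, hsA, hsB, ?_⟩
  refine le_of_tendsto (((tendsto_regEnt τ.2.1 hA hsA).const_mul α).add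
    ((tendsto_regEnt τ.2.1 hB hsB).const_mul (1 - α))) ?_
  filter_upwards [self_mem_nhdsWithin] with δ hδ using hτ' δ hδ

theorem renyiOfQ_of_pos {q : ℝ} (hq : 0 < q) :
    renyiOfQ α q = (((α - 1)⁻¹ * Real.log q : ℝ) : EReal) := by
  rw [renyiOfQ, ENNReal.log_ofReal_of_pos hq, EReal.coe_mul]

theorem renyiOfQ_of_nonpos (h1 : α < 1) {q : ℝ} (hq : q ≤ 0) : renyiOfQ α q = ⊤ := by
  rw [renyiOfQ, ENNReal.ofReal_of_nonpos hq, ENNReal.log_zero,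
    EReal.coe_mul_bot_of_neg (inv_lt_zero.2 (by linarith))]

theorem renyiOfQ_ne_bot (h1 : α < 1) (q : ℝ) : renyiOfQ α q ≠ ⊥ := by
  rcases le_or_gt q 0 with h | h
  · rw [renyiOfQ_of_nonpos h1 h]; exact top_ne_bot
  · rw [renyiOfQ_of_pos h]; exact EReal.coe_ne_bot _

theorem continuous_renyiOfQ (h1 : α < 1) : Continuous (renyiOfQ α) := by
  have hne : (α - 1)⁻¹ ≠ 0 := inv_ne_zero (by linarith)
  refine continuous_iff_continuousAt.2 fun q => ?_
  refine ContinuousAt.comp (f := fun q : ℝ => ((((α - 1)⁻¹ : ℝ) : EReal),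
    ENNReal.log (ENNReal.ofReal q))) (g := fun p : EReal × EReal => p.1 * p.2) ?_ ?_
  · exact EReal.continuousAt_mul (by simp [hne]) (by simp [hne]) (by simp) (by simp)
  · exact (continuous_const.prodMk
      (ENNReal.continuous_log.comp ENNReal.continuous_ofReal)).continuousAt

theorem renyiOfQ_anti (h1 : α < 1) : Antitone (renyiOfQ α) := by
  intro q q' h
  rcases le_or_gt q 0 with h0 | h0
  · rw [renyiOfQ_of_nonpos h1 h0]; exact le_top
  · rw [renyiOfQ_of_pos h0, renyiOfQ_of_pos (h0.trans_le h), EReal.coe_le_coe_iff]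
    exact mul_le_mul_of_nonpos_left (Real.log_le_log h0 h) (inv_nonpos.2 (by linarith))

theorem logEuclideanDiv_eq (h0 : 0 < α) (h1 : α < 1) (A B : Matrix m m ℂ) :
    logEuclideanDiv α A B = renyiOfQ α (logEuclideanQ α A B) := by
  rw [logEuclideanDiv, renyiDiv, if_neg h0.ne', if_neg h1.ne]

/-- The divergence is approximated from below by its regularizations, which are continuous in `σ`.
-/
theorem lowerSemicontinuous_logEuclideanDiv (h0 : 0 < α) (h1 : α < 1) (hA : A.PosSemidef) :
    LowerSemicontinuous fun σ : State m => logEuclideanDiv α A σ.1 := by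
  intro σ₀ y hy
  have := σ₀.nonempty
  simp only [logEuclideanDiv_eq h0 h1] at hy ⊢
  have ht := ((continuous_renyiOfQ h1).tendsto _).comp (tendsto_regQ h0.le h1.le hA σ₀.2.1)
  obtain ⟨δ, hδy, hδ⟩ := ((ht.eventually (lt_mem_nhds hy)).and self_mem_nhdsWithin).exists
  have hc : Continuous fun σ : State m => renyiOfQ α (regQ α A σ.1 δ) := by
    refine (continuous_renyiOfQ h1).comp (continuous_trace_re.comp ?_)
    refine continuous_cfc (f := fun _ => Real.exp) (u := fun σ : State m =>
      logEuclideanExponent α δ A σ.1) ?_ (fun σ => isHermitian_logEuclideanExponent _ _ _ _)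
      (Real.continuous_exp.comp continuous_snd)
    exact continuous_const.add ((continuous_mlog_add continuous_subtype_val
      (fun σ : State m => σ.2.1) hδ).const_smul (1 - α))
  filter_upwards [hc.continuousAt.eventually (lt_mem_nhds hδy)] with σ hσ
  exact hσ.trans_le (renyiOfQ_anti h1 (logEuclideanQ_le_regQ h0.le h1.le hA σ.2.1 hδ))

end LogEuclidean

/-! ### Extended-real averages with the convention `0 · ∞ = 0` -/

section WeightedSums

variable {X : Type*} [Fintype X]

theorem ereal_sum_ne_bot {ι : Type*} (s : Finset ι) {d : ι → EReal} (h : ∀ x ∈ s, d x ≠ ⊥) :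
    ∑ x ∈ s, d x ≠ ⊥ := by
  classical
  induction s using Finset.induction_on with
  | empty => simp
  | insert a s ha ih =>
    rw [Finset.sum_insert ha]
    exact EReal.add_ne_bot_iff.2 ⟨h a (Finset.mem_insert_self _ _),
      ih fun x hx => h x (Finset.mem_insert_of_mem hx)⟩

theorem ereal_coe_mul_ne_bot {c : ℝ} (hc : 0 ≤ c) {d : EReal} (hd : d ≠ ⊥) :
    (c : EReal) * d ≠ ⊥ := by
  rcases hc.eq_or_lt with h | h
  · simp [← h]
  · induction d with
    | bot => exact absurd rfl hd
    | top => rw [EReal.coe_mul_top_of_pos h]; exact top_ne_bot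
    | coe r => rw [← EReal.coe_mul]; exact EReal.coe_ne_bot _

theorem ereal_coe_sum {ι : Type*} (s : Finset ι) (r : ι → ℝ) :
    ((∑ x ∈ s, r x : ℝ) : EReal) = ∑ x ∈ s, (r x : EReal) :=
  map_sum (⟨⟨Real.toEReal, EReal.coe_zero⟩, EReal.coe_add⟩ : ℝ →+ EReal) r s

theorem weighted_sum_coe (P : Dist X) {d : X → EReal} {r : X → ℝ}
    (h : ∀ x, 0 < P.1 x → d x = (r x : EReal)) :
    ∑ x, ((P.1 x : ℝ) : EReal) * d x = ((∑ x, P.1 x * r x : ℝ) : EReal) := by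
  rw [ereal_coe_sum]
  refine Finset.sum_congr rfl fun x _ => ?_
  rcases (P.2.1 x).eq_or_lt with h0 | h0
  · simp [← h0]
  · rw [h x h0, EReal.coe_mul]

theorem weighted_sum_top (P : Dist X) {d : X → EReal} (hb : ∀ x, d x ≠ ⊥) {x : X}
    (hx : 0 < P.1 x) (hd : d x = ⊤) : ∑ x, ((P.1 x : ℝ) : EReal) * d x = ⊤ := by
  classical
  rw [← Finset.add_sum_erase _ _ (Finset.mem_univ x), hd, EReal.coe_mul_top_of_pos hx]
  exact EReal.top_add_of_ne_bot
    (ereal_sum_ne_bot _ fun y _ => ereal_coe_mul_ne_bot (P.2.1 y) (hb y))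

theorem lowerSemicontinuous_weighted_sum {Y : Type*} [TopologicalSpace Y] (P : Dist X)
    {d : X → Y → EReal} (hb : ∀ x y, d x y ≠ ⊥) (hl : ∀ x, LowerSemicontinuous (d x)) :
    LowerSemicontinuous fun y => ∑ x, ((P.1 x : ℝ) : EReal) * d x y := by
  classical
  have key : ∀ s : Finset X, LowerSemicontinuous fun y => ∑ x ∈ s, ((P.1 x : ℝ) : EReal) * d x y := by
    intro s
    induction s using Finset.induction_on with
    | empty => simpa using lowerSemicontinuous_const
    | insert a s ha ih =>
      simp only [Finset.sum_insert ha]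
      refine LowerSemicontinuous.add' ?_ ih fun y => ?_
      · rcases (P.2.1 a).eq_or_lt with h0 | h0
        · simpa [← h0] using lowerSemicontinuous_const
        · refine Continuous.comp_lowerSemicontinuous (g := fun z : EReal => ((P.1 a : ℝ) : EReal) * z)
            ?_ (hl a) fun u v h => mul_le_mul_of_nonneg_left h (EReal.coe_nonneg.2 h0.le)
          refine continuous_iff_continuousAt.2 fun z => ?_
          refine ContinuousAt.comp (f := fun z : EReal => (((P.1 a : ℝ) : EReal), z))
            (g := fun p : EReal × EReal => p.1 * p.2) ?_ (by fun_prop)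
          have h1 : ((P.1 a : ℝ) : EReal) ≠ 0 := by exact_mod_cast h0.ne'
          exact EReal.continuousAt_mul (Or.inl h1) (Or.inl h1) (by simp) (by simp)
      · have h1 : ((P.1 a : ℝ) : EReal) * d a y ≠ ⊥ := ereal_coe_mul_ne_bot (P.2.1 a) (hb a y)
        have h2 : ∑ x ∈ s, ((P.1 x : ℝ) : EReal) * d x y ≠ ⊥ :=
          ereal_sum_ne_bot _ fun x _ => ereal_coe_mul_ne_bot (P.2.1 x) (hb x y)
        exact EReal.continuousAt_add (Or.inr h2) (Or.inl h1)
  exact key Finset.univ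

theorem exists_eq_iInf_objective {Y : Type*} [TopologicalSpace Y] [CompactSpace Y] [Nonempty Y]
    {S : Y → EReal} (hS : LowerSemicontinuous S) {c : ℝ} (hc : 0 ≤ c) (R : ℝ) :
    ∃ y, (c : EReal) * (S y - (R : EReal)) = ⨅ z, (c : EReal) * (S z - (R : EReal)) := by
  obtain ⟨y, -, hy⟩ := LowerSemicontinuousOn.exists_isMinOn (s := (Set.univ : Set Y))
    Set.univ_nonempty isCompact_univ (hS.lowerSemicontinuousOn _)
  refine ⟨y, le_antisymm (le_iInf fun z => ?_) (iInf_le _ y)⟩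
  exact mul_le_mul_of_nonneg_left (EReal.sub_le_sub (hy (Set.mem_univ z)) le_rfl)
    (EReal.coe_nonneg.2 hc)

theorem coe_objective (c u R : ℝ) :
    (c : EReal) * ((u : EReal) - (R : EReal)) = ((c * (u - R) : ℝ) : EReal) := by
  norm_cast

end WeightedSums

/-! ### Lagrange duality -/

section Duality

/-- Lagrange duality for a convex-like problem with one constraint on a compact set. -/
theorem exists_le_of_lagrangian {Y : Type*} [TopologicalSpace Y] {K : Set Y} (hK : IsCompact K)
    {f g : Y → ℝ} (hf : Continuous f) (hg : Continuous g) (hf0 : ∀ y ∈ K, 0 ≤ f y)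
    (hconv : ∀ u ∈ K, ∀ v ∈ K, ∀ p q : ℝ, 0 ≤ p → 0 ≤ q → p + q = 1 →
      ∃ w ∈ K, f w ≤ p * f u + q * f v ∧ g w ≤ p * g u + q * g v)
    {M R : ℝ} (h : ∀ s : ℝ, 0 ≤ s → ∃ v ∈ K, f v + s * (g v - R) ≤ M) :
    ∃ v ∈ K, f v ≤ M ∧ g v ≤ R := by
  -- Relaxing both bounds by `ε` allows strict separation; compactness of `K` removes `ε` at the
  -- end.
  have hε : ∀ ε : ℝ, 0 < ε → ∃ v ∈ K, f v ≤ M + ε ∧ g v ≤ R + ε := by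
    intro ε hε
    by_contra hcon
    push Not at hcon
    -- If the relaxed problem had no solution, the open quadrant `Q` would miss the upward closed
    -- convex set `C` of achievable values. A separating functional `(lam, mu)` then provides the
    -- multiplier.
    set Q : Set (ℝ × ℝ) := Set.Iio (M + ε) ×ˢ Set.Iio (R + ε) with hQ
    set C : Set (ℝ × ℝ) := {z | ∃ v ∈ K, f v ≤ z.1 ∧ g v ≤ z.2} with hC
    have hCc : Convex ℝ C := by
      rintro z ⟨u, hu, hu1, hu2⟩ z' ⟨v, hv, hv1, hv2⟩ p q hp hq hpq
      obtain ⟨w, hw, hw1, hw2⟩ := hconv u hu v hv p q hp hq hpq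
      refine ⟨w, hw, hw1.trans ?_, hw2.trans ?_⟩
      · exact add_le_add (mul_le_mul_of_nonneg_left hu1 hp) (mul_le_mul_of_nonneg_left hv1 hq)
      · exact add_le_add (mul_le_mul_of_nonneg_left hu2 hp) (mul_le_mul_of_nonneg_left hv2 hq)
    have hdisj : Disjoint Q C := by
      rw [Set.disjoint_left]
      rintro z ⟨h1, h2⟩ ⟨v, hv, hv1, hv2⟩
      rw [Set.mem_Iio] at h1 h2
      have := hcon v hv (hv1.trans h1.le)
      linarith
    obtain ⟨φ, c, hφQ, hφC⟩ := geometric_hahn_banach_open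
      ((convex_Iio _).prod (convex_Iio _)) (isOpen_Iio.prod isOpen_Iio) hCc hdisj
    set lam := φ (1, 0) with hlam
    set mu := φ (0, 1) with hmu
    have hφ : ∀ a b : ℝ, φ (a, b) = a * lam + b * mu := fun a b => by
      have : ((a, b) : ℝ × ℝ) = a • (1, 0) + b • (0, 1) := by simp
      rw [this, map_add, map_smul, map_smul, smul_eq_mul, smul_eq_mul]
    have hQ' : ∀ a b : ℝ, 0 < a → 0 < b → (M + ε - a) * lam + (R + ε - b) * mu < c :=
      fun a b ha hb => by
        rw [← hφ]
        exact hφQ _ ⟨by simpa using ha, by simpa using hb⟩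
    have hC' : ∀ v ∈ K, c ≤ f v * lam + g v * mu := fun v hv => by
      rw [← hφ]
      exact hφC _ ⟨v, hv, le_rfl, le_rfl⟩
    have hC'' : ∀ v ∈ K, ∀ a b : ℝ, 0 ≤ a → 0 ≤ b → c ≤ (f v + a) * lam + (g v + b) * mu :=
      fun v hv a b ha hb => by
        rw [← hφ]
        exact hφC _ ⟨v, hv, by simpa using ha, by simpa using hb⟩
    obtain ⟨v₀, hv₀, -⟩ := h 0 le_rfl
    have hlam0 : 0 ≤ lam := by
      by_contra hneg
      push Not at hneg
      have h1 := hC'' v₀ hv₀ ((f v₀ * lam + g v₀ * mu - c + 1) / (-lam)) 0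
        (div_nonneg (by linarith [hC' v₀ hv₀]) (by linarith)) le_rfl
      have h2 : (f v₀ * lam + g v₀ * mu - c + 1) / (-lam) * lam =
        -(f v₀ * lam + g v₀ * mu - c + 1) := by field_simp [hneg.ne]
      rw [add_mul, h2] at h1
      linarith
    have hmu0 : 0 ≤ mu := by
      by_contra hneg
      push Not at hneg
      have h1 := hC'' v₀ hv₀ 0 ((f v₀ * lam + g v₀ * mu - c + 1) / (-mu)) le_rfl
        (div_nonneg (by linarith [hC' v₀ hv₀]) (by linarith))
      have h2 : (f v₀ * lam + g v₀ * mu - c + 1) / (-mu) * mu =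
        -(f v₀ * lam + g v₀ * mu - c + 1) := by field_simp [hneg.ne]
      rw [add_mul (g v₀), h2] at h1
      linarith
    have hcl : (M + ε) * lam + (R + ε) * mu ≤ c := by
      refine le_of_forall_pos_le_add fun η hη => ?_
      have hd : 0 < lam + mu + 1 := by linarith
      have h1 := hQ' (η / (lam + mu + 1)) (η / (lam + mu + 1)) (by positivity) (by positivity)
      have h2 : η / (lam + mu + 1) * (lam + mu) ≤ η := by
        rw [div_mul_eq_mul_div, div_le_iff₀ hd]
        nlinarith
      nlinarith
    -- No Slater condition is assumed. If `lam = 0`, then `g ≥ R + ε` on `K`, and the large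
    -- multiplier `(|M| + 1) / ε` contradicts the hypothesis because `f ≥ 0`. Otherwise `mu / lam`
    -- is the multiplier.
    rcases hlam0.eq_or_lt with h0 | h0
    · have hmupos : 0 < mu := by
        rcases hmu0.eq_or_lt with h1 | h1
        · have h2 := hQ' 1 1 one_pos one_pos
          have h3 := hC' v₀ hv₀
          rw [← h0, ← h1] at h2 h3
          linarith
        · exact h1
      rw [← h0] at hcl
      obtain ⟨v, hv, hv1⟩ := h ((|M| + 1) / ε) (by positivity)
      have h1 := hC' v hv
      rw [← h0] at h1
      have h2 : ε ≤ g v - R := by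
        have : (R + ε) * mu ≤ g v * mu := by linarith
        linarith [le_of_mul_le_mul_right this hmupos]
      have h3 : (|M| + 1) / ε * ε ≤ (|M| + 1) / ε * (g v - R) :=
        mul_le_mul_of_nonneg_left h2 (by positivity)
      rw [div_mul_cancel₀ _ hε.ne'] at h3
      linarith [hf0 v hv, le_abs_self M]
    · obtain ⟨v, hv, hv1⟩ := h (mu / lam) (by positivity)
      have h1 := hC' v hv
      have h2 : (f v + mu / lam * (g v - R)) * lam ≤ M * lam :=
        mul_le_mul_of_nonneg_right hv1 h0.le
      have h3 : (f v + mu / lam * (g v - R)) * lam = f v * lam + mu * (g v - R) := by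
        field_simp
      rw [h3] at h2
      nlinarith
  have hne : ∀ ε : {ε : ℝ // 0 < ε}, (K ∩ {v | f v ≤ M + ε.1 ∧ g v ≤ R + ε.1}).Nonempty :=
    fun ε => by
      obtain ⟨v, hv, h1⟩ := hε ε.1 ε.2
      exact ⟨v, hv, h1⟩
  have hcl : ∀ ε : {ε : ℝ // 0 < ε}, IsClosed {v | f v ≤ M + ε.1 ∧ g v ≤ R + ε.1} := fun ε =>
    (isClosed_le hf continuous_const).inter (isClosed_le hg continuous_const)
  have hanti : ∀ {ε ε' : {ε : ℝ // 0 < ε}}, ε ≤ ε' → {v | f v ≤ M + ε.1 ∧ g v ≤ R + ε.1} ⊆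
      {v | f v ≤ M + ε'.1 ∧ g v ≤ R + ε'.1} := fun {ε ε'} hle v hv => by
    have : ε.1 ≤ ε'.1 := hle
    exact ⟨hv.1.trans (by linarith), hv.2.trans (by linarith)⟩
  have : Nonempty {ε : ℝ // 0 < ε} := ⟨⟨1, one_pos⟩⟩
  obtain ⟨v, hvK, hv⟩ := hK.inter_iInter_nonempty _ hcl fun u => by
    rcases u.eq_empty_or_nonempty with rfl | hu
    · obtain ⟨v, hv, -⟩ := h 0 le_rfl
      exact ⟨v, by simpa using hv⟩
    · obtain ⟨v, hv, h1⟩ := hne (u.inf' hu id)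
      exact ⟨v, hv, Set.mem_iInter₂.2 fun i hi => hanti (Finset.inf'_le id hi) h1⟩
  have hv' : ∀ ε, 0 < ε → f v ≤ M + ε ∧ g v ≤ R + ε := fun ε hε => Set.mem_iInter.1 hv ⟨ε, hε⟩
  exact ⟨v, hvK, le_of_forall_pos_le_add fun ε hε => (hv' ε hε).1,
    le_of_forall_pos_le_add fun ε hε => (hv' ε hε).2⟩

end Duality

/-! ### Holevo quantity and the weak exponent -/

section Channels

variable {X n : Type*} [Fintype X] [Fintype n] [DecidableEq n]

/-- Convex combination of two states. -/
def State.mix {p q : ℝ} (hp : 0 ≤ p) (hq : 0 ≤ q) (hpq : p + q = 1) (ρ σ : State n) : State n :=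
  ⟨p • ρ.1 + q • σ.1, posSemidef_combo hp hq ρ.2.1 σ.2.1, by
    rw [trace_add, trace_smul, trace_smul, ρ.2.2, σ.2.2, ← add_smul, hpq, one_smul]⟩

/-- The output state of a channel for a given input distribution. -/
def avgState (P : Dist X) (V : Channel X n) : State n :=
  ⟨∑ x, P.1 x • (V x).1, posSemidef_sum _ fun x _ => (V x).2.1.smul (P.2.1 x), by
    rw [trace_sum]
    simp only [trace_smul, (V _).2.2]
    rw [← Finset.sum_smul, P.2.2, one_smul]⟩

/-- The Holevo quantity, in terms of entropies. -/
def holevo (P : Dist X) (V : Channel X n) : ℝ :=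
  ∑ x, P.1 x * ent (V x).1 - ent (avgState P V).1

omit [DecidableEq n] in
theorem sum_trace_mul (P : Dist X) (V : Channel X n) (M : Matrix n n ℂ) :
    ∑ x, P.1 x * ((V x).1 * M).trace.re = ((avgState P V).1 * M).trace.re := by
  simp only [avgState, Finset.sum_mul, trace_sum, Complex.re_sum, Matrix.smul_mul, trace_smul,
    Complex.smul_re, smul_eq_mul]

/-- The logarithm of `σ` enters linearly, so only the average state meets it. The average state is
therefore the optimal `σ`, and the Holevo quantity is the minimum. -/
theorem sum_umegaki (P : Dist X) (V : Channel X n) (σ : Matrix n n ℂ) :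
    ∑ x, P.1 x * umegaki (V x).1 σ = holevo P V + umegaki (avgState P V).1 σ := by
  simp only [umegaki_eq, mul_sub, Finset.sum_sub_distrib, sum_trace_mul, holevo]
  ring

theorem sum_regEnt (P : Dist X) (V : Channel X n) (δ : ℝ) (σ : Matrix n n ℂ) :
    ∑ x, P.1 x * regEnt δ (V x).1 σ = holevo P V + regEnt δ (avgState P V).1 σ := by
  simp only [regEnt, mul_sub, Finset.sum_sub_distrib, sum_trace_mul, holevo]
  ring

theorem umegaki_self (A : Matrix n n ℂ) : umegaki A A = 0 := by
  simp [umegaki]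

theorem suppLE_avgState_iff (P : Dist X) (V : Channel X n) (σ : State n) :
    SuppLE (avgState P V).1 σ.1 ↔ ∀ x, 0 < P.1 x → SuppLE (V x).1 σ.1 := by
  have hd : ∀ j, diagIn σ.2.1.1 (avgState P V).1 j =
      ∑ x, P.1 x * diagIn σ.2.1.1 (V x).1 j := fun j => by
    rw [avgState, diagIn_sum]
    simp only [diagIn_smul]
  have hn : ∀ j x, 0 ≤ P.1 x * diagIn σ.2.1.1 (V x).1 j := fun j x =>
    mul_nonneg (P.2.1 x) (diagIn_nonneg _ (V x).2.1 j)
  rw [suppLE_iff_diagIn (avgState P V).2.1 σ.2.1.1]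
  constructor
  · intro h x hx
    rw [suppLE_iff_diagIn (V x).2.1 σ.2.1.1]
    intro j hj
    have := h j hj
    rw [hd, Finset.sum_eq_zero_iff_of_nonneg fun x _ => hn j x] at this
    exact (mul_eq_zero.1 (this x (Finset.mem_univ x))).resolve_left hx.ne'
  · intro h j hj
    rw [hd]
    refine Finset.sum_eq_zero fun x _ => ?_
    rcases (P.2.1 x).eq_or_lt with h0 | h0
    · rw [← h0, zero_mul]
    · rw [(suppLE_iff_diagIn (V x).2.1 σ.2.1.1).1 (h x h0) j hj, mul_zero]

theorem relEntropy_of_suppLE {A B : Matrix n n ℂ} (h : SuppLE A B) :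
    relEntropy A B = (umegaki A B : EReal) := by
  rw [relEntropy, if_pos h, umegaki]

theorem relEntropy_ne_bot (A B : Matrix n n ℂ) : relEntropy A B ≠ ⊥ := by
  rw [relEntropy]; split_ifs
  · exact EReal.coe_ne_bot _
  · exact top_ne_bot

theorem condRelEntropy_of_suppLE {V W : Channel X n} {P : Dist X}
    (h : ∀ x, 0 < P.1 x → SuppLE (V x).1 (W x).1) :
    condRelEntropy V W P = ((∑ x, P.1 x * umegaki (V x).1 (W x).1 : ℝ) : EReal) :=
  weighted_sum_coe P fun x hx => relEntropy_of_suppLE (h x hx)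

theorem condRelEntropy_eq_top {V W : Channel X n} {P : Dist X}
    (h : ¬ ∀ x, 0 < P.1 x → SuppLE (V x).1 (W x).1) : condRelEntropy V W P = ⊤ := by
  push Not at h
  obtain ⟨x, hx, hs⟩ := h
  exact weighted_sum_top P (fun x => relEntropy_ne_bot _ _) hx (by rw [relEntropy, if_neg hs])

theorem mutualInfo_eq (P : Dist X) (V : Channel X n) : mutualInfo P V = (holevo P V : EReal) := by
  refine le_antisymm ?_ (le_iInf fun σ => ?_)
  · refine (iInf_le _ (avgState P V)).trans ?_
    have hs := (suppLE_avgState_iff P V (avgState P V)).1 le_rfl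
    rw [condRelEntropy_of_suppLE hs, sum_umegaki, umegaki_self, add_zero]
  · by_cases hs : ∀ x, 0 < P.1 x → SuppLE (V x).1 σ.1
    · rw [condRelEntropy_of_suppLE hs, sum_umegaki, EReal.coe_le_coe_iff]
      linarith [umegaki_nonneg ((suppLE_avgState_iff P V σ).2 hs)]
    · rw [condRelEntropy_eq_top hs]; exact le_top

omit [DecidableEq n] in
theorem avgState_mix (P : Dist X) (V₀ V₁ : Channel X n) {p q : ℝ} (hp : 0 ≤ p) (hq : 0 ≤ q)
    (hpq : p + q = 1) : avgState P (fun x => State.mix hp hq hpq (V₀ x) (V₁ x)) =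
      State.mix hp hq hpq (avgState P V₀) (avgState P V₁) := by
  refine Subtype.ext ?_
  simp only [avgState, State.mix, Finset.smul_sum, ← Finset.sum_add_distrib, smul_add]
  refine Finset.sum_congr rfl fun x _ => ?_
  rw [smul_comm p, smul_comm q]

/-- The average state is affine in the channel, so joint convexity applies letter by letter. The
regularization is needed since the average state may be singular. -/
theorem holevo_convex (P : Dist X) (V₀ V₁ : Channel X n) {p q : ℝ} (hp : 0 ≤ p) (hq : 0 ≤ q)
    (hpq : p + q = 1) : holevo P (fun x => State.mix hp hq hpq (V₀ x) (V₁ x)) ≤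
      p * holevo P V₀ + q * holevo P V₁ := by
  have ht : ∀ V : Channel X n, Tendsto (fun δ => ∑ x, P.1 x * regEnt δ (V x).1 (avgState P V).1)
      (𝓝[>] 0) (𝓝 (holevo P V)) := fun V => by
    simp only [sum_regEnt]
    have := (tendsto_regEnt (avgState P V).2.1 (avgState P V).2.1 le_rfl).const_add (holevo P V)
    rwa [umegaki_self, add_zero] at this
  refine le_of_tendsto_of_tendsto (ht _) (((ht V₀).const_mul p).add ((ht V₁).const_mul q)) ?_
  filter_upwards [self_mem_nhdsWithin] with δ hδ
  rw [avgState_mix, Finset.mul_sum, Finset.mul_sum, ← Finset.sum_add_distrib]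
  refine Finset.sum_le_sum fun x _ => ?_
  have h := mul_le_mul_of_nonneg_left (regEnt_convex hp hq hpq (V₀ x).2.1 (V₁ x).2.1
    (avgState P V₀).2.1 (avgState P V₁).2.1 hδ) (P.2.1 x)
  refine h.trans (le_of_eq ?_)
  ring

theorem umegaki_convex_left {p q : ℝ} (hp : 0 ≤ p) (hq : 0 ≤ q) (hpq : p + q = 1)
    {A₀ A₁ : Matrix n n ℂ} (B : Matrix n n ℂ) (hA₀ : A₀.PosSemidef) (hA₁ : A₁.PosSemidef) :
    umegaki (p • A₀ + q • A₁) B ≤ p * umegaki A₀ B + q * umegaki A₁ B := by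
  have h := ent_convex hp hq hpq hA₀ hA₁
  simp only [umegaki_eq, add_mul, Matrix.smul_mul, trace_add, trace_smul, Complex.add_re,
    Complex.smul_re, smul_eq_mul]
  linarith

omit [Fintype X] [DecidableEq n] in
theorem continuous_channel_apply (x : X) : Continuous fun V : Channel X n => (V x).1 :=
  continuous_subtype_val.comp (continuous_apply x)

theorem continuous_holevo (P : Dist X) : Continuous (holevo P (n := n)) := by
  refine (continuous_finsetSum _ fun x _ => (continuous_ent (continuous_channel_apply x)
    fun V => (V x).2.1.1).const_mul _).sub (continuous_ent ?_ fun V => (avgState P V).2.1.1)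
  exact continuous_finsetSum _ fun x _ =>
    Continuous.const_smul (g := fun V : Channel X n => (V x).1) (continuous_channel_apply x) (P.1 x)

omit [Fintype X] in
theorem continuous_umegaki_left (x : X) (B : Matrix n n ℂ) :
    Continuous fun V : Channel X n => umegaki (V x).1 B := by
  simp only [umegaki_eq]
  exact (continuous_ent (continuous_channel_apply x) fun V => (V x).2.1.1).sub
    (continuous_trace_re.comp ((continuous_channel_apply x).mul continuous_const))

theorem isClosed_suppLE (W : Channel X n) (P : Dist X) :
    IsClosed {V : Channel X n | ∀ x, 0 < P.1 x → SuppLE (V x).1 (W x).1} := by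
  simp only [Set.ofPred_forall]
  refine isClosed_iInter fun x => isClosed_iInter fun _ => ?_
  simp only [fun V : Channel X n => suppLE_iff_diagIn (V x).2.1 (W x).2.1.1, Set.ofPred_forall]
  exact isClosed_iInter fun j => isClosed_iInter fun _ => isClosed_eq
    ((continuous_diagIn _ j).comp (continuous_channel_apply x)) continuous_const

theorem suppLE_mix {p q : ℝ} (hp : 0 ≤ p) (hq : 0 ≤ q) (hpq : p + q = 1) {ρ₀ ρ₁ σ : State n}
    (h₀ : SuppLE ρ₀.1 σ.1) (h₁ : SuppLE ρ₁.1 σ.1) : SuppLE (State.mix hp hq hpq ρ₀ ρ₁).1 σ.1 := by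
  rw [suppLE_iff_diagIn (State.mix hp hq hpq ρ₀ ρ₁).2.1 σ.2.1.1]
  intro j hj
  rw [State.mix, diagIn_add, diagIn_smul, diagIn_smul,
    (suppLE_iff_diagIn ρ₀.2.1 σ.2.1.1).1 h₀ j hj, (suppLE_iff_diagIn ρ₁.2.1 σ.2.1.1).1 h₁ j hj]
  simp

/-- Weak duality: `σ` is the average state of `V`, and each `V x` is a trial state in the
variational formula. The `σ` terms sum to the Holevo quantity, which `R` absorbs. -/
theorem iInf_logEuclideanObjective_le {W V : Channel X n} {R : ℝ} {P : Dist X} {α : ℝ}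
    (h0 : 0 < α) (h1 : α < 1) (hV : ∀ x, 0 < P.1 x → SuppLE (V x).1 (W x).1)
    (hR : holevo P V ≤ R) : ⨅ σ : State n, logEuclideanObjective W R P α σ ≤
      ((∑ x, P.1 x * umegaki (V x).1 (W x).1 : ℝ) : EReal) := by
  refine (iInf_le _ (avgState P V)).trans ?_
  set σ := avgState P V with hσ
  have hs := (suppLE_avgState_iff P V σ).1 le_rfl
  have hα : 0 < 1 - α := by linarith
  set q : X → ℝ := fun x => logEuclideanQ α (W x).1 σ.1
  have hq : ∀ x, 0 < P.1 x → Real.exp (-(α * umegaki (V x).1 (W x).1 +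
      (1 - α) * umegaki (V x).1 σ.1)) ≤ q x := fun x hx =>
    exp_neg_le_logEuclideanQ h0.le h1.le (W x).2.1 σ.2.1 (V x) (hV x hx) (hs x hx)
  have hc : condLogEuclideanDiv α W σ P =
      ((∑ x, P.1 x * ((α - 1)⁻¹ * Real.log (q x)) : ℝ) : EReal) :=
    weighted_sum_coe P fun x hx => by
      rw [logEuclideanDiv_eq h0 h1, renyiOfQ_of_pos ((Real.exp_pos _).trans_le (hq x hx))]
  rw [logEuclideanObjective, hc, coe_objective, EReal.coe_le_coe_iff]
  have hx : ∀ x, P.1 x * ((α - 1)⁻¹ * Real.log (q x)) ≤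
      P.1 x * (α / (1 - α) * umegaki (V x).1 (W x).1 + umegaki (V x).1 σ.1) := fun x => by
    rcases (P.2.1 x).eq_or_lt with hx | hx
    · rw [← hx, zero_mul, zero_mul]
    · refine mul_le_mul_of_nonneg_left ?_ hx.le
      have h2 := (Real.le_log_iff_exp_le ((Real.exp_pos _).trans_le (hq x hx))).2 (hq x hx)
      have h3 : (α - 1)⁻¹ * Real.log (q x) = -Real.log (q x) / (1 - α) := by
        rw [← neg_sub 1 α, inv_neg]; field_simp
      rw [h3, div_le_iff₀ hα]
      have h4 : (α / (1 - α) * umegaki (V x).1 (W x).1 + umegaki (V x).1 σ.1) * (1 - α) =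
        α * umegaki (V x).1 (W x).1 + (1 - α) * umegaki (V x).1 σ.1 := by field_simp
      rw [h4]; linarith
  have h5 := Finset.sum_le_sum fun x (_ : x ∈ Finset.univ) => hx x
  have h6 : ∑ x, P.1 x * (α / (1 - α) * umegaki (V x).1 (W x).1 + umegaki (V x).1 σ.1) =
      α / (1 - α) * ∑ x, P.1 x * umegaki (V x).1 (W x).1 + holevo P V := by
    simp only [mul_add, Finset.sum_add_distrib]
    rw [sum_umegaki, hσ, umegaki_self, add_zero, Finset.mul_sum]
    congr 1
    exact Finset.sum_congr rfl fun x _ => by ring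
  have h7 : ∑ x, P.1 x * ((α - 1)⁻¹ * Real.log (q x)) - R ≤
      α / (1 - α) * ∑ x, P.1 x * umegaki (V x).1 (W x).1 := by linarith
  have h8 := mul_le_mul_of_nonneg_left h7 (show 0 ≤ (1 - α) / α by positivity)
  refine h8.trans (le_of_eq ?_)
  field_simp

theorem iInf_logEuclideanObjective_le_weak (W : Channel X n) (R : ℝ) (P : Dist X) {α : ℝ}
    (h0 : 0 < α) (h1 : α < 1) :
    ⨅ σ : State n, logEuclideanObjective W R P α σ ≤ weakExponentAt W R P := by
  refine le_iInf₂ fun V hV => ?_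
  have hV' : holevo P V ≤ R := by
    have : mutualInfo P V ≤ (R : EReal) := hV
    rwa [mutualInfo_eq, EReal.coe_le_coe_iff] at this
  by_cases hs : ∀ x, 0 < P.1 x → SuppLE (V x).1 (W x).1
  · rw [condRelEntropy_of_suppLE hs]
    exact iInf_logEuclideanObjective_le h0 h1 hs hV'
  · rw [condRelEntropy_eq_top hs]; exact le_top

/-- The converse to weak duality: `V x` is the optimal state of the variational formula for `W x`
and `σ`, and `holevo P V` is at most the average divergence from `σ`. A finite objective excludes
`Q^♭ = 0` on letters of positive probability. -/
theorem exists_lagrangian_le {W : Channel X n} {R : ℝ} {P : Dist X} {α : ℝ}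
    (h0 : 0 < α) (h1 : α < 1) {σ : State n} {M : ℝ}
    (hM : logEuclideanObjective W R P α σ ≤ (M : EReal)) :
    ∃ V : Channel X n, (∀ x, 0 < P.1 x → SuppLE (V x).1 (W x).1) ∧
      ∑ x, P.1 x * umegaki (V x).1 (W x).1 + (1 - α) / α * (holevo P V - R) ≤ M := by
  have := σ.nonempty
  have hα : 0 < 1 - α := by linarith
  have hs : 0 < (1 - α) / α := by positivity
  set q : X → ℝ := fun x => logEuclideanQ α (W x).1 σ.1
  have hq : ∀ x, 0 < P.1 x → 0 < q x := by
    intro x hx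
    by_contra hqx
    have htop : condLogEuclideanDiv α W σ P = ⊤ :=
      weighted_sum_top P (fun y => by
        rw [logEuclideanDiv_eq h0 h1]; exact renyiOfQ_ne_bot h1 _) hx
        (by rw [logEuclideanDiv_eq h0 h1, renyiOfQ_of_nonpos h1 (not_lt.1 hqx)])
    rw [logEuclideanObjective, htop, EReal.top_sub_coe, EReal.coe_mul_top_of_pos hs,
      top_le_iff] at hM
    exact EReal.coe_ne_top _ hM
  have hc : condLogEuclideanDiv α W σ P =
      ((∑ x, P.1 x * ((α - 1)⁻¹ * Real.log (q x)) : ℝ) : EReal) :=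
    weighted_sum_coe P fun x hx => by
      rw [logEuclideanDiv_eq h0 h1, renyiOfQ_of_pos (hq x hx)]
  rw [logEuclideanObjective, hc, coe_objective, EReal.coe_le_coe_iff] at hM
  have hex : ∀ x, ∃ τ : State n, 0 < P.1 x → SuppLE τ.1 (W x).1 ∧ SuppLE τ.1 σ.1 ∧
      α * umegaki τ.1 (W x).1 + (1 - α) * umegaki τ.1 σ.1 ≤ -Real.log (q x) := fun x => by
    by_cases hx : 0 < P.1 x
    · obtain ⟨τ, hτ⟩ := exists_state_le_neg_log h0 h1 (W x).2.1 σ.2.1 (hq x hx)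
      exact ⟨τ, fun _ => hτ⟩
    · exact ⟨σ, fun h => absurd h hx⟩
  choose V hV using hex
  refine ⟨V, fun x hx => (hV x hx).1, le_trans ?_ hM⟩
  have hsupp := (suppLE_avgState_iff P V σ).2 fun x hx => (hV x hx).2.1
  have h2 : holevo P V ≤ ∑ x, P.1 x * umegaki (V x).1 σ.1 := by
    rw [sum_umegaki]; linarith [umegaki_nonneg hsupp]
  have h3 : ∀ x, P.1 x * (umegaki (V x).1 (W x).1 + (1 - α) / α * umegaki (V x).1 σ.1) ≤
      P.1 x * ((1 - α) / α * ((α - 1)⁻¹ * Real.log (q x))) := fun x => by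
    rcases (P.2.1 x).eq_or_lt with hx | hx
    · rw [← hx, zero_mul, zero_mul]
    · refine mul_le_mul_of_nonneg_left ?_ hx.le
      have h4 : (1 - α) / α * ((α - 1)⁻¹ * Real.log (q x)) = -Real.log (q x) / α := by
        rw [← neg_sub 1 α, inv_neg]; field_simp
      rw [h4, le_div_iff₀ h0]
      refine le_trans (le_of_eq ?_) (hV x hx).2.2
      field_simp
  have h5 := Finset.sum_le_sum fun x (_ : x ∈ Finset.univ) => h3 x
  have h6 : ∑ x, P.1 x * (umegaki (V x).1 (W x).1 + (1 - α) / α * umegaki (V x).1 σ.1) =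
      ∑ x, P.1 x * umegaki (V x).1 (W x).1 +
        (1 - α) / α * ∑ x, P.1 x * umegaki (V x).1 σ.1 := by
    simp only [mul_add, Finset.sum_add_distrib]
    rw [Finset.mul_sum]
    congr 1
    exact Finset.sum_congr rfl fun x _ => by ring
  have h7 : ∑ x, P.1 x * ((1 - α) / α * ((α - 1)⁻¹ * Real.log (q x))) =
      (1 - α) / α * ∑ x, P.1 x * ((α - 1)⁻¹ * Real.log (q x)) := by
    rw [Finset.mul_sum]
    exact Finset.sum_congr rfl fun x _ => by ring
  rw [h6, h7] at h5
  have h8 := mul_le_mul_of_nonneg_left h2 hs.le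
  rw [mul_sub, mul_sub]
  linarith

/-- The prefactor vanishes and `0 * ⊤ = 0`, so the one-sided limit at order one is never evaluated.
-/
theorem logEuclideanObjective_one (W : Channel X n) (R : ℝ) (P : Dist X) (σ : State n) :
    logEuclideanObjective W R P 1 σ = 0 := by
  simp [logEuclideanObjective]

theorem exists_eq_iInf_logEuclideanObjective [Nonempty X] (W : Channel X n) (R : ℝ) (P : Dist X)
    {α : ℝ} (hα : α ∈ Set.Ioc (0 : ℝ) 1) : ∃ σ : State n, logEuclideanObjective W R P α σ =
      ⨅ τ : State n, logEuclideanObjective W R P α τ := by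
  have : Nonempty (State n) := ⟨W (Classical.arbitrary X)⟩
  rcases hα.2.eq_or_lt with rfl | h1
  · exact ⟨Classical.arbitrary _, by simp [logEuclideanObjective_one]⟩
  · refine exists_eq_iInf_objective (S := fun σ => condLogEuclideanDiv α W σ P) ?_
      (div_nonneg (by linarith) hα.1.le) R
    exact lowerSemicontinuous_weighted_sum P
      (fun x σ => by rw [logEuclideanDiv_eq hα.1 h1]; exact renyiOfQ_ne_bot h1 _)
      fun x => lowerSemicontinuous_logEuclideanDiv hα.1 h1 (W x).2.1

/-- The dual value of the weak exponent is attained by a feasible channel. -/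
theorem exists_channel_le_iSup [Nonempty X] (W : Channel X n) {R : ℝ} (hR : 0 ≤ R) (P : Dist X) :
    ∃ V : Channel X n, mutualInfo P V ≤ (R : EReal) ∧ condRelEntropy V W P ≤
      ⨆ α ∈ Set.Ioc (0 : ℝ) 1, ⨅ σ : State n, logEuclideanObjective W R P α σ := by
  set S := ⨆ α ∈ Set.Ioc (0 : ℝ) 1, ⨅ σ : State n, logEuclideanObjective W R P α σ with hS
  have : Nonempty (State n) := ⟨W (Classical.arbitrary X)⟩
  have hle : ∀ α ∈ Set.Ioc (0 : ℝ) 1, ⨅ σ : State n, logEuclideanObjective W R P α σ ≤ S :=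
    fun α hα => le_iSup₂ (f := fun α (_ : α ∈ Set.Ioc (0 : ℝ) 1) =>
      ⨅ σ : State n, logEuclideanObjective W R P α σ) α hα
  have hS0 : 0 ≤ S := by
    have := hle 1 ⟨one_pos, le_rfl⟩
    simpa [logEuclideanObjective_one] using this
  -- When the dual value is infinite any feasible channel will do; a constant channel has zero
  -- mutual information, and `R ≥ 0`.
  rcases eq_or_ne S ⊤ with htop | htop
  · set σ := W (Classical.arbitrary X)
    refine ⟨fun _ => σ, ?_, by rw [htop]; exact le_top⟩
    refine (iInf_le _ σ).trans ?_
    rw [condRelEntropy_of_suppLE fun _ _ => le_rfl]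
    simpa [umegaki_self] using hR
  · have hbot : S ≠ ⊥ := fun h => by simp [h] at hS0
    lift S to ℝ using ⟨htop, hbot⟩ with M
    have hM0 : 0 ≤ M := by exact_mod_cast hS0
    obtain ⟨V, hV, hVM, hVR⟩ := exists_le_of_lagrangian (isClosed_suppLE W P).isCompact
      (f := fun V => ∑ x, P.1 x * umegaki (V x).1 (W x).1) (g := holevo P) (M := M) (R := R)
      (continuous_finsetSum _ fun x _ => (continuous_umegaki_left x _).const_mul _)
      (continuous_holevo P) (fun V hV => Finset.sum_nonneg fun x _ => by
        rcases (P.2.1 x).eq_or_lt with hx | hx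
        · rw [← hx, zero_mul]
        · exact mul_nonneg hx.le (umegaki_nonneg (hV x hx)))
      (fun V₀ hV₀ V₁ hV₁ p q hp hq hpq =>
        ⟨fun x => State.mix hp hq hpq (V₀ x) (V₁ x),
          fun x hx => suppLE_mix hp hq hpq (hV₀ x hx) (hV₁ x hx), by
            rw [Finset.mul_sum, Finset.mul_sum, ← Finset.sum_add_distrib]
            refine Finset.sum_le_sum fun x _ => ?_
            refine (mul_le_mul_of_nonneg_left (umegaki_convex_left hp hq hpq (W x).1
              (V₀ x).2.1 (V₁ x).2.1) (P.2.1 x)).trans (le_of_eq ?_)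
            ring, holevo_convex P V₀ V₁ hp hq hpq⟩)
      (fun s hs => by
        -- The multiplier `s = 0` is served by `W` itself; a positive `s` corresponds to the order
        -- `1 / (1 + s)`.
        rcases hs.eq_or_lt with rfl | hs
        · exact ⟨W, fun x _ => le_rfl, by simpa [umegaki_self] using hM0⟩
        · have hα0 : 0 < 1 / (1 + s) := by positivity
          have hα1 : 1 / (1 + s) < 1 := by rw [div_lt_one (by positivity)]; linarith
          have hαs : (1 - 1 / (1 + s)) / (1 / (1 + s)) = s := by field_simp; ring
          obtain ⟨σ, hσ⟩ := exists_eq_iInf_logEuclideanObjective W R P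
            (α := 1 / (1 + s)) ⟨hα0, hα1.le⟩
          have h := hle _ ⟨hα0, hα1.le⟩
          rw [← hσ] at h
          obtain ⟨V, hV, hVM⟩ := exists_lagrangian_le hα0 hα1 h
          rw [hαs] at hVM
          exact ⟨V, hV, hVM⟩)
    refine ⟨V, ?_, ?_⟩
    · rw [mutualInfo_eq]; exact_mod_cast hVR
    · rw [condRelEntropy_of_suppLE hV]; exact_mod_cast hVM

theorem weakExponentAt_eq [Nonempty X] (W : Channel X n) {R : ℝ} (hR : 0 ≤ R) (P : Dist X) :
    weakExponentAt W R P =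
      ⨆ α ∈ Set.Ioc (0 : ℝ) 1, ⨅ σ : State n, logEuclideanObjective W R P α σ := by
  refine le_antisymm ?_ (iSup₂_le fun α hα => ?_)
  · obtain ⟨V, hV, h⟩ := exists_channel_le_iSup W hR P
    exact (iInf₂_le V hV).trans h
  · have : Nonempty (State n) := ⟨W (Classical.arbitrary X)⟩
    rcases hα.2.eq_or_lt with rfl | h1
    · simp only [logEuclideanObjective_one, ciInf_const]
      refine le_iInf₂ fun V _ => ?_
      by_cases hs : ∀ x, 0 < P.1 x → SuppLE (V x).1 (W x).1
      · rw [condRelEntropy_of_suppLE hs]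
        refine EReal.coe_nonneg.2 (Finset.sum_nonneg fun x _ => ?_)
        rcases (P.2.1 x).eq_or_lt with hx | hx
        · rw [← hx, zero_mul]
        · exact mul_nonneg hx.le (umegaki_nonneg (hs x hx))
      · rw [condRelEntropy_eq_top hs]; exact le_top
    · exact iInf_logEuclideanObjective_le_weak W R P hα.1 h1

theorem exists_eq_weakExponentAt [Nonempty X] (W : Channel X n) {R : ℝ} (hR : 0 ≤ R)
    (P : Dist X) : ∃ V : Channel X n, mutualInfo P V ≤ (R : EReal) ∧
      condRelEntropy V W P = weakExponentAt W R P := by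
  obtain ⟨V, hV, h⟩ := exists_channel_le_iSup W hR P
  rw [← weakExponentAt_eq W hR] at h
  exact ⟨V, hV, le_antisymm h (iInf₂_le V hV)⟩

end Channels

/-! ### Powers, Hölder's inequality and first-order optimality -/

section Powers

variable {m : Type*} [Fintype m] [DecidableEq m]

theorem mpow_eq_cfc {p : ℝ} (hp : p ≠ 0) (A : Matrix m m ℂ) :
    mpow A p = cfc (fun t : ℝ => t ^ p) A := by
  rw [mpow]
  congr 1
  ext t
  split_ifs with h
  · rw [h, Real.zero_rpow hp]
  · rfl

theorem mpow_one {A : Matrix m m ℂ} (hA : A.IsHermitian) : mpow A 1 = A := by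
  rw [mpow_eq_cfc one_ne_zero]
  simp only [Real.rpow_one]
  exact cfc_id_of_isHermitian hA

theorem trace_mpow {A : Matrix m m ℂ} (hA : A.IsHermitian) {p : ℝ} (hp : p ≠ 0) :
    (mpow A p).trace.re = ∑ i, hA.eigenvalues i ^ p := by
  rw [mpow_eq_cfc hp, trace_cfc hA]

theorem isHermitian_mpow (A : Matrix m m ℂ) (p : ℝ) : (mpow A p).IsHermitian := isHermitian_cfc _ _

theorem posSemidef_mpow {A : Matrix m m ℂ} (hA : A.PosSemidef) (p : ℝ) : (mpow A p).PosSemidef :=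
  posSemidef_cfc hA.1 fun i => by
    split_ifs
    · exact le_rfl
    · exact Real.rpow_nonneg (hA.eigenvalues_nonneg i) p

theorem continuous_mpow {Y : Type*} [TopologicalSpace Y] {u : Y → Matrix m m ℂ} {p : Y → ℝ}
    (hu : Continuous u) (hH : ∀ y, (u y).IsHermitian) (hp : Continuous p) (hp0 : ∀ y, 0 < p y) :
    Continuous fun y => mpow (u y) (p y) := by
  simp only [fun y => mpow_eq_cfc (hp0 y).ne' (u y)]
  refine continuous_cfc hu hH (f := fun y t => t ^ p y) ?_
  exact Continuous.rpow continuous_snd (hp.comp continuous_fst) fun z => Or.inr (hp0 z.1)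

theorem trace_mpow_pos {A : Matrix m m ℂ} (hA : A.PosSemidef) (hA0 : 0 < A.trace.re) (p : ℝ) :
    0 < (mpow A p).trace.re := by
  rw [mpow, trace_cfc hA.1]
  rw [← sum_eigenvalues_eq_trace_re hA.1] at hA0
  obtain ⟨i, -, hi⟩ := Finset.exists_lt_of_sum_lt (s := Finset.univ) (f := fun _ : m => (0 : ℝ))
    (g := hA.1.eigenvalues) (by simpa using hA0)
  refine Finset.sum_pos' (fun j _ => ?_) ⟨i, Finset.mem_univ i, ?_⟩
  · split_ifs
    · exact le_rfl
    · exact Real.rpow_nonneg (hA.eigenvalues_nonneg j) p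
  · rw [if_neg hi.ne']
    exact Real.rpow_pos_of_pos hi p

/-- Hölder's inequality for the trace, against a state. -/
theorem trace_mul_mpow_le {p : ℝ} (hp : 1 < p) {A : Matrix m m ℂ} (hA : A.PosSemidef)
    (hZ : 0 < (mpow A p).trace.re) (σ : State m) :
    (A * mpow σ.1 (1 - 1 / p)).trace.re ≤ (mpow A p).trace.re ^ (1 / p) := by
  set Z := (mpow A p).trace.re with hZd
  have hp0 : 0 < p := by linarith
  have hpi : 1 / p < 1 := by rw [div_lt_one hp0]; exact hp
  have hpi0 : 0 < 1 / p := by positivity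
  have h := trace_cfc_mul_cfc_le hA.1 σ.2.1.1 (f := id) (g := fun t => t ^ (1 - 1 / p))
    (h := fun t => (Z ^ (1 / p) * (1 / p) / Z) * t ^ p)
    (k := fun t => (Z ^ (1 / p) * (1 - 1 / p)) * t) (fun i j => by
      have ha := hA.eigenvalues_nonneg i
      have hb := σ.2.1.eigenvalues_nonneg j
      set a := hA.1.eigenvalues i
      set b := σ.2.1.1.eigenvalues j
      have hap : 0 ≤ a ^ p := Real.rpow_nonneg ha p
      -- Young's inequality is applied to `a ^ p / Z` and `b`: each sums to one over the spectrum,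
      -- so the two weights add up to the constant `Z ^ (1 / p)`.
      have hy := Real.geom_mean_le_arith_mean2_weighted hpi0.le (sub_nonneg.2 hpi.le)
        (div_nonneg hap hZ.le) hb (by ring)
      have e : (a ^ p / Z) ^ (1 / p) = a / Z ^ (1 / p) := by
        rw [Real.div_rpow hap hZ.le, ← Real.rpow_mul ha, mul_one_div_cancel hp0.ne',
          Real.rpow_one]
      rw [e] at hy
      have hZp : 0 < Z ^ (1 / p) := Real.rpow_pos_of_pos hZ _
      have h2 := mul_le_mul_of_nonneg_left hy hZp.le
      have e1 : Z ^ (1 / p) * (a / Z ^ (1 / p) * b ^ (1 - 1 / p)) = a * b ^ (1 - 1 / p) := by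
        field_simp
      rw [e1] at h2
      refine h2.trans (le_of_eq ?_)
      ring)
  rw [cfc_id_of_isHermitian hA.1, ← mpow_eq_cfc (by linarith), trace_cfc hA.1, trace_cfc σ.2.1.1,
    ← Finset.mul_sum, ← Finset.mul_sum, ← trace_mpow hA.1 hp0.ne',
    sum_eigenvalues_eq_trace_re, ← hZd] at h
  have h1 : (σ.1.trace).re = 1 := by rw [σ.2.2, Complex.one_re]
  rw [h1] at h
  refine h.trans (le_of_eq ?_)
  field_simp
  ring

/-- Tangent inequality for the convex function `A ↦ Tr A ^ p`. -/
theorem trace_mul_mpow_tangent {p : ℝ} (hp : 1 < p) {A B : Matrix m m ℂ} (hA : A.PosSemidef)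
    (hB : B.PosSemidef) : p * (A * mpow B (p - 1)).trace.re ≤
      (mpow A p).trace.re + (p - 1) * (mpow B p).trace.re := by
  have hp0 : 0 < p := by linarith
  have h := trace_cfc_mul_cfc_le hA.1 hB.1 (f := id) (g := fun t => t ^ (p - 1))
    (h := fun t => (1 / p) * t ^ p) (k := fun t => (1 - 1 / p) * t ^ p) (fun i j => by
      have ha := hA.eigenvalues_nonneg i
      have hb := hB.eigenvalues_nonneg j
      set a := hA.1.eigenvalues i
      set b := hB.1.eigenvalues j
      have hy := Real.geom_mean_le_arith_mean2_weighted (w₁ := 1 / p) (w₂ := 1 - 1 / p)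
        (by positivity) (by rw [sub_nonneg, div_le_one hp0]; exact hp.le)
        (Real.rpow_nonneg ha p) (Real.rpow_nonneg hb p) (by ring)
      rw [← Real.rpow_mul ha, ← Real.rpow_mul hb, mul_one_div_cancel hp0.ne', Real.rpow_one,
        mul_sub, mul_one_div_cancel hp0.ne', mul_one] at hy
      exact hy)
  rw [cfc_id_of_isHermitian hA.1, ← mpow_eq_cfc (by linarith), trace_cfc hA.1, trace_cfc hB.1,
    ← Finset.mul_sum, ← Finset.mul_sum, ← trace_mpow hA.1 hp0.ne',
    ← trace_mpow hB.1 hp0.ne'] at h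
  have h2 := mul_le_mul_of_nonneg_left h hp0.le
  refine h2.trans (le_of_eq ?_)
  field_simp

theorem mul_mpow_self {p : ℝ} (hp : 1 < p) {A : Matrix m m ℂ} (hA : A.PosSemidef) :
    A * mpow A (p - 1) = mpow A p := by
  rw [mpow_eq_cfc (by linarith), mpow_eq_cfc (by linarith), mul_cfc_self hA.1]
  refine cfc_congr_eigen hA.1 fun i => ?_
  have ha := hA.eigenvalues_nonneg i
  set a := hA.1.eigenvalues i
  rcases ha.eq_or_lt with h | h
  · rw [← h, zero_mul, Real.zero_rpow (by linarith)]
  · rw [Real.rpow_sub_one h.ne']; field_simp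

/-- First-order optimality: if `A` minimizes `Tr A ^ p` along the segment towards `B`, then
`Tr A ^ p ≤ Tr B A ^ (p - 1)`. -/
theorem trace_mpow_le_of_min {p : ℝ} (hp : 1 < p) {A B : Matrix m m ℂ} (hA : A.PosSemidef)
    (hB : B.PosSemidef) (h : ∀ t : ℝ, 0 < t → t < 1 →
      (mpow A p).trace.re ≤ (mpow ((1 - t) • A + t • B) p).trace.re) :
    (mpow A p).trace.re ≤ (B * mpow A (p - 1)).trace.re := by
  have hH : ∀ t : ℝ, ((1 - t) • A + t • B).IsHermitian := fun t => by
    rw [IsHermitian, conjTranspose_add, conjTranspose_smul, conjTranspose_smul, hA.1.eq, hB.1.eq,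
      star_trivial, star_trivial]
  have hcm : Continuous fun t : ℝ => mpow ((1 - t) • A + t • B) (p - 1) :=
    continuous_mpow (by fun_prop) hH continuous_const fun _ => by linarith
  have hlim : ∀ M : Matrix m m ℂ, Tendsto (fun t : ℝ =>
      (M * mpow ((1 - t) • A + t • B) (p - 1)).trace.re) (𝓝[>] 0)
      (𝓝 (M * mpow A (p - 1)).trace.re) := fun M => by
    have hc : Continuous fun t : ℝ => (M * mpow ((1 - t) • A + t • B) (p - 1)).trace.re :=
      continuous_trace_re.comp (continuous_const.mul hcm)
    have := (hc.tendsto 0).mono_left (nhdsWithin_le_nhds (s := Set.Ioi 0))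
    simpa using this
  rw [← mul_mpow_self hp hA]
  refine le_of_tendsto_of_tendsto (hlim A) (hlim B) ?_
  filter_upwards [Ioo_mem_nhdsGT (zero_lt_one' ℝ)] with t ht
  set C := (1 - t) • A + t • B with hC
  have hCp : C.PosSemidef := posSemidef_combo (by linarith [ht.2]) ht.1.le hA hB
  -- The tangent is taken at the mixture `C`, not at `A`. Minimality then gives `Tr A C ^ (p - 1) ≤
  -- Tr C ^ p`; expanding one factor `C` and dividing by `t` leaves an inequality whose limit `t ↓
  -- 0` needs only continuity.
  have h1 := trace_mul_mpow_tangent hp hA hCp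
  have h2 := h t ht.1 ht.2
  have h3 : (mpow C p).trace.re = (1 - t) * (A * mpow C (p - 1)).trace.re +
      t * (B * mpow C (p - 1)).trace.re := by
    rw [← mul_mpow_self hp hCp]
    nth_rewrite 1 [hC]
    simp only [add_mul, Matrix.smul_mul, trace_add, trace_smul, Complex.add_re, Complex.smul_re,
      smul_eq_mul]
  have h4 : p * (A * mpow C (p - 1)).trace.re ≤ p * (mpow C p).trace.re := by
    rw [← hC] at h2; linarith
  have h5 := le_of_mul_le_mul_left h4 (by linarith)
  rw [h3] at h5
  exact le_of_mul_le_mul_left (by linarith) ht.1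

end Powers

/-! ### Petz divergence at interior orders and at order zero -/

section Petz

variable {m : Type*} [Fintype m] [DecidableEq m] {α : ℝ} {A B : Matrix m m ℂ}

/-- Both exponents are positive, so the powers are continuous at singular matrices and the
regularization can be dropped. -/
theorem petzQ_eq (h0 : 0 < α) (h1 : α < 1) (hA : A.IsHermitian) (hB : B.IsHermitian) :
    petzQ α A B = petzQPos α A B := by
  have hc : Continuous fun δ : ℝ => petzQPos α (A + δ • (1 : Matrix m m ℂ))
      (B + δ • (1 : Matrix m m ℂ)) :=
    continuous_trace_re.comp
      ((continuous_mpow (by fun_prop) (isHermitian_add_smul_one hA) continuous_const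
        fun _ => h0).mul
      (continuous_mpow (by fun_prop) (isHermitian_add_smul_one hB) continuous_const
        fun _ => by linarith))
  have := (hc.tendsto 0).mono_left (nhdsWithin_le_nhds (s := Set.Ioi 0))
  simp only [zero_smul, add_zero] at this
  exact this.limUnder_eq

theorem petzDiv_eq (h0 : 0 < α) (h1 : α < 1) (hA : A.IsHermitian) (hB : B.IsHermitian) :
    petzDiv α A B = renyiOfQ α (petzQPos α A B) := by
  rw [petzDiv, renyiDiv, if_neg h0.ne', if_neg h1.ne, petzQ_eq h0 h1 hA hB]

/-- As the order tends to `0`, nonzero eigenvalues of `A` have powers tending to `1` while zero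
eigenvalues are excluded by `mpow`; the limit is the support projection. -/
theorem petzDiv_zero (hA : A.PosSemidef) (hB : B.PosSemidef) :
    petzDiv 0 A B = renyiOfQ 0 (mpow A 0 * B).trace.re := by
  have hq : Tendsto (fun a => petzQ a A B) (𝓝[>] 0) (𝓝 (mpow A 0 * B).trace.re) := by
    have h : Tendsto (fun a => petzQPos a A B) (𝓝[>] 0) (𝓝 (mpow A 0 * B).trace.re) := by
      have e : (mpow A 0 * B).trace.re = (mpow A 0 * mpow B 1).trace.re := by rw [mpow_one hB.1]
      rw [e]
      simp only [petzQPos, mpow, trace_cfc_mul_cfc hA.1 hB.1]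
      refine tendsto_finsetSum _ fun j _ => tendsto_finsetSum _ fun i _ =>
        Tendsto.mul_const _ (Tendsto.mul ?_ ?_)
      · split_ifs with hi
        · exact tendsto_const_nhds
        · exact tendsto_nhdsWithin_of_tendsto_nhds
            (Real.continuousAt_const_rpow hi).tendsto
      · split_ifs with hi
        · exact tendsto_const_nhds
        · have h2 : Tendsto (fun a : ℝ => 1 - a) (𝓝 0) (𝓝 (1 - 0)) :=
            tendsto_const_nhds.sub tendsto_id
          rw [sub_zero] at h2
          exact tendsto_nhdsWithin_of_tendsto_nhds
            ((Real.continuousAt_const_rpow hi).tendsto.comp h2)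
    refine h.congr' ?_
    filter_upwards [Ioo_mem_nhdsGT (zero_lt_one' ℝ)] with a ha
    rw [petzQ_eq ha.1 ha.2 hA.1 hB.1]
  rw [petzDiv, renyiDiv, if_pos rfl]
  refine Tendsto.limUnder_eq ?_
  have h1 : Tendsto (fun a : ℝ => (((a - 1)⁻¹ : ℝ) : EReal)) (𝓝[>] 0)
      (𝓝 (((0 - 1)⁻¹ : ℝ) : EReal)) := by
    refine (continuous_coe_real_ereal.tendsto _).comp (tendsto_nhdsWithin_of_tendsto_nhds ?_)
    exact ((tendsto_id (α := ℝ)).sub_const 1).inv₀ (by norm_num)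
  have h2 : Tendsto (fun a : ℝ => ENNReal.log (ENNReal.ofReal (petzQ a A B))) (𝓝[>] 0)
      (𝓝 (ENNReal.log (ENNReal.ofReal (mpow A 0 * B).trace.re))) :=
    ((ENNReal.continuous_log.comp ENNReal.continuous_ofReal).tendsto _).comp hq
  have hne : (((0 - 1 : ℝ)⁻¹ : ℝ) : EReal) ≠ 0 := by
    rw [← EReal.coe_zero, Ne, EReal.coe_eq_coe_iff]; norm_num
  exact (EReal.continuousAt_mul (p := ((((0 - 1 : ℝ)⁻¹ : ℝ) : EReal),
    ENNReal.log (ENNReal.ofReal (mpow A 0 * B).trace.re))) (Or.inl hne) (Or.inl hne)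
    (Or.inl (EReal.coe_ne_bot _)) (Or.inl (EReal.coe_ne_top _))).tendsto.comp (h1.prodMk_nhds h2)

end Petz

/-! ### Classical-quantum states as block matrices and the rate `R_∞` -/

section Blocks

variable {m : Type*} [Fintype m] [DecidableEq m]

theorem mpow_zero_mul_self {A : Matrix m m ℂ} (hA : A.IsHermitian) : mpow A 0 * A = A := by
  have hs : IsSelfAdjoint A := hA
  conv_lhs => rw [mpow]; enter [2]; rw [← cfc_id' ℝ A]
  conv_rhs => rw [← cfc_id' ℝ A]
  rw [← cfc_mul _ _ A (continuousOn_spectrum _ A) (continuousOn_spectrum _ A)]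
  congr 1; ext t; by_cases h : t = 0 <;> simp [h]

theorem mpow_zero_eq_mul {A : Matrix m m ℂ} (hA : A.IsHermitian) :
    mpow A 0 = A * cfc (fun t : ℝ => t⁻¹) A := by
  rw [mul_cfc_self hA, mpow]
  congr 1; ext t; by_cases h : t = 0 <;> simp [h]

/-- Characterization of the support projection. -/
theorem eq_mpow_zero {A N G : Matrix m m ℂ} (hA : A.IsHermitian) (hN : N.IsHermitian)
    (h1 : N * A = A) (h2 : N = A * G) : N = mpow A 0 := by
  have e1 : mpow A 0 * N = N := by
    conv_lhs => rw [h2]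
    rw [← mul_assoc, mpow_zero_mul_self hA, ← h2]
  have e2 : N * mpow A 0 = mpow A 0 := by
    rw [mpow_zero_eq_mul hA, ← mul_assoc, h1]
  rw [← e2]
  have := congrArg conjTranspose e1
  rw [conjTranspose_mul, hN.eq, (isHermitian_mpow A 0).eq] at this
  exact this.symm

theorem mpow_zero_smul {c : ℝ} (hc : c ≠ 0) {A : Matrix m m ℂ} (hA : A.IsHermitian) :
    mpow (c • A) 0 = mpow A 0 := by
  have hs : IsSelfAdjoint A := hA
  have h : c • A = cfc (fun t : ℝ => c * t) A := by
    rw [cfc_const_mul c _ A (continuousOn_spectrum _ A), cfc_id' ℝ A]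
  rw [h, mpow, cfc_cfc hA, mpow]
  congr 1; ext t; simp [hc]

variable {X n : Type*} [Fintype X] [DecidableEq X] [Fintype n] [DecidableEq n]

/-- The block-diagonal matrix with blocks `M x`. -/
def blockSum (M : X → Matrix n n ℂ) : Matrix (X × n) (X × n) ℂ :=
  of fun a b => if a.1 = b.1 then M a.1 a.2 b.2 else 0

omit [DecidableEq n] in
theorem blockSum_mul (M N : X → Matrix n n ℂ) :
    blockSum M * blockSum N = blockSum fun x => M x * N x := by
  ext ⟨x, i⟩ ⟨y, j⟩
  simp only [blockSum, mul_apply, of_apply, Fintype.sum_prod_type]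
  by_cases h : x = y
  · subst h
    rw [Finset.sum_eq_single x (fun z _ hz => by simp [hz.symm]) (by simp)]
    simp
  · rw [if_neg h]
    refine Finset.sum_eq_zero fun z _ => Finset.sum_eq_zero fun k _ => ?_
    by_cases h1 : x = z
    · subst h1; simp [h]
    · simp [h1]

omit [Fintype X] [Fintype n] [DecidableEq n] in
theorem isHermitian_blockSum {M : X → Matrix n n ℂ} (h : ∀ x, (M x).IsHermitian) :
    (blockSum M).IsHermitian := by
  ext ⟨x, i⟩ ⟨y, j⟩
  simp only [blockSum, conjTranspose_apply, of_apply]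
  by_cases hxy : x = y
  · subst hxy
    simpa using congrFun (congrFun (h x).eq i) j
  · simp [hxy, Ne.symm hxy]

omit [DecidableEq n] in
theorem trace_blockSum (M : X → Matrix n n ℂ) : (blockSum M).trace = ∑ x, (M x).trace := by
  simp [blockSum, trace, Fintype.sum_prod_type]

/-- Only the support projection of a block matrix is needed, so its algebraic characterization
suffices. -/
theorem mpow_zero_blockSum {M : X → Matrix n n ℂ} (h : ∀ x, (M x).IsHermitian) :
    mpow (blockSum M) 0 = blockSum fun x => mpow (M x) 0 := by
  refine (eq_mpow_zero (isHermitian_blockSum h)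
    (isHermitian_blockSum fun x => isHermitian_mpow (M x) 0)
    (G := blockSum fun x => cfc (fun t : ℝ => t⁻¹) (M x)) ?_ ?_).symm
  · rw [blockSum_mul]
    congr 1; ext1 x; exact mpow_zero_mul_self (h x)
  · rw [blockSum_mul]
    congr 1; ext1 x; exact mpow_zero_eq_mul (h x)

omit [DecidableEq n] in
theorem cqState_eq_blockSum (P : Dist X) (W : Channel X n) :
    cqState P W = blockSum fun x => P.1 x • (W x).1 := by
  ext ⟨x, i⟩ ⟨y, j⟩
  simp only [cqState, blockSum, Matrix.sum_apply, Matrix.smul_apply, of_apply, kroneckerMap_apply,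
    single_apply]
  by_cases h : x = y
  · subst h
    rw [Finset.sum_eq_single x (fun z _ hz => by simp [hz]) (by simp)]
    simp
  · rw [if_neg h]
    refine Finset.sum_eq_zero fun z _ => ?_
    by_cases h1 : z = x
    · subst h1; simp [h]
    · simp [h1]

omit [DecidableEq n] in
theorem prodState_eq_blockSum (P : Dist X) (σ : State n) :
    prodState P σ = blockSum fun x => P.1 x • σ.1 := by
  ext ⟨x, i⟩ ⟨y, j⟩
  simp only [prodState, blockSum, Matrix.smul_apply, of_apply, kroneckerMap_apply, diagonal_apply]
  by_cases h : x = y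
  · subst h; simp
  · simp [h]

omit [DecidableEq n] in
theorem posSemidef_cqState (P : Dist X) (W : Channel X n) : (cqState P W).PosSemidef := by
  refine posSemidef_sum _ fun x _ => ?_
  have h1 : (single x x (1 : ℂ)).PosSemidef := by
    rw [← diagonal_single]
    exact PosSemidef.diagonal (Pi.single_nonneg.2 zero_le_one)
  exact (h1.kronecker (W x).2.1).smul (Complex.zero_le_real.2 (P.2.1 x))

omit [DecidableEq n] in
theorem posSemidef_prodState (P : Dist X) (σ : State n) : (prodState P σ).PosSemidef :=
  (PosSemidef.diagonal fun x => Complex.zero_le_real.2 (P.2.1 x)).kronecker σ.2.1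

theorem petzDiv_zero_cqState (P : Dist X) (W : Channel X n) (σ : State n) :
    petzDiv 0 (cqState P W) (prodState P σ) =
      renyiOfQ 0 (∑ x, P.1 x * (mpow (W x).1 0 * σ.1).trace.re) := by
  rw [petzDiv_zero (posSemidef_cqState P W) (posSemidef_prodState P σ), cqState_eq_blockSum,
    prodState_eq_blockSum, mpow_zero_blockSum fun x => ((W x).2.1.smul (P.2.1 x)).1, blockSum_mul,
    trace_blockSum, Complex.re_sum]
  congr 1
  refine Finset.sum_congr rfl fun x _ => ?_
  rcases (P.2.1 x).eq_or_lt with h | h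
  · simp [← h]
  · rw [mpow_zero_smul h.ne' (W x).2.1.1, Matrix.mul_smul, trace_smul, Complex.smul_re, smul_eq_mul]

/-- A real `r` strictly between `R_∞` and `R` turns the hypothesis into a bound with a gap `R - r`
that is the same for all `P`. -/
theorem exists_rate_lt {W : Channel X n} {R : ℝ} (hR : rateInfty W < (R : EReal)) :
    ∃ r : ℝ, r < R ∧ ∀ P : Dist X, ∃ σ : State n,
      Real.exp (-r) < ∑ x, P.1 x * (mpow (W x).1 0 * σ.1).trace.re := by
  obtain ⟨r, hr, hrR⟩ := EReal.lt_iff_exists_real_btwn.1 hR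
  refine ⟨r, EReal.coe_lt_coe_iff.1 hrR, fun P => ?_⟩
  have h1 : renyiInfo 0 P W < (r : EReal) := (le_iSup (fun P => renyiInfo 0 P W) P).trans_lt hr
  obtain ⟨σ, hσ⟩ := iInf_lt_iff.1 h1
  refine ⟨σ, ?_⟩
  rw [petzDiv_zero_cqState] at hσ
  set q := ∑ x, P.1 x * (mpow (W x).1 0 * σ.1).trace.re
  have hq : 0 < q := by
    by_contra h
    rw [renyiOfQ_of_nonpos one_pos (not_lt.1 h)] at hσ
    exact not_top_lt hσ
  rw [renyiOfQ_of_pos hq, EReal.coe_lt_coe_iff] at hσ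
  rw [← Real.lt_log_iff_exp_lt hq]
  norm_num at hσ
  linarith

end Blocks

/-! ### The strong exponent -/

section Strong

variable {X n : Type*} [Fintype X] [Fintype n] [DecidableEq n]

/-- The averaged power `∑ₓ P(x) W_x ^ α`. -/
def avgPow (W : Channel X n) (α : ℝ) (P : Dist X) : Matrix n n ℂ :=
  ∑ x, P.1 x • mpow (W x).1 α

theorem posSemidef_avgPow (W : Channel X n) (α : ℝ) (P : Dist X) : (avgPow W α P).PosSemidef :=
  posSemidef_sum _ fun x _ => (posSemidef_mpow (W x).2.1 α).smul (P.2.1 x)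

theorem trace_avgPow_mul (W : Channel X n) (α : ℝ) (P : Dist X) (M : Matrix n n ℂ) :
    (avgPow W α P * M).trace.re = ∑ x, P.1 x * (mpow (W x).1 α * M).trace.re := by
  simp only [avgPow, Finset.sum_mul, trace_sum, Complex.re_sum, Matrix.smul_mul, trace_smul,
    Complex.smul_re, smul_eq_mul]

theorem one_le_trace_mpow_state (ρ : State n) {α : ℝ} (h0 : 0 < α) (h1 : α ≤ 1) :
    1 ≤ (mpow ρ.1 α).trace.re := by
  have h : (ρ.1.trace).re = 1 := by rw [ρ.2.2, Complex.one_re]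
  rw [trace_mpow ρ.2.1.1 h0.ne', ← h, ← sum_eigenvalues_eq_trace_re ρ.2.1.1]
  refine Finset.sum_le_sum fun i _ => ?_
  have hb0 := ρ.2.1.eigenvalues_nonneg i
  have hb1 := ρ.eigenvalues_le_one i
  rcases hb0.eq_or_lt with hb | hb
  · rw [← hb, Real.zero_rpow h0.ne']
  · conv_lhs => rw [← Real.rpow_one (ρ.2.1.1.eigenvalues i)]
    exact Real.rpow_le_rpow_of_exponent_ge hb hb1 h1

theorem trace_avgPow_pos (W : Channel X n) {α : ℝ} (h0 : 0 < α) (h1 : α ≤ 1) (P : Dist X) :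
    0 < (avgPow W α P).trace.re := by
  have h := trace_avgPow_mul W α P 1
  simp only [mul_one] at h
  rw [h]
  refine zero_lt_one.trans_le ?_
  rw [← P.2.2]
  refine Finset.sum_le_sum fun x _ => ?_
  conv_lhs => rw [← mul_one (P.1 x)]
  exact mul_le_mul_of_nonneg_left (one_le_trace_mpow_state (W x) h0 h1) (P.2.1 x)

/-- `Tr[(∑ₓ P(x) W_x ^ (1/(1+s))) ^ (1+s)]`. -/
def auxZ (W : Channel X n) (s : ℝ) (P : Dist X) : ℝ :=
  (mpow (avgPow W (1 / (1 + s)) P) (1 + s)).trace.re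

theorem auxE0_eq (W : Channel X n) (s : ℝ) (P : Dist X) : auxE0 W s P = -Real.log (auxZ W s P) :=
  rfl

theorem inv_one_add_mem {s : ℝ} (hs : 0 ≤ s) : 0 < 1 / (1 + s) ∧ 1 / (1 + s) ≤ 1 :=
  ⟨by positivity, by rw [div_le_one (by positivity)]; linarith⟩

theorem auxZ_pos (W : Channel X n) {s : ℝ} (hs : 0 ≤ s) (P : Dist X) : 0 < auxZ W s P :=
  trace_mpow_pos (posSemidef_avgPow W _ P)
    (trace_avgPow_pos W (inv_one_add_mem hs).1 (inv_one_add_mem hs).2 P) _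

theorem auxE0_zero (W : Channel X n) (P : Dist X) : auxE0 W 0 P = 0 := by
  have h : ∑ x, P.1 x • (W x).1 = (avgState P W).1 := rfl
  rw [auxE0_eq, auxZ, add_zero, div_one, mpow_one (posSemidef_avgPow W 1 P).1, avgPow]
  simp only [mpow_one (W _).2.1.1]
  rw [h, (avgState P W).2.2]
  simp

/-- One half of Sibson's identity. -/
theorem auxE0_le (W : Channel X n) {s : ℝ} (hs : 0 < s) (P : Dist X) (σ : State n)
    (hQ : 0 < ∑ x, P.1 x * petzQPos (1 / (1 + s)) (W x).1 σ.1) :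
    auxE0 W s P ≤ -((1 + s) * Real.log (∑ x, P.1 x * petzQPos (1 / (1 + s)) (W x).1 σ.1)) := by
  have hZ : 0 < (mpow (avgPow W (1 / (1 + s)) P) (1 + s)).trace.re := auxZ_pos W hs.le P
  have h := trace_mul_mpow_le (p := 1 + s) (by linarith) (posSemidef_avgPow W (1 / (1 + s)) P) hZ σ
  rw [trace_avgPow_mul] at h
  have h2 := Real.log_le_log hQ h
  rw [Real.log_rpow hZ, one_div_mul_eq_div, le_div_iff₀ (by positivity)] at h2
  rw [auxE0_eq, auxZ]
  linarith

/-- Jensen's inequality from `log u ≤ u - 1` at `u = q x / Q`; letters of probability zero need no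
positivity. -/
theorem sum_mul_log_le (P : Dist X) {q : X → ℝ} (hq : ∀ x, 0 < P.1 x → 0 < q x) :
    0 < ∑ x, P.1 x * q x ∧ ∑ x, P.1 x * Real.log (q x) ≤ Real.log (∑ x, P.1 x * q x) := by
  have hnn : ∀ x, 0 ≤ P.1 x * q x := fun x => by
    rcases (P.2.1 x).eq_or_lt with h | h
    · rw [← h, zero_mul]
    · exact (mul_pos h (hq x h)).le
  have hQ : 0 < ∑ x, P.1 x * q x := by
    obtain ⟨x, -, hx⟩ := Finset.exists_lt_of_sum_lt (s := Finset.univ) (f := fun _ : X => (0 : ℝ))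
      (g := P.1) (by rw [P.2.2]; simp)
    exact Finset.sum_pos' (fun x _ => hnn x) ⟨x, Finset.mem_univ x, mul_pos hx (hq x hx)⟩
  refine ⟨hQ, ?_⟩
  set Q := ∑ x, P.1 x * q x with hQd
  have h : ∀ x, P.1 x * Real.log (q x) ≤ P.1 x * Real.log Q + (P.1 x * q x) / Q - P.1 x :=
    fun x => by
      rcases (P.2.1 x).eq_or_lt with hx | hx
      · simp [← hx]
      · have := Real.log_le_sub_one_of_pos (div_pos (hq x hx) hQ)
        rw [Real.log_div (hq x hx).ne' hQ.ne'] at this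
        have h2 := mul_le_mul_of_nonneg_left this hx.le
        rw [mul_div_assoc]
        linarith
  refine (Finset.sum_le_sum fun x _ => h x).trans (le_of_eq ?_)
  rw [Finset.sum_sub_distrib, Finset.sum_add_distrib, ← Finset.sum_mul, ← Finset.sum_div, ← hQd,
    P.2.2, div_self hQ.ne']
  ring

theorem petzObjective_one (W : Channel X n) (R : ℝ) (P : Dist X) (σ : State n) :
    petzObjective W R P 1 σ = 0 := by
  simp [petzObjective]

omit [Fintype X] in
theorem petzDiv_state (W : Channel X n) {α : ℝ} (h0 : 0 < α) (h1 : α < 1) (x : X) (σ : State n) :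
    petzDiv α (W x).1 σ.1 = renyiOfQ α (petzQPos α (W x).1 σ.1) :=
  petzDiv_eq h0 h1 (W x).2.1.1 σ.2.1.1

theorem exists_eq_iInf_petzObjective [Nonempty X] (W : Channel X n) (R : ℝ) (P : Dist X)
    {α : ℝ} (hα : α ∈ Set.Ioc (0 : ℝ) 1) : ∃ σ : State n, petzObjective W R P α σ =
      ⨅ τ : State n, petzObjective W R P α τ := by
  have : Nonempty (State n) := ⟨W (Classical.arbitrary X)⟩
  rcases hα.2.eq_or_lt with rfl | h1
  · exact ⟨Classical.arbitrary _, by simp [petzObjective_one]⟩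
  · refine exists_eq_iInf_objective (S := fun σ => condPetzDiv α W σ P) ?_
      (div_nonneg (by linarith) hα.1.le) R
    refine lowerSemicontinuous_weighted_sum P
      (fun x σ => by rw [petzDiv_state W hα.1 h1]; exact renyiOfQ_ne_bot h1 _) fun x => ?_
    simp only [petzDiv_state W hα.1 h1]
    refine Continuous.lowerSemicontinuous ((continuous_renyiOfQ h1).comp
      (continuous_trace_re.comp (continuous_const.mul ?_)))
    exact continuous_mpow continuous_subtype_val (fun σ => σ.2.1.1) continuous_const
      fun _ => by linarith

theorem auxE0_le_petzObjective (W : Channel X n) (R : ℝ) (P : Dist X) {s : ℝ} (hs : 0 < s)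
    (σ : State n) :
    ((auxE0 W s P - s * R : ℝ) : EReal) ≤ petzObjective W R P (1 / (1 + s)) σ := by
  set α := 1 / (1 + s) with hα
  have h0 : 0 < α := by positivity
  have h1 : α < 1 := by rw [hα, div_lt_one (by positivity)]; linarith
  have hαs : (1 - α) / α = s := by rw [hα]; field_simp; ring
  set q : X → ℝ := fun x => petzQPos α (W x).1 σ.1
  rw [petzObjective, hαs]
  by_cases hq : ∀ x, 0 < P.1 x → 0 < q x
  · have hc : condPetzDiv α W σ P = ((∑ x, P.1 x * ((α - 1)⁻¹ * Real.log (q x)) : ℝ) : EReal) :=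
      weighted_sum_coe P fun x hx => by rw [petzDiv_state W h0 h1, renyiOfQ_of_pos (hq x hx)]
    rw [hc, coe_objective, EReal.coe_le_coe_iff]
    obtain ⟨hQ, hJ⟩ := sum_mul_log_le P hq
    have h2 := auxE0_le W hs P σ hQ
    have e : ∑ x, P.1 x * ((α - 1)⁻¹ * Real.log (q x)) =
        (α - 1)⁻¹ * ∑ x, P.1 x * Real.log (q x) := by
      rw [Finset.mul_sum]
      exact Finset.sum_congr rfl fun x _ => by ring
    have e2 : s * (α - 1)⁻¹ = -(1 + s) := by
      have : α - 1 = -(s / (1 + s)) := by rw [hα]; field_simp; ring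
      rw [this, inv_neg, inv_div]
      field_simp
    rw [e, mul_sub, ← mul_assoc, e2]
    have h3 := mul_le_mul_of_nonneg_left hJ (show 0 ≤ 1 + s by positivity)
    linarith
  · push Not at hq
    obtain ⟨x, hx, hqx⟩ := hq
    have htop : condPetzDiv α W σ P = ⊤ :=
      weighted_sum_top P (fun y => by
        rw [petzDiv_state W h0 h1]; exact renyiOfQ_ne_bot h1 _) hx
        (by rw [petzDiv_state W h0 h1, renyiOfQ_of_nonpos h1 hqx])
    rw [htop, EReal.top_sub_coe, EReal.coe_mul_top_of_pos hs]
    exact le_top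

theorem strongExponentAt_le [Nonempty X] (W : Channel X n) (R : ℝ) (P : Dist X) :
    strongExponentAt W R P ≤
      ⨆ α ∈ Set.Ioc (0 : ℝ) 1, ⨅ σ : State n, petzObjective W R P α σ := by
  have : Nonempty (State n) := ⟨W (Classical.arbitrary X)⟩
  refine iSup₂_le fun s hs => ?_
  refine le_trans ?_ (le_iSup₂ (f := fun α (_ : α ∈ Set.Ioc (0 : ℝ) 1) =>
    ⨅ σ : State n, petzObjective W R P α σ) (1 / (1 + s)) (inv_one_add_mem hs))
  refine le_iInf fun σ => ?_
  rcases (Set.mem_Ici.1 hs).eq_or_lt with rfl | hs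
  · rw [auxE0_zero, add_zero, div_one, petzObjective_one]
    simp
  · exact auxE0_le_petzObjective W R P hs σ

theorem continuous_avgPow {Y : Type*} [TopologicalSpace Y] (W : Channel X n) {α : Y → ℝ}
    {P : Y → Dist X} (hα : Continuous α) (hα0 : ∀ y, 0 < α y) (hP : Continuous P) :
    Continuous fun y => avgPow W (α y) (P y) :=
  continuous_finsetSum _ fun x _ => Continuous.smul
    ((continuous_apply x).comp (continuous_subtype_val.comp hP))
    (continuous_mpow continuous_const (fun _ => (W x).2.1.1) hα hα0)

theorem continuous_auxZ {Y : Type*} [TopologicalSpace Y] (W : Channel X n) {s : Y → ℝ}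
    {P : Y → Dist X} (hs : Continuous s) (hs0 : ∀ y, 0 ≤ s y) (hP : Continuous P) :
    Continuous fun y => auxZ W (s y) (P y) := by
  have h1 : ∀ y, 0 < 1 + s y := fun y => by linarith [hs0 y]
  refine continuous_trace_re.comp (continuous_mpow
    (continuous_avgPow W ?_ (fun y => (inv_one_add_mem (hs0 y)).1) hP)
    (fun y => (posSemidef_avgPow W _ _).1) (by fun_prop) h1)
  exact continuous_const.div (by fun_prop) fun y => (h1 y).ne'

/-- The optimal output state at a maximizer of `E₀(s, ·)` bounds all letters simultaneously. -/
theorem exists_optimal_state [Nonempty X] (W : Channel X n) {s : ℝ} (hs : 0 < s) :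
    ∃ (P : Dist X) (σ : State n), ∀ x,
      auxZ W s P ^ (1 / (1 + s)) ≤ petzQPos (1 / (1 + s)) (W x).1 σ.1 := by
  classical
  obtain ⟨P, -, hP⟩ := isCompact_univ.exists_isMinOn (Set.univ_nonempty (α := Dist X))
    (continuous_auxZ W continuous_const (fun _ => hs.le) continuous_id).continuousOn
  have hmin : ∀ P', auxZ W s P ≤ auxZ W s P' := fun P' => hP (Set.mem_univ P')
  set p := 1 + s with hp
  have hp1 : 1 < p := by linarith
  have hp0 : 0 < p := by linarith
  set A := avgPow W (1 / p) P with hA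
  have hAp : A.PosSemidef := posSemidef_avgPow W _ P
  set Z := auxZ W s P with hZ
  have hZ0 : 0 < Z := auxZ_pos W hs.le P
  have hZA : Z = (mpow A p).trace.re := rfl
  -- The state `A ^ p / Z` is the equality case of the Hölder bound; its power of order `1 - 1 / p`
  -- is a multiple of `A ^ (p - 1)`, the gradient direction of `Tr A ^ p`.
  have hσp : (cfc (fun t : ℝ => t ^ p / Z) A).PosSemidef := posSemidef_cfc hAp.1 fun i =>
    div_nonneg (Real.rpow_nonneg (hAp.eigenvalues_nonneg i) p) hZ0.le
  have hσt : (cfc (fun t : ℝ => t ^ p / Z) A).trace.re = 1 := by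
    rw [trace_cfc hAp.1, ← Finset.sum_div, ← trace_mpow hAp.1 hp0.ne', ← hZA, div_self hZ0.ne']
  refine ⟨P, ⟨_, hσp, Complex.ext hσt (Complex.nonneg_iff.1 hσp.trace_nonneg).2.symm⟩, fun x => ?_⟩
  have hpi : 1 / p < 1 := by rw [div_lt_one hp0]; exact hp1
  have hpow : mpow (cfc (fun t : ℝ => t ^ p / Z) A) (1 - 1 / p) =
      (Z ^ (1 - 1 / p))⁻¹ • mpow A (p - 1) := by
    rw [mpow_eq_cfc (by linarith), mpow_eq_cfc (by linarith), cfc_cfc hAp.1,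
      ← cfc_smul _ _ A (continuousOn_spectrum _ A)]
    refine cfc_congr_eigen hAp.1 fun i => ?_
    have ha := hAp.eigenvalues_nonneg i
    rw [Real.div_rpow (Real.rpow_nonneg ha p) hZ0.le, ← Real.rpow_mul ha, mul_sub, mul_one,
      mul_one_div_cancel hp0.ne', smul_eq_mul, div_eq_inv_mul]
  have hopt : Z ≤ (mpow (W x).1 (1 / p) * mpow A (p - 1)).trace.re := by
    rw [hZA]
    refine trace_mpow_le_of_min hp1 hAp (posSemidef_mpow (W x).2.1 _) fun t ht0 ht1 => ?_
    -- Moving `P` towards the point mass at `x` moves `A` along the segment towards `W_x ^ (1 / p)`.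
    let Pt : Dist X := ⟨(1 - t) • P.1 + t • Pi.single x 1,
      convex_stdSimplex ℝ X P.2 (single_mem_stdSimplex ℝ x) (by linarith) ht0.le (by ring)⟩
    have h := hmin Pt
    have e : avgPow W (1 / p) Pt = (1 - t) • A + t • mpow (W x).1 (1 / p) := by
      rw [hA, avgPow, avgPow, Finset.smul_sum]
      have : t • mpow (W x).1 (1 / p) =
          ∑ y, (t * (Pi.single x (1 : ℝ) : X → ℝ) y) • mpow (W y).1 (1 / p) := by
        rw [Finset.sum_eq_single x (fun y _ hy => by simp [hy]) (by simp)]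
        simp
      rw [this, ← Finset.sum_add_distrib]
      refine Finset.sum_congr rfl fun y _ => ?_
      rw [← mul_smul, ← add_smul]
      rfl
    rw [hZA, auxZ, e] at h
    exact h
  rw [petzQPos, hpow, Matrix.mul_smul, trace_smul, Complex.smul_re, smul_eq_mul]
  have hZ1 : 0 < Z ^ (1 - 1 / p) := Real.rpow_pos_of_pos hZ0 _
  rw [← div_eq_inv_mul, le_div_iff₀ hZ1, ← Real.rpow_add hZ0]
  simpa using hopt

theorem le_strongExponentAt (W : Channel X n) (R : ℝ) (P : Dist X) {s : ℝ} (hs : 0 ≤ s) :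
    ((auxE0 W s P - s * R : ℝ) : EReal) ≤ strongExponentAt W R P :=
  le_iSup₂ (f := fun s (_ : s ∈ Set.Ici (0 : ℝ)) => ((auxE0 W s P - s * R : ℝ) : EReal)) s hs

/-- The state of `exists_optimal_state` bounds every letter by one constant, so the same `P` and `σ`
serve all `P'` at once. -/
theorem iInf_petzObjective_le [Nonempty X] (W : Channel X n) (R : ℝ) {α : ℝ}
    (hα : α ∈ Set.Ioc (0 : ℝ) 1) : ∃ P : Dist X, ∀ P' : Dist X,
      ⨅ σ : State n, petzObjective W R P' α σ ≤ strongExponentAt W R P := by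
  have : Nonempty (State n) := ⟨W (Classical.arbitrary X)⟩
  rcases hα.2.eq_or_lt with rfl | h1
  · refine ⟨Classical.arbitrary _, fun P' => ?_⟩
    simp only [petzObjective_one, ciInf_const]
    have := le_strongExponentAt W R (Classical.arbitrary _) le_rfl
    simpa [auxE0_zero] using this
  · have h0 := hα.1
    have hα1 : 0 < 1 - α := by linarith
    set s := (1 - α) / α with hs
    have hs0 : 0 < s := by positivity
    have hsα : 1 / (1 + s) = α := by rw [hs]; field_simp; ring
    obtain ⟨P, σ, h⟩ := exists_optimal_state W hs0
    rw [hsα] at h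
    refine ⟨P, fun P' => (iInf_le _ σ).trans (le_trans ?_ (le_strongExponentAt W R P hs0.le))⟩
    have hZ0 := auxZ_pos W hs0.le P
    have hq : ∀ x, 0 < petzQPos α (W x).1 σ.1 := fun x =>
      (Real.rpow_pos_of_pos hZ0 α).trans_le (h x)
    have hc : condPetzDiv α W σ P' =
        ((∑ x, P'.1 x * ((α - 1)⁻¹ * Real.log (petzQPos α (W x).1 σ.1)) : ℝ) : EReal) :=
      weighted_sum_coe P' fun x _ => by rw [petzDiv_state W h0 h1, renyiOfQ_of_pos (hq x)]
    rw [petzObjective, ← hs, hc, coe_objective, EReal.coe_le_coe_iff, mul_sub]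
    refine sub_le_sub_right ?_ _
    have h2 : ∑ x, P'.1 x * ((α - 1)⁻¹ * Real.log (petzQPos α (W x).1 σ.1)) ≤
        ∑ x, P'.1 x * ((α - 1)⁻¹ * (α * Real.log (auxZ W s P))) :=
      Finset.sum_le_sum fun x _ => by
        refine mul_le_mul_of_nonneg_left (mul_le_mul_of_nonpos_left ?_
          (inv_nonpos.2 (by linarith))) (P'.2.1 x)
        rw [← Real.log_rpow hZ0]
        exact Real.log_le_log (Real.rpow_pos_of_pos hZ0 α) (h x)
    rw [← Finset.sum_mul, P'.2.2, one_mul] at h2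
    refine (mul_le_mul_of_nonneg_left h2 hs0.le).trans (le_of_eq ?_)
    rw [auxE0_eq, hs, ← neg_sub 1 α, inv_neg]
    field_simp

theorem exists_pos_le_eigenvalues (W : Channel X n) :
    ∃ c : ℝ, 0 < c ∧ c ≤ 1 ∧ ∀ x i, (W x).2.1.1.eigenvalues i ≠ 0 →
      c ≤ (W x).2.1.1.eigenvalues i := by
  classical
  let S : Finset ℝ := insert 1 ((Finset.univ.image fun z : X × n =>
    (W z.1).2.1.1.eigenvalues z.2).filter (· ≠ 0))
  have hS : S.Nonempty := Finset.insert_nonempty _ _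
  refine ⟨S.min' hS, ?_, S.min'_le 1 (Finset.mem_insert_self _ _), fun x i hi => ?_⟩
  · have h := S.min'_mem hS
    rcases Finset.mem_insert.1 h with h | h
    · rw [h]; exact one_pos
    · obtain ⟨h2, h3⟩ := Finset.mem_filter.1 h
      obtain ⟨z, -, hz⟩ := Finset.mem_image.1 h2
      refine lt_of_le_of_ne ?_ (Ne.symm h3)
      rw [← hz]
      exact (W z.1).2.1.eigenvalues_nonneg z.2
  · refine S.min'_le _ (Finset.mem_insert_of_mem (Finset.mem_filter.2 ⟨?_, hi⟩))
    exact Finset.mem_image.2 ⟨(x, i), Finset.mem_univ _, rfl⟩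

/-- Nonzero eigenvalues of `ρ` are at least `c`, and those of `σ` are at most one, so `b ≤ b ^ (1 -
α)`. This compares order `α` with order zero uniformly. -/
theorem trace_mpow_zero_le {c : ℝ} (hc0 : 0 < c) {ρ σ : State n}
    (hc : ∀ i, ρ.2.1.1.eigenvalues i ≠ 0 → c ≤ ρ.2.1.1.eigenvalues i)
    {α : ℝ} (h0 : 0 < α) (h1 : α < 1) :
    c ^ α * (mpow ρ.1 0 * σ.1).trace.re ≤ petzQPos α ρ.1 σ.1 := by
  have h := trace_cfc_mul_cfc_mono ρ.2.1.1 σ.2.1.1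
    (f := fun t : ℝ => c ^ α * (if t = 0 then 0 else t ^ (0 : ℝ))) (g := id)
    (f' := fun t : ℝ => t ^ α) (g' := fun t : ℝ => t ^ (1 - α)) (fun i j => by
      have hb := σ.2.1.eigenvalues_nonneg j
      have hb1 := σ.eigenvalues_le_one j
      have ha := ρ.2.1.eigenvalues_nonneg i
      have hbb : σ.2.1.1.eigenvalues j ≤ σ.2.1.1.eigenvalues j ^ (1 - α) := by
        rcases hb.eq_or_lt with h | h
        · rw [← h, Real.zero_rpow (by linarith)]
        · conv_lhs => rw [← Real.rpow_one (σ.2.1.1.eigenvalues j)]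
          exact Real.rpow_le_rpow_of_exponent_ge h hb1 (by linarith)
      by_cases hi : ρ.2.1.1.eigenvalues i = 0
      · simp [hi, Real.zero_rpow h0.ne']
      · simp only [hi, if_false, Real.rpow_zero, mul_one, id]
        exact mul_le_mul (Real.rpow_le_rpow hc0.le (hc i hi) h0.le) hbb hb
          (Real.rpow_nonneg ha α))
  rw [cfc_const_mul _ _ _ (continuousOn_spectrum _ _), cfc_id_of_isHermitian σ.2.1.1,
    Matrix.smul_mul, trace_smul, Complex.smul_re, smul_eq_mul,
    ← mpow_eq_cfc h0.ne', ← mpow_eq_cfc (by linarith)] at h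
  exact h

theorem trace_mpow_zero_mul_le_one (ρ σ : State n) : (mpow ρ.1 0 * σ.1).trace.re ≤ 1 := by
  have h := trace_cfc_mul_cfc_mono ρ.2.1.1 σ.2.1.1
    (f := fun t : ℝ => if t = 0 then 0 else t ^ (0 : ℝ)) (g := id)
    (f' := fun _ => 1) (g' := id) (fun i j => by
      refine mul_le_mul_of_nonneg_right ?_ (σ.2.1.eigenvalues_nonneg j)
      split_ifs <;> simp)
  rw [cfc_one_of_isHermitian ρ.2.1.1, cfc_id_of_isHermitian σ.2.1.1, one_mul, σ.2.2,
    Complex.one_re] at h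
  exact h

theorem rate_nonneg {W : Channel X n} {P : Dist X} {σ : State n} {r : ℝ}
    (h : Real.exp (-r) < ∑ x, P.1 x * (mpow (W x).1 0 * σ.1).trace.re) : 0 ≤ r := by
  have h1 : ∑ x, P.1 x * (mpow (W x).1 0 * σ.1).trace.re ≤ ∑ x, P.1 x * 1 :=
    Finset.sum_le_sum fun x _ =>
      mul_le_mul_of_nonneg_left (trace_mpow_zero_mul_le_one (W x) σ) (P.2.1 x)
  simp only [mul_one, P.2.2] at h1
  have := Real.exp_lt_one_iff.1 (h.trans_le h1)
  linarith

/-- Above the rate `R_∞` the supremum over `s` is effectively over a bounded interval. -/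
theorem exists_auxE0_sub_nonpos [Nonempty X] {W : Channel X n} {R r : ℝ} (hrR : r < R)
    (hr : ∀ P : Dist X, ∃ σ : State n,
      Real.exp (-r) < ∑ x, P.1 x * (mpow (W x).1 0 * σ.1).trace.re) :
    ∃ S : ℝ, 0 ≤ S ∧ ∀ s, S ≤ s → ∀ P : Dist X, auxE0 W s P - s * R ≤ 0 := by
  obtain ⟨c, hc0, hc1, hc⟩ := exists_pos_le_eigenvalues W
  have hr0 : 0 ≤ r := by
    obtain ⟨σ, hσ⟩ := hr (Classical.arbitrary _)
    exact rate_nonneg hσ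
  have hlc : Real.log c ≤ 0 := Real.log_nonpos hc0.le hc1
  have hd : 0 < R - r := by linarith
  -- The bounds below give `E₀(s, P) ≤ (1 + s) r - log c`, so the difference is at most `r - log c -
  -- s (R - r)`. The added `1` only ensures `s > 0`.
  refine ⟨(r - Real.log c) / (R - r) + 1, ?_, fun s hs P => ?_⟩
  · have : 0 ≤ (r - Real.log c) / (R - r) := div_nonneg (by linarith) hd.le
    linarith
  have hs' : (r - Real.log c) / (R - r) ≤ s := by linarith
  have hs0 : 0 < s := by
    have : 0 ≤ (r - Real.log c) / (R - r) := div_nonneg (by linarith) hd.le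
    linarith
  rw [div_le_iff₀ hd] at hs'
  obtain ⟨σ, hσ⟩ := hr P
  set α := 1 / (1 + s) with hα
  have h0 : 0 < α := by positivity
  have h1 : α < 1 := by rw [hα, div_lt_one (by positivity)]; linarith
  have hcα : 0 < c ^ α := Real.rpow_pos_of_pos hc0 α
  have hQ : c ^ α * Real.exp (-r) ≤ ∑ x, P.1 x * petzQPos α (W x).1 σ.1 := by
    refine (mul_le_mul_of_nonneg_left hσ.le hcα.le).trans ?_
    rw [Finset.mul_sum]
    refine Finset.sum_le_sum fun x _ => ?_
    rw [mul_left_comm]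
    exact mul_le_mul_of_nonneg_left (trace_mpow_zero_le hc0 (hc x) h0 h1) (P.2.1 x)
  have hpos : 0 < c ^ α * Real.exp (-r) := mul_pos hcα (Real.exp_pos _)
  have h2 := auxE0_le W hs0 P σ (hpos.trans_le hQ)
  have h3 := Real.log_le_log hpos hQ
  rw [Real.log_mul hcα.ne' (Real.exp_pos _).ne', Real.log_exp, Real.log_rpow hc0] at h3
  have h4 := mul_le_mul_of_nonneg_left h3 (show 0 ≤ 1 + s by positivity)
  have h5 : (1 + s) * (α * Real.log c + -r) = Real.log c - (1 + s) * r := by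
    rw [hα]; field_simp; ring
  rw [h5] at h4
  nlinarith

theorem continuous_auxE0_sub (W : Channel X n) (R S : ℝ) :
    Continuous fun y : Set.Icc 0 S × Dist X => auxE0 W y.1.1 y.2 - y.1.1 * R := by
  have hcZ : Continuous fun y : Set.Icc 0 S × Dist X => auxZ W y.1.1 y.2 :=
    continuous_auxZ W (continuous_subtype_val.comp continuous_fst) (fun y => y.1.2.1)
      continuous_snd
  simp only [auxE0_eq]
  exact (hcZ.log fun y => (auxZ_pos W y.1.2.1 y.2).ne').neg.sub
    ((continuous_subtype_val.comp continuous_fst).mul continuous_const)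

/-- A joint maximizer over `[0, S]` and the simplex is global, since beyond `S` the objective is at
most its value `0` at `s = 0`. -/
theorem exists_strongExponentAt_eq [Nonempty X] {W : Channel X n} {R r : ℝ} (hrR : r < R)
    (hr : ∀ P : Dist X, ∃ σ : State n,
      Real.exp (-r) < ∑ x, P.1 x * (mpow (W x).1 0 * σ.1).trace.re) :
    ∃ P : Dist X, strongExponentAt W R P = strongExponent W R := by
  obtain ⟨S, hS0, hS⟩ := exists_auxE0_sub_nonpos hrR hr
  have hne : Nonempty (Set.Icc 0 S) := ⟨⟨0, le_rfl, hS0⟩⟩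
  obtain ⟨y, -, hmax⟩ := isCompact_univ.exists_isMaxOn
    (Set.univ_nonempty (α := Set.Icc 0 S × Dist X)) (continuous_auxE0_sub W R S).continuousOn
  have hmax' : ∀ t, 0 ≤ t → t ≤ S → ∀ P' : Dist X,
      auxE0 W t P' - t * R ≤ auxE0 W y.1.1 y.2 - y.1.1 * R := fun t ht0 htS P' =>
    isMaxOn_iff.1 hmax (⟨t, ht0, htS⟩, P') (Set.mem_univ _)
  refine ⟨y.2, le_antisymm (le_iSup (fun P => strongExponentAt W R P) y.2) ?_⟩
  refine le_trans (iSup_le fun P' => iSup₂_le fun t ht => ?_)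
    (le_strongExponentAt W R y.2 y.1.2.1)
  rw [EReal.coe_le_coe_iff]
  rcases le_or_gt t S with h | h
  · exact hmax' t ht h P'
  · have h1 := hmax' 0 le_rfl hS0 P'
    rw [auxE0_zero] at h1
    linarith [hS t h.le P']

end Strong

end CQ

end

/-! ### Assembly of the theorem -/

theorem theorem1 {X n : Type*} [Fintype X] [DecidableEq X] [Nonempty X]
    [Fintype n] [DecidableEq n] (W : CQ.Channel X n) (R : ℝ)
    (hR : CQ.rateInfty W < (R : EReal)) :
    -- the infimum that defines the weak exponent, and both infima over `σ`, are minima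
    (∀ P : CQ.Dist X, ∃ V : CQ.Channel X n, CQ.mutualInfo P V ≤ (R : EReal) ∧
      CQ.condRelEntropy V W P = CQ.weakExponentAt W R P) ∧
    (∀ (P : CQ.Dist X), ∀ α ∈ Set.Ioc (0 : ℝ) 1,
      (∃ σ : CQ.State n, CQ.logEuclideanObjective W R P α σ =
        ⨅ τ : CQ.State n, CQ.logEuclideanObjective W R P α τ) ∧
      (∃ σ : CQ.State n, CQ.petzObjective W R P α σ =
        ⨅ τ : CQ.State n, CQ.petzObjective W R P α τ)) ∧
    -- the weak exponent
    (∀ P : CQ.Dist X, CQ.weakExponentAt W R P =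
      ⨆ α ∈ Set.Ioc (0 : ℝ) 1, ⨅ σ : CQ.State n, CQ.logEuclideanObjective W R P α σ) ∧
    -- the strong exponent, for each input distribution
    (∀ P : CQ.Dist X, CQ.strongExponentAt W R P ≤
      ⨆ α ∈ Set.Ioc (0 : ℝ) 1, ⨅ σ : CQ.State n, CQ.petzObjective W R P α σ) ∧
    -- the strong exponent, maximized over the input distributions (both maxima are attained)
    (∃ P : CQ.Dist X, CQ.strongExponentAt W R P = CQ.strongExponent W R) ∧
    IsGreatest (Set.range fun P : CQ.Dist X =>
        ⨆ α ∈ Set.Ioc (0 : ℝ) 1, ⨅ σ : CQ.State n, CQ.petzObjective W R P α σ)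
      (CQ.strongExponent W R) := by
  obtain ⟨r, hrR, hr⟩ := CQ.exists_rate_lt hR
  have hR0 : 0 ≤ R := by
    obtain ⟨σ, hσ⟩ := hr (Classical.arbitrary _)
    exact (CQ.rate_nonneg hσ).trans hrR.le
  have hupper : ∀ P : CQ.Dist X,
      ⨆ α ∈ Set.Ioc (0 : ℝ) 1, ⨅ σ : CQ.State n, CQ.petzObjective W R P α σ ≤
        CQ.strongExponent W R := fun P => iSup₂_le fun α hα => by
    obtain ⟨P', hP'⟩ := CQ.iInf_petzObjective_le W R hα
    exact (hP' P).trans (le_iSup (fun P => CQ.strongExponentAt W R P) P')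
  obtain ⟨P, hP⟩ := CQ.exists_strongExponentAt_eq hrR hr
  refine ⟨CQ.exists_eq_weakExponentAt W hR0, fun P α hα =>
    ⟨CQ.exists_eq_iInf_logEuclideanObjective W R P hα, CQ.exists_eq_iInf_petzObjective W R P hα⟩,
    CQ.weakExponentAt_eq W hR0, CQ.strongExponentAt_le W R, ⟨P, hP⟩, ⟨P, ?_⟩, ?_⟩
  -- A maximizer of the strong exponent also maximizes the dual expression, which lies between its
  -- `E_sp(R, P)` and the common upper bound.
  · exact le_antisymm (hupper P) (hP ▸ CQ.strongExponentAt_le W R P)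
  · rintro _ ⟨P', rfl⟩
    exact hupper P'
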